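/- Let $M$ be a connected complex manifold of complex dimension $n$. For a Kähler metric $g$ on $M$, written in local holomorphic coordinates as $(g_{i\bar j})$, let $\omega=\frac i2\sum g_{i\bar j}\,dz_i\wedge d\bar z_j$ be its Kähler form, $\mathrm{Ric}_{i\bar j}=-\partial_i\partial_{\bar j}\log\det(g)$ its Ricci tensor, $\rho=-i\,\partial\bar\partial\log\det(g)$ its Ricci form and $\mathrm{scal}=\sum g^{i\bar j}\mathrm{Ric}_{i\bar j}$ its scalar curvature. For $1\le k\le n$ its $k$-th generalized scalar curvature $\rho_k(g)$ is defined by $$\frac{\det(g_{i\bar j}+s\,\mathrm{Ric}_{i\bar j})}{\det(g_{i\bar j})}=1+\sum_{k=1}^n\rho_k(g)\,s^k .$$ Consider the following sets of Kähler metrics $g$ on $M$: - $\mathcal{KE}(M)$: the Kähler–Einstein metrics, i.e. $\rho=\lambda\omega$ for some $\lambda\in\mathbb R$; - $\mathcal{E}xt(M)$: the extremal metrics, i.e. the $(1,0)$-part of the Hamiltonian vector field of $\mathrm{scal}$ is holomorphic; - $\mathcal{KRS}(M)$: the metrics associated to a Kähler–Ricci soliton, i.e. $\rho=\lambda\omega+L_X\omega$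 for some $\lambda\in\mathbb R$ and some (real) holomorphic vector field $X$ on $M$; - $\mathcal C_k(M)$, $1\le k\le n$: the metrics for which $\rho_k(g)$ is constant on $M$; - $\mathcal{R}ad(M)$: the radial metrics, i.e. there is a global Kähler potential $\Phi:M\to\mathbb R$, $\omega=\frac i2\partial\bar\partial\Phi$, such that around every point of $M$ there are local holomorphic coordinates $z_1,\dots,z_n$ in which $\Phi$ depends only on $|z_1|^2+\dots+|z_n|^2$. Then: (i) $\mathcal{E}xt(M)\cap\mathcal{KRS}(M)\cap\mathcal{R}ad(M)=\mathcal{KE}(M)\cap\mathcal{R}ad(M)$; (ii) $\mathcal C_k(M)\cap\mathcal C_h(M)\cap\mathcal{R}ad(M)=\mathcal{KE}(M)\cap\mathcal{R}ad(M)$ for all $1\le h,k\le n$ with $h\ne k$; (iii) $\mathcal C_k(M)\cap\mathcal{E}xt(M)\cap\mathcal{R}ad(M)=\mathcal{KE}(M)\cap\mathcal{R}ad(M)$ for all $1<k\le n$; (iv) $\mathcal C_k(M)\cap\mathcal{KRS}(M)\cap\mathcal{R}ad(M)=\mathcal{KE}(M)\cap\mathcal{R}ad(M)$ for all $1\le k\le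 n$. -/

import Mathlib

open scoped Manifold ContDiff ComplexConjugate

noncomputable section

namespace RadialKahler

/-- The Wirtinger derivative `∂u/∂z_i` on `ℂⁿ`. -/
def wirtinger {n : ℕ} (u : (Fin n → ℂ) → ℂ) (i : Fin n) (z : Fin n → ℂ) : ℂ :=
  (fderiv ℝ u z (Pi.single i 1) - Complex.I * fderiv ℝ u z (Pi.single i Complex.I)) / 2

/-- The Wirtinger derivative `∂u/∂z̄_i` on `ℂⁿ`. -/
def wirtingerBar {n : ℕ} (u : (Fin n → ℂ) → ℂ) (i : Fin n) (z : Fin n → ℂ) : ℂ :=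
  (fderiv ℝ u z (Pi.single i 1) + Complex.I * fderiv ℝ u z (Pi.single i Complex.I)) / 2

/-- The second derivative `∂²u/∂z_i∂z̄_j`. -/
def ddbar {n : ℕ} (u : (Fin n → ℂ) → ℂ) (i j : Fin n) (z : Fin n → ℂ) : ℂ :=
  wirtinger (wirtingerBar u j) i z

/-- The local holomorphic coordinate systems of `M`: all charts of the maximal holomorphic atlas. -/
abbrev holoCharts (n : ℕ) (M : Type*) [TopologicalSpace M] [ChartedSpace (Fin n → ℂ) M] :
    Set (OpenPartialHomeomorph M (Fin n → ℂ)) :=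
  IsManifold.maximalAtlas 𝓘(ℂ, Fin n → ℂ) ω M

section Local

variable {n : ℕ} {M : Type*} [TopologicalSpace M] [ChartedSpace (Fin n → ℂ) M]

/-- The coordinate vector `∂/∂z_i` of the chart `e` at the point with coordinates `z`. -/
def coordVector (e : OpenPartialHomeomorph M (Fin n → ℂ)) (z : Fin n → ℂ) (i : Fin n) :
    TangentSpace 𝓘(ℂ, Fin n → ℂ) (e.symm z) :=
  mfderiv 𝓘(ℂ, Fin n → ℂ) 𝓘(ℂ, Fin n → ℂ) e.symm z (Pi.single i (1 : ℂ) : Fin n → ℂ)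

/-- The matrix `h(∂/∂z_i, ∂/∂z_j)` of a field of sesquilinear forms in the chart `e`. -/
def formMatrix
    (h : ∀ p : M, TangentSpace 𝓘(ℂ, Fin n → ℂ) p →ₗ[ℂ]
      TangentSpace 𝓘(ℂ, Fin n → ℂ) p →ₗ⋆[ℂ] ℂ)
    (e : OpenPartialHomeomorph M (Fin n → ℂ)) (z : Fin n → ℂ) : Matrix (Fin n) (Fin n) ℂ :=
  fun i j => h (e.symm z) (coordVector e z i) (coordVector e z j)

/-- The components of a vector field in the chart `e`, at the point with coordinates `z`. -/
def vectorCoord (X : ∀ p : M, TangentSpace 𝓘(ℂ, Fin n → ℂ) p)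
    (e : OpenPartialHomeomorph M (Fin n → ℂ)) (z : Fin n → ℂ) : Fin n → ℂ :=
  mfderiv 𝓘(ℂ, Fin n → ℂ) 𝓘(ℂ, Fin n → ℂ) e (e.symm z) (X (e.symm z))

/-- A vector field is holomorphic if its components in all holomorphic charts are holomorphic
functions. The tangent space at `p` is the real tangent space, with complex structure the
multiplication by `i`; so `X` is a real vector field whose flow preserves the complex structure,
and in a chart it is the derivation `∑ X^j ∂/∂z_j + ∑ conj X^j ∂/∂z̄_j`. -/
def IsHolomorphicVectorField (X : ∀ p : M, TangentSpace 𝓘(ℂ, Fin n → ℂ) p) : Prop :=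
  ∀ e ∈ holoCharts n M, DifferentiableOn ℂ (vectorCoord X e) e.target

end Local

/-- A Kähler metric, given by its positive definite Hermitian form `h` on the tangent spaces
(linear in the first variable). Its Riemannian metric is `Re h`. In local coordinates
`g_{ij̄} = h(∂/∂z_i, ∂/∂z_j)`, and the Kähler form is `(i/2) ∑ g_{ij̄} dz_i ∧ dz̄_j`; it is closed. -/
structure KahlerMetric (n : ℕ) (M : Type*) [TopologicalSpace M]
    [ChartedSpace (Fin n → ℂ) M] where
  form : ∀ p : M, TangentSpace 𝓘(ℂ, Fin n → ℂ) p →ₗ[ℂ]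
    TangentSpace 𝓘(ℂ, Fin n → ℂ) p →ₗ⋆[ℂ] ℂ
  hermitian : ∀ p v w, form p w v = conj (form p v w)
  posDef : ∀ p v, v ≠ 0 → 0 < (form p v v).re
  smooth : ∀ e ∈ holoCharts n M, ∀ i j : Fin n,
    ContDiffOn ℝ ∞ (fun z => formMatrix form e z i j) e.target
  closed : ∀ e ∈ holoCharts n M, ∀ z ∈ e.target, ∀ i j k : Fin n,
    wirtinger (fun w => formMatrix form e w i j) k z
      = wirtinger (fun w => formMatrix form e w k j) i z

section Geometry

variable {n : ℕ} {M : Type*} [TopologicalSpace M] [ChartedSpace (Fin n → ℂ) M]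

/-- The matrix `g_{ij̄}` in the chart `e`. -/
def metricMatrix (g : KahlerMetric n M) (e : OpenPartialHomeomorph M (Fin n → ℂ))
    (z : Fin n → ℂ) : Matrix (Fin n) (Fin n) ℂ :=
  formMatrix g.form e z

/-- The Ricci tensor `Ric_{ij̄} = - ∂²(log det g)/∂z_i∂z̄_j` in the chart `e` (the determinant is
real and positive). -/
def ricciMatrix (g : KahlerMetric n M) (e : OpenPartialHomeomorph M (Fin n → ℂ))
    (z : Fin n → ℂ) : Matrix (Fin n) (Fin n) ℂ :=
  fun i j => - ddbar (fun w => (Real.log (metricMatrix g e w).det.re : ℂ)) i j z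

/-- The components of the Kähler form `ω` with respect to `(i/2) dz_i ∧ dz̄_j`. -/
def kahlerForm (g : KahlerMetric n M) (e : OpenPartialHomeomorph M (Fin n → ℂ))
    (z : Fin n → ℂ) : Matrix (Fin n) (Fin n) ℂ :=
  metricMatrix g e z

/-- The components of the Ricci form `ρ = -i ∂∂̄ log det g` with respect to
`(i/2) dz_i ∧ dz̄_j`. -/
def ricciForm (g : KahlerMetric n M) (e : OpenPartialHomeomorph M (Fin n → ℂ))
    (z : Fin n → ℂ) : Matrix (Fin n) (Fin n) ℂ :=
  fun i j => 2 * ricciMatrix g e z i j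

/-- The components, with respect to `(i/2) dz_i ∧ dz̄_j`, of the Lie derivative `L_X ω` along a
holomorphic vector field `X`:
`X(g_{ij̄}) + ∑_l g_{lj̄} ∂X^l/∂z_i + ∑_l g_{il̄} conj (∂X^l/∂z_j)`.
The flow of `X` is holomorphic, so `L_X ω` has no components of other types. -/
def lieKahlerForm (g : KahlerMetric n M) (X : ∀ p : M, TangentSpace 𝓘(ℂ, Fin n → ℂ) p)
    (e : OpenPartialHomeomorph M (Fin n → ℂ)) (z : Fin n → ℂ) : Matrix (Fin n) (Fin n) ℂ :=
  fun i j =>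
    fderiv ℝ (fun w => kahlerForm g e w i j) z (vectorCoord X e z)
    + ∑ l, kahlerForm g e z l j * wirtinger (fun w => vectorCoord X e w l) i z
    + ∑ l, kahlerForm g e z i l * conj (wirtinger (fun w => vectorCoord X e w l) j z)

/-- The scalar curvature `∑ g^{ij̄} Ric_{ij̄}` in the chart `e`. -/
def scalarCurvature (g : KahlerMetric n M) (e : OpenPartialHomeomorph M (Fin n → ℂ))
    (z : Fin n → ℂ) : ℂ :=
  ((metricMatrix g e z)⁻¹ * ricciMatrix g e z).trace

/-- The `(1,0)`-part `-2i ∑_k g^{jk̄} ∂s/∂z̄_k` of the Hamiltonian vector field of the scalar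
curvature `s`, in the chart `e`. -/
def hamiltonianScal (g : KahlerMetric n M) (e : OpenPartialHomeomorph M (Fin n → ℂ))
    (z : Fin n → ℂ) : Fin n → ℂ :=
  fun j => -2 * Complex.I *
    ∑ k, (metricMatrix g e z)⁻¹ k j * wirtingerBar (scalarCurvature g e) k z

open Polynomial in
/-- The `k`-th generalized scalar curvature `ρ_k` in the chart `e`: the coefficient of `s^k` in
`det(g_{ij̄} + s Ric_{ij̄}) / det(g_{ij̄})`. -/
def genScalarCurvature (g : KahlerMetric n M) (k : ℕ)
    (e : OpenPartialHomeomorph M (Fin n → ℂ)) (z : Fin n → ℂ) : ℂ :=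
  (((metricMatrix g e z).map (C : ℂ → ℂ[X])
      + (X : ℂ[X]) • (ricciMatrix g e z).map (C : ℂ → ℂ[X])).det).coeff k
    / (metricMatrix g e z).det

end Geometry

section Classes

variable (n : ℕ) (M : Type*) [TopologicalSpace M] [ChartedSpace (Fin n → ℂ) M]

/-- Extremal metrics. -/
def Ext : Set (KahlerMetric n M) :=
  {g | ∀ e ∈ holoCharts n M, DifferentiableOn ℂ (hamiltonianScal g e) e.target}

/-- Metrics associated to a Kähler-Ricci soliton: `ρ = c ω + L_X ω`. -/
def KRS : Set (KahlerMetric n M) :=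
  {g | ∃ (c : ℝ) (X : ∀ p : M, TangentSpace 𝓘(ℂ, Fin n → ℂ) p), IsHolomorphicVectorField X ∧
    ∀ e ∈ holoCharts n M, ∀ z ∈ e.target,
      ricciForm g e z = (c : ℂ) • kahlerForm g e z + lieKahlerForm g X e z}

/-- Metrics whose `k`-th generalized scalar curvature is constant. -/
def ConstGenScal (k : ℕ) : Set (KahlerMetric n M) :=
  {g | ∃ c : ℝ, ∀ e ∈ holoCharts n M, ∀ z ∈ e.target, genScalarCurvature g k e z = (c : ℂ)}

/-- Kähler-Einstein metrics: `ρ = c ω`. -/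
def KE : Set (KahlerMetric n M) :=
  {g | ∃ c : ℝ, ∀ e ∈ holoCharts n M, ∀ z ∈ e.target,
    ricciForm g e z = (c : ℂ) • kahlerForm g e z}

/-- Radial metrics: there is a global (smooth, real) Kähler potential `Φ`, that is
`ω = (i/2) ∂∂̄ Φ`, such that around every point there are local holomorphic coordinates `z` in
which `Φ` depends only on `|z|² = ∑ |z_i|²`. -/
def Rad : Set (KahlerMetric n M) :=
  {g | ∃ Φ : M → ℝ,
    (∀ e ∈ holoCharts n M, ContDiffOn ℝ ∞ (fun z => Φ (e.symm z)) e.target ∧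
      ∀ z ∈ e.target, ∀ i j : Fin n,
        kahlerForm g e z i j = ddbar (fun w => (Φ (e.symm w) : ℂ)) i j z) ∧
    ∀ p : M, ∃ e ∈ holoCharts n M, p ∈ e.source ∧
      ∃ f : ℝ → ℝ, ∀ q ∈ e.source, Φ q = f (∑ i, ‖e q i‖ ^ 2)}

end Classes

end RadialKahler

end

/-!
Einstein metrics belong to every class, by direct computation. For the converse inclusions, the
condition on `ρ_k`, on the scalar curvature or on the soliton field is restricted to the part of a
radial chart away from the origin, where the metric has the potential `f(|z|²)`. Put `x = |z|²`,
`φ = f'`, `y = x φ`, `ψ = x y'`. The metric has the eigenvalue `φ` on the complex tangent space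
of the sphere (with multiplicity `n - 1`) and `y'` in the radial direction, and the Ricci tensor
has the corresponding eigenvalues `m` and `μ` relative to the metric, functions of `x` with
`μ y' = (m y)'`. The metric is Einstein there as soon as `m` is constant, so let `n ≥ 2` and
suppose `m' ≠ 0` on an interval.

* If `ρ_k` is constant, then `m^k = A + B y^(-n)` (`IsMomentumProfile.genScal_integral`), because
  `ρ_k = C(n-1,k) m^k + C(n-1,k-1) m^(k-1) μ`.
* If the metric is extremal, holomorphy of the field, which is a function of `x` times
  `∑ z_j ∂/∂z_j`, makes the scalar curvature affine in `y`; hence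
  `m = K y + D + ε y^(-n)` (`IsMomentumProfile.ext_integral`).
* If the metric is a soliton with field `X`, the trace of the equation gives
  `2 Re div X = 2 scal - c n - X(log det g)`, and this function is pluriharmonic. Its Hessian and
  the soliton equation, restricted to tangential vectors, are two linear equations for `X(|z|²)`
  and the derivative of `X`; they make `X(|z|²)` a function of `|z|²`, which the Hessian then shows
  to be `a |z|²`, and the soliton equation becomes `2 m y = c y + a ψ` (`IsRadialOn.soliton_ode`).

Any two of these conditions, except extremality together with constant `ρ_1`, which it follows
from, give a polynomial relation for the nonconstant function `y` or `m`,
whose coefficients cannot all vanish (`IsMomentumProfile.not_genScal_genScal` and its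
companions).

In dimension one there is no tangential direction. The first scalar curvature determines the Ricci
form, and only extremal solitons need an argument: if the scalar curvature is not constant, the
Hessian of the divergence expresses `X(|z|²)` through `|z|²`, and the resulting equation contradicts
the polynomial dependence of the curvature on `y` (`IsRadialOn.deriv_scal_eq_zero`).

The Einstein constant found on such a region is locally constant. It extends over the origin of a
chart because a punctured ball is connected, and it is constant on `M` because `M` is connected
(`mem_KE_of_radial`).
-/

noncomputable section

namespace RadialKahler

open Filter Topology Finset

/-! ### Wirtinger calculus -/

/-- The squared Euclidean norm `|z|² = ∑ |z_i|²`. -/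
def sqNorm {n : ℕ} (z : Fin n → ℂ) : ℝ := ∑ i, ‖z i‖ ^ 2

/-- `u` is real differentiable at `z`, with Wirtinger derivatives `∂u/∂z_i = a i` and
`∂u/∂z̄_i = b i`. -/
structure HasWirtingerAt {n : ℕ} (u : (Fin n → ℂ) → ℂ) (a b : Fin n → ℂ) (z : Fin n → ℂ) :
    Prop where
  diff : DifferentiableAt ℝ u z
  left : ∀ i, wirtinger u i z = a i
  right : ∀ i, wirtingerBar u i z = b i

section Calculus

variable {n : ℕ} {u v : (Fin n → ℂ) → ℂ} {a b a' b' : Fin n → ℂ} {z : Fin n → ℂ}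

theorem hasWirtingerAt_self (h : DifferentiableAt ℝ u z) :
    HasWirtingerAt u (fun i => wirtinger u i z) (fun i => wirtingerBar u i z) z :=
  ⟨h, fun _ => rfl, fun _ => rfl⟩

theorem HasWirtingerAt.congr_deriv (h : HasWirtingerAt u a b z) (ha : ∀ i, a i = a' i)
    (hb : ∀ i, b i = b' i) : HasWirtingerAt u a' b' z :=
  ⟨h.diff, fun i => (h.left i).trans (ha i), fun i => (h.right i).trans (hb i)⟩

theorem wirtinger_congr (h : u =ᶠ[𝓝 z] v) (i : Fin n) : wirtinger u i z = wirtinger v i z := by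
  simp only [wirtinger, h.fderiv_eq]

theorem wirtingerBar_congr (h : u =ᶠ[𝓝 z] v) (i : Fin n) :
    wirtingerBar u i z = wirtingerBar v i z := by
  simp only [wirtingerBar, h.fderiv_eq]

theorem hasWirtingerAt_const (c : ℂ) : HasWirtingerAt (fun _ => c) 0 0 z :=
  ⟨differentiableAt_const c, fun i => by simp [wirtinger], fun i => by simp [wirtingerBar]⟩

theorem HasWirtingerAt.add (hu : HasWirtingerAt u a b z) (hv : HasWirtingerAt v a' b' z) :
    HasWirtingerAt (fun w => u w + v w) (fun i => a i + a' i) (fun i => b i + b' i) z := by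
  refine ⟨hu.diff.add hv.diff, fun i => ?_, fun i => ?_⟩
  · rw [← hu.left, ← hv.left, wirtinger, fderiv_fun_add hu.diff hv.diff]
    simp only [wirtinger, add_apply]; ring
  · rw [← hu.right, ← hv.right, wirtingerBar, fderiv_fun_add hu.diff hv.diff]
    simp only [wirtingerBar, add_apply]; ring

theorem HasWirtingerAt.mul (hu : HasWirtingerAt u a b z) (hv : HasWirtingerAt v a' b' z) :
    HasWirtingerAt (fun w => u w * v w) (fun i => u z * a' i + v z * a i)
      (fun i => u z * b' i + v z * b i) z := by
  refine ⟨hu.diff.mul hv.diff, fun i => ?_, fun i => ?_⟩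
  · rw [← hu.left, ← hv.left, wirtinger, fderiv_fun_mul hu.diff hv.diff]
    simp only [wirtinger, add_apply, smul_apply,
      smul_eq_mul]; ring
  · rw [← hu.right, ← hv.right, wirtingerBar, fderiv_fun_mul hu.diff hv.diff]
    simp only [wirtingerBar, add_apply, smul_apply,
      smul_eq_mul]; ring

theorem HasWirtingerAt.const_mul (hu : HasWirtingerAt u a b z) (c : ℂ) :
    HasWirtingerAt (fun w => c * u w) (fun i => c * a i) (fun i => c * b i) z :=
  ((hasWirtingerAt_const c).mul hu).congr_deriv (fun i => by simp) (fun i => by simp)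

theorem HasWirtingerAt.sum {ι : Type*} {s : Finset ι} {u : ι → (Fin n → ℂ) → ℂ}
    {a b : ι → Fin n → ℂ} (h : ∀ l ∈ s, HasWirtingerAt (u l) (a l) (b l) z) :
    HasWirtingerAt (fun w => ∑ l ∈ s, u l w) (fun i => ∑ l ∈ s, a l i) (fun i => ∑ l ∈ s, b l i)
      z := by
  classical
  induction s using Finset.induction_on with
  | empty => simpa using! hasWirtingerAt_const (z := z) 0
  | insert l s hl ih =>
    simp only [Finset.sum_insert hl]
    exact (h l (by simp)).add (ih fun k hk => h k (by simp [hk]))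

theorem fderiv_conj_apply (hu : DifferentiableAt ℝ u z) (x : Fin n → ℂ) :
    fderiv ℝ (fun w => conj (u w)) z x = conj (fderiv ℝ u z x) := by
  have h : HasFDerivAt (fun w => conj (u w))
      ((Complex.conjCLE : ℂ →L[ℝ] ℂ).comp (fderiv ℝ u z)) z :=
    (Complex.conjCLE : ℂ →L[ℝ] ℂ).hasFDerivAt.comp z hu.hasFDerivAt
  rw [h.fderiv]; simp

theorem HasWirtingerAt.conj (hu : HasWirtingerAt u a b z) :
    HasWirtingerAt (fun w => conj (u w)) (fun i => conj (b i)) (fun i => conj (a i)) z := by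
  refine ⟨(Complex.conjCLE : ℂ →L[ℝ] ℂ).differentiableAt.comp z hu.diff, fun i => ?_, fun i => ?_⟩
  · rw [← hu.right, wirtinger, fderiv_conj_apply hu.diff, fderiv_conj_apply hu.diff]
    simp [wirtingerBar, sub_eq_add_neg, map_ofNat]
  · rw [← hu.left, wirtingerBar, fderiv_conj_apply hu.diff, fderiv_conj_apply hu.diff]
    simp [wirtinger, sub_eq_add_neg, map_ofNat]

theorem hasWirtingerAt_of_differentiableAt (h : DifferentiableAt ℂ u z) :
    HasWirtingerAt u (fun i => fderiv ℂ u z (Pi.single i 1)) 0 z := by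
  have key : ∀ i : Fin n, (fderiv ℂ u z) (Pi.single i Complex.I)
      = Complex.I * fderiv ℂ u z (Pi.single i 1) := by
    intro i
    have : (Pi.single i Complex.I : Fin n → ℂ) = Complex.I • Pi.single i 1 := by
      rw [← Pi.single_smul]; simp
    rw [this, map_smul, smul_eq_mul]
  refine ⟨h.restrictScalars ℝ, fun i => ?_, fun i => ?_⟩
  · rw [wirtinger, h.fderiv_restrictScalars ℝ]
    simp only [ContinuousLinearMap.coe_restrictScalars', key]
    linear_combination (-(fderiv ℂ u z) (Pi.single i 1)) / 2 * Complex.I_mul_I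
  · rw [wirtingerBar, h.fderiv_restrictScalars ℝ]
    simp only [ContinuousLinearMap.coe_restrictScalars', key, Pi.zero_apply]
    linear_combination ((fderiv ℂ u z) (Pi.single i 1)) / 2 * Complex.I_mul_I

theorem hasWirtingerAt_coord (l : Fin n) :
    HasWirtingerAt (fun w => w l) (fun i => if i = l then 1 else 0) 0 z := by
  have h : HasFDerivAt (𝕜 := ℂ) (fun w : Fin n → ℂ => w l) (ContinuousLinearMap.proj l) z :=
    (ContinuousLinearMap.proj (R := ℂ) (φ := fun _ : Fin n => ℂ) l).hasFDerivAt
  refine (hasWirtingerAt_of_differentiableAt h.differentiableAt).congr_deriv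
    (fun i => ?_) (fun i => rfl)
  rw [h.fderiv]
  simp [Pi.single_apply, eq_comm]

theorem hasWirtingerAt_conj_coord (l : Fin n) :
    HasWirtingerAt (fun w => conj (w l)) 0 (fun i => if i = l then 1 else 0) z :=
  (hasWirtingerAt_coord l).conj.congr_deriv (fun i => by simp) (fun i => by split <;> simp)

theorem ofReal_sqNorm (z : Fin n → ℂ) : (sqNorm z : ℂ) = ∑ i, z i * conj (z i) := by
  simp [sqNorm, Complex.mul_conj, Complex.normSq_eq_norm_sq]

theorem hasWirtingerAt_sqNorm :
    HasWirtingerAt (fun w => (sqNorm w : ℂ)) (fun i => conj (z i)) z z := by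
  simp only [ofReal_sqNorm]
  refine (HasWirtingerAt.sum fun l _ => (hasWirtingerAt_coord l).mul
    (hasWirtingerAt_conj_coord l)).congr_deriv (fun i => ?_) (fun i => ?_)
  · simp
  · simp

theorem differentiableAt_sqNorm : DifferentiableAt ℝ (sqNorm : (Fin n → ℂ) → ℝ) z := by
  have := (Complex.reCLM.differentiableAt.comp z (hasWirtingerAt_sqNorm (z := z)).diff)
  exact this

theorem hasWirtingerAt_radial {f : ℝ → ℝ} {f' : ℝ} (hf : HasDerivAt f f' (sqNorm z)) :
    HasWirtingerAt (fun w => (f (sqNorm w) : ℂ)) (fun i => f' * conj (z i)) (fun i => f' * z i)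
      z := by
  have h1 : HasFDerivAt (fun w => (sqNorm w : ℂ))
      (Complex.ofRealCLM.comp (fderiv ℝ sqNorm z)) z :=
    Complex.ofRealCLM.hasFDerivAt.comp z differentiableAt_sqNorm.hasFDerivAt
  have h2 : HasFDerivAt (fun w => (f (sqNorm w) : ℂ))
      (Complex.ofRealCLM.comp (f' • fderiv ℝ sqNorm z)) z := by
    have := hf.comp_hasFDerivAt z (differentiableAt_sqNorm (z := z)).hasFDerivAt
    exact Complex.ofRealCLM.hasFDerivAt.comp z this
  have h3 := hasWirtingerAt_sqNorm (z := z)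
  refine ⟨h2.differentiableAt, fun i => ?_, fun i => ?_⟩
  · rw [← h3.left, wirtinger, wirtinger, h1.fderiv, h2.fderiv]
    simp; ring
  · rw [← h3.right, wirtingerBar, wirtingerBar, h1.fderiv, h2.fderiv]
    simp; ring

/-- Computes `ddbar` from the first derivatives near a point. -/
theorem ddbar_eq {B : (Fin n → ℂ) → Fin n → ℂ} {i j : Fin n}
    (h : ∀ᶠ w in 𝓝 z, wirtingerBar u j w = B w j)
    (h' : HasWirtingerAt (fun w => B w j) a b z) : ddbar u i j z = a i := by
  rw [ddbar, ← h'.left]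
  exact wirtinger_congr h i

theorem ddbar_congr (h : u =ᶠ[𝓝 z] v) (i j : Fin n) : ddbar u i j z = ddbar v i j z :=
  wirtinger_congr (h.eventuallyEq_nhds.mono fun _ hw => wirtingerBar_congr hw j) i

theorem ddbar_radial {f f' : ℝ → ℝ} {f'' : ℝ}
    (hf : ∀ᶠ x in 𝓝 (sqNorm z), HasDerivAt f (f' x) x) (hf' : HasDerivAt f' f'' (sqNorm z))
    (i j : Fin n) : ddbar (fun w => (f (sqNorm w) : ℂ)) i j z
      = f' (sqNorm z) * (if i = j then 1 else 0) + f'' * (conj (z i) * z j) := by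
  have h1 : ∀ᶠ w in 𝓝 z, HasDerivAt f (f' (sqNorm w)) (sqNorm w) :=
    (differentiableAt_sqNorm (z := z)).continuousAt.eventually hf
  rw [ddbar_eq (B := fun w j => f' (sqNorm w) * w j)
    (h1.mono fun w hw => (hasWirtingerAt_radial hw).right j)
    ((hasWirtingerAt_radial hf').mul (hasWirtingerAt_coord j))]
  ring

/-- The real derivative in terms of the Wirtinger derivatives. -/
theorem HasWirtingerAt.fderiv_apply (h : HasWirtingerAt u a b z) (x : Fin n → ℂ) :
    fderiv ℝ u z x = ∑ i, (a i * x i + b i * conj (x i)) := by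
  have hx : x = ∑ i, ((x i).re • (Pi.single i 1 : Fin n → ℂ)
      + (x i).im • (Pi.single i Complex.I : Fin n → ℂ)) := by
    ext l
    simp [Finset.sum_apply, Pi.single_apply, Finset.sum_add_distrib, Complex.re_add_im]
  conv_lhs => rw [hx]
  rw [map_sum]
  refine Finset.sum_congr rfl fun i _ => ?_
  rw [map_add, map_smul, map_smul, ← h.left, ← h.right, wirtinger, wirtingerBar]
  have h1 : conj (x i) = (x i).re - (x i).im * Complex.I := by
    apply Complex.ext <;> simp
  have key : ∀ (r s : ℝ) (A B : ℂ), r • A + s • B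
      = (A - Complex.I * B) / 2 * (r + s * Complex.I)
        + (A + Complex.I * B) / 2 * (r - s * Complex.I) := by
    intro r s A B
    simp only [Complex.real_smul]
    linear_combination s * B * Complex.I_mul_I
  rw [key, h1, Complex.re_add_im]

theorem contDiffOn_wirtinger {U : Set (Fin n → ℂ)} (hU : IsOpen U) (hu : ContDiffOn ℝ ∞ u U)
    (i : Fin n) : ContDiffOn ℝ ∞ (wirtinger u i) U := by
  have h : ContDiffOn ℝ ∞ (fderiv ℝ u) U := hu.fderiv_of_isOpen hU (by simp)
  unfold wirtinger
  fun_prop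

theorem contDiffOn_wirtingerBar {U : Set (Fin n → ℂ)} (hU : IsOpen U) (hu : ContDiffOn ℝ ∞ u U)
    (i : Fin n) : ContDiffOn ℝ ∞ (wirtingerBar u i) U := by
  have h : ContDiffOn ℝ ∞ (fderiv ℝ u) U := hu.fderiv_of_isOpen hU (by simp)
  unfold wirtingerBar
  fun_prop

end Calculus

/-! ### Smoothness of holomorphic functions of several variables -/

section Holomorphic

variable {n : ℕ} {h : (Fin n → ℂ) → ℂ} {U : Set (Fin n → ℂ)}

theorem diffContOnCl_comp_line {z v : Fin n → ℂ} {r : ℝ} (hd : DifferentiableOn ℂ h U)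
    (hU : IsOpen U) (hr : 0 < r) (hz : ∀ ζ : ℂ, ‖ζ‖ ≤ r → z + ζ • v ∈ U) :
    DiffContOnCl ℂ (fun ζ : ℂ => h (z + ζ • v)) (Metric.ball 0 r) := by
  refine DifferentiableOn.diffContOnCl ?_
  rw [closure_ball _ hr.ne']
  intro ζ hζ
  have h1 : DifferentiableAt ℂ h (z + ζ • v) :=
    hd.differentiableAt (hU.mem_nhds (hz ζ (by simpa using hζ)))
  have h2 : DifferentiableAt ℂ (fun ζ : ℂ => z + ζ • v) ζ := by fun_prop
  exact (h1.comp ζ h2).differentiableWithinAt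

theorem deriv_comp_line {z v : Fin n → ℂ} (hd : DifferentiableAt ℂ h z) :
    deriv (fun ζ : ℂ => h (z + ζ • v)) 0 = fderiv ℂ h z v := by
  have h2 : HasDerivAt (fun ζ : ℂ => z + ζ • v) v 0 := by
    simpa using ((hasDerivAt_id (0 : ℂ)).smul_const v).const_add z
  have h1 : HasFDerivAt h (fderiv ℂ h z) (z + (0 : ℂ) • v) := by
    simpa using hd.hasFDerivAt
  exact (h1.comp_hasDerivAt (0 : ℂ) h2).deriv

/-- Directional derivatives of a holomorphic function of several variables are holomorphic: the
Cauchy formula on a disc in the direction `v` can be differentiated under the integral sign. -/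
theorem differentiableOn_fderiv_apply (hU : IsOpen U) (hd : DifferentiableOn ℂ h U)
    (v : Fin n → ℂ) : DifferentiableOn ℂ (fun z => fderiv ℂ h z v) U := by
  intro z₀ hz₀
  refine DifferentiableAt.differentiableWithinAt ?_
  obtain ⟨R, hR, hRU⟩ := Metric.nhds_basis_closedBall.mem_iff.1 (hU.mem_nhds hz₀)
  have hdat : ∀ z ∈ Metric.closedBall z₀ R, DifferentiableAt ℂ h z := fun z hz =>
    hd.differentiableAt (hU.mem_nhds (hRU hz))
  obtain ⟨C, hC⟩ := (isCompact_closedBall z₀ R).exists_bound_of_continuousOn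
    (fun z hz => (hdat z hz).continuousAt.continuousWithinAt : ContinuousOn h _)
  have hC0 : 0 ≤ C := (norm_nonneg _).trans (hC z₀ (Metric.mem_closedBall_self hR.le))
  -- Cauchy estimate on the ball of half the radius
  have hbound : ∀ z ∈ Metric.ball z₀ (R / 2), ‖fderiv ℂ h z‖ ≤ C / (R / 2) := by
    intro z hz
    refine ContinuousLinearMap.opNorm_le_of_unit_norm (by positivity) fun w hw => ?_
    have hmem : ∀ ζ : ℂ, ‖ζ‖ ≤ R / 2 → z + ζ • w ∈ Metric.closedBall z₀ R := by
      intro ζ hζ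
      rw [Metric.mem_ball, dist_eq_norm] at hz
      rw [Metric.mem_closedBall, dist_eq_norm]
      calc ‖z + ζ • w - z₀‖ = ‖(z - z₀) + ζ • w‖ := by congr 1; abel
        _ ≤ ‖z - z₀‖ + ‖ζ • w‖ := norm_add_le _ _
        _ ≤ R / 2 + R / 2 := by
          rw [norm_smul, hw, mul_one]; linarith
        _ = R := by ring
    rw [← deriv_comp_line (hdat z (by simpa using hmem 0 (by simp; positivity)))]
    refine Complex.norm_deriv_le_of_forall_mem_sphere_norm_le (by positivity)
      (diffContOnCl_comp_line hd hU (by positivity) fun ζ hζ => hRU (hmem ζ hζ)) fun ζ hζ => ?_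
    exact hC _ (hmem ζ (by simpa using hζ.le))
  have hlip : LipschitzOnWith (Real.toNNReal (C / (R / 2))) h (Metric.ball z₀ (R / 2)) := by
    refine (convex_ball z₀ (R / 2)).lipschitzOnWith_of_nnnorm_fderiv_le (𝕜 := ℂ)
      (fun z hz => hdat z (Metric.ball_subset_closedBall
        (Metric.ball_subset_ball (by linarith) hz))) fun z hz => ?_
    rw [← NNReal.coe_le_coe, coe_nnnorm, Real.coe_toNNReal _ (by positivity)]
    exact hbound z hz
  obtain ⟨r, hr, hrv⟩ : ∃ r : ℝ, 0 < r ∧ r * ‖v‖ < R / 4 := by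
    refine ⟨R / 4 / (‖v‖ + 1), by positivity, ?_⟩
    rw [div_mul_eq_mul_div, div_lt_iff₀ (by positivity)]
    nlinarith [norm_nonneg v]
  have hmem : ∀ z ∈ Metric.ball z₀ (R / 4), ∀ ζ : ℂ, ‖ζ‖ ≤ r →
      z + ζ • v ∈ Metric.ball z₀ (R / 2) := by
    intro z hz ζ hζ
    rw [Metric.mem_ball, dist_eq_norm] at hz ⊢
    calc ‖z + ζ • v - z₀‖ = ‖(z - z₀) + ζ • v‖ := by congr 1; abel
      _ ≤ ‖z - z₀‖ + ‖ζ • v‖ := norm_add_le _ _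
      _ < R / 4 + R / 4 := by
        rw [norm_smul]
        have := mul_le_mul_of_nonneg_right hζ (norm_nonneg v)
        linarith
      _ = R / 2 := by ring
  have hsub : Metric.ball z₀ (R / 2) ⊆ Metric.closedBall z₀ R := fun z hz =>
    Metric.ball_subset_closedBall (Metric.ball_subset_ball (by linarith) hz)
  have hcauchy : (fun z => fderiv ℂ h z v) =ᶠ[𝓝 z₀] fun z => (2 * Real.pi * Complex.I : ℂ)⁻¹ *
      ∫ θ in (0 : ℝ)..2 * Real.pi, (deriv (circleMap 0 r) θ * (circleMap 0 r θ ^ 2)⁻¹) •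
        h (z + circleMap 0 r θ • v) := by
    filter_upwards [Metric.ball_mem_nhds z₀ (show 0 < R / 4 by positivity)] with z hz
    have hz' : z ∈ Metric.closedBall z₀ R :=
      hsub (Metric.ball_subset_ball (by linarith) hz)
    rw [← deriv_comp_line (hdat z hz'), eq_inv_mul_iff_mul_eq₀ Complex.two_pi_I_ne_zero,
      ← smul_eq_mul, ← DiffContOnCl.deriv_eq_smul_circleIntegral hr
      (diffContOnCl_comp_line hd hU hr fun ζ hζ => hRU (hsub (hmem z hz ζ hζ)))]
    simp only [circleIntegral, sub_zero, smul_smul, one_div]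
  refine DifferentiableAt.congr_of_eventuallyEq ?_ hcauchy
  refine DifferentiableAt.const_mul ?_ _
  have hnorm : ∀ θ : ℝ, ‖circleMap 0 r θ‖ ≤ r := fun θ => by simp [abs_of_pos hr]
  have hw : Continuous fun θ : ℝ => deriv (circleMap 0 r) θ * (circleMap 0 r θ ^ 2)⁻¹ := by
    refine Continuous.mul ?_ ?_
    · exact ((continuous_circleMap 0 r).mul_const Complex.I).congr fun θ => by
        simp [deriv_circleMap]
    · exact ((continuous_circleMap 0 r).pow 2).inv₀ fun θ => pow_ne_zero 2 (circleMap_ne_center hr.ne')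
  have hcont : ∀ z ∈ Metric.ball z₀ (R / 4), Continuous fun θ : ℝ =>
      (deriv (circleMap 0 r) θ * (circleMap 0 r θ ^ 2)⁻¹) •
        h (z + circleMap 0 r θ • v) := by
    intro z hz
    refine hw.smul ?_
    rw [continuous_iff_continuousAt]
    intro θ
    have h1 : ContinuousAt h (z + circleMap 0 r θ • v) :=
      (hdat _ (hsub (hmem z hz _ (hnorm θ)))).continuousAt
    have h2 : ContinuousAt (fun θ : ℝ => z + circleMap 0 r θ • v) θ := by fun_prop
    exact ContinuousAt.comp (g := h) h1 h2
  have hball : Metric.ball z₀ (R / 4) ∈ 𝓝 z₀ := Metric.ball_mem_nhds _ (by positivity)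
  refine HasFDerivAt.differentiableAt (𝕜 := ℂ)
    (intervalIntegral.hasFDerivAt_integral_of_dominated_loc_of_lip (𝕜 := ℂ)
    (F := fun z θ => (deriv (circleMap 0 r) θ * (circleMap 0 r θ ^ 2)⁻¹) •
        h (z + circleMap 0 r θ • v))
    (F' := fun θ => (deriv (circleMap 0 r) θ * (circleMap 0 r θ ^ 2)⁻¹) •
        fderiv ℂ h (z₀ + circleMap 0 r θ • v))
    (bound := fun θ => ‖deriv (circleMap 0 r) θ * (circleMap 0 r θ ^ 2)⁻¹‖ * (C / (R / 2)))
    hball ?_ ?_ ?_ ?_ ?_ ?_).2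
  · filter_upwards [hball] with z hz
    exact (hcont z hz).aestronglyMeasurable
  · exact (hcont z₀ (mem_of_mem_nhds hball)).intervalIntegrable _ _
  · refine hw.aestronglyMeasurable.smul ?_
    refine Measurable.aestronglyMeasurable ?_
    refine (measurable_fderiv ℂ h).comp ?_
    exact Continuous.measurable (by fun_prop)
  · refine Eventually.of_forall fun θ _ => ?_
    refine LipschitzOnWith.of_dist_le_mul fun x hx y hy => ?_
    rw [dist_smul₀]
    have h1 := hlip.dist_le_mul _ (hmem x hx _ (hnorm θ)) _ (hmem y hy _ (hnorm θ))
    rw [dist_add_right, Real.coe_toNNReal _ (by positivity)] at h1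
    have h2 : (0 : ℝ) ≤ ‖deriv (circleMap 0 r) θ * (circleMap 0 r θ ^ 2)⁻¹‖ := norm_nonneg _
    rw [Real.coe_nnabs, abs_of_nonneg (by positivity), mul_assoc]
    exact mul_le_mul_of_nonneg_left h1 h2
  · exact (hw.norm.mul continuous_const).intervalIntegrable _ _
  · refine Eventually.of_forall fun θ _ => ?_
    have h1 : HasFDerivAt h (fderiv ℂ h (z₀ + circleMap 0 r θ • v)) (z₀ + circleMap 0 r θ • v) :=
      (hdat _ (hsub (hmem z₀ (mem_of_mem_nhds hball) _ (hnorm θ)))).hasFDerivAt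
    have h2 := h1.comp z₀ ((hasFDerivAt_id (𝕜 := ℂ) z₀).add_const (circleMap 0 r θ • v))
    rw [ContinuousLinearMap.comp_id] at h2
    exact h2.const_smul (deriv (circleMap 0 r) θ * (circleMap 0 r θ ^ 2)⁻¹)

end Holomorphic

/-! ### Pullback by holomorphic maps -/

section Composition

variable {n : ℕ} {u : (Fin n → ℂ) → ℂ} {a b : Fin n → ℂ} {z : Fin n → ℂ}

/-- The Jacobian matrix `∂φ^k/∂z_i` of a holomorphic map, with rows indexed by `k`. -/
def jacobian (φ : (Fin n → ℂ) → Fin n → ℂ) (z : Fin n → ℂ) : Matrix (Fin n) (Fin n) ℂ :=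
  fun k i => fderiv ℂ φ z (Pi.single i 1) k

theorem single_I (i : Fin n) : (Pi.single i Complex.I : Fin n → ℂ)
    = Complex.I • (Pi.single i (1 : ℂ) : Fin n → ℂ) := by
  rw [← Pi.single_smul]; simp

theorem HasWirtingerAt.comp_holomorphic {φ : (Fin n → ℂ) → Fin n → ℂ}
    (hu : HasWirtingerAt u a b (φ z)) (hφ : DifferentiableAt ℂ φ z) :
    HasWirtingerAt (fun w => u (φ w)) (fun i => ∑ k, a k * jacobian φ z k i)
      (fun i => ∑ k, b k * conj (jacobian φ z k i)) z := by
  have h1 : ∀ x, fderiv ℝ (fun w => u (φ w)) z x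
      = ∑ k, (a k * (fderiv ℂ φ z x) k + b k * conj ((fderiv ℂ φ z x) k)) := by
    intro x
    rw [← hu.fderiv_apply, ← Function.comp_def u φ, fderiv_comp z hu.diff (hφ.restrictScalars ℝ),
      hφ.fderiv_restrictScalars ℝ]
    rfl
  refine ⟨hu.diff.comp z (hφ.restrictScalars ℝ), fun i => ?_, fun i => ?_⟩
  · rw [wirtinger, h1, h1, single_I, map_smul, Finset.mul_sum, ← Finset.sum_sub_distrib,
      Finset.sum_div]
    refine Finset.sum_congr rfl fun k _ => ?_
    simp only [jacobian, Pi.smul_apply, smul_eq_mul, map_mul, Complex.conj_I]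
    linear_combination (-(a k * (fderiv ℂ φ z) (Pi.single i 1) k
      - b k * conj ((fderiv ℂ φ z) (Pi.single i 1) k)) / 2) * Complex.I_mul_I
  · rw [wirtingerBar, h1, h1, single_I, map_smul, Finset.mul_sum, ← Finset.sum_add_distrib,
      Finset.sum_div]
    refine Finset.sum_congr rfl fun k _ => ?_
    simp only [jacobian, Pi.smul_apply, smul_eq_mul, map_mul, Complex.conj_I]
    linear_combination ((a k * (fderiv ℂ φ z) (Pi.single i 1) k
      - b k * conj ((fderiv ℂ φ z) (Pi.single i 1) k)) / 2) * Complex.I_mul_I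

theorem differentiableOn_jacobian {U : Set (Fin n → ℂ)} (hU : IsOpen U)
    {φ : (Fin n → ℂ) → Fin n → ℂ} (hφ : DifferentiableOn ℂ φ U) (k i : Fin n) :
    DifferentiableOn ℂ (fun w => jacobian φ w k i) U := by
  have hk : DifferentiableOn ℂ (fun w => φ w k) U := differentiableOn_pi.1 hφ k
  refine (differentiableOn_fderiv_apply hU hk (Pi.single i 1)).congr fun w hw => ?_
  rw [jacobian, fderiv_apply (hφ.differentiableAt (hU.mem_nhds hw))]
  rfl

theorem ddbar_comp_holomorphic {U : Set (Fin n → ℂ)} (hU : IsOpen U)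
    {V : Set (Fin n → ℂ)} (hV : IsOpen V) {φ : (Fin n → ℂ) → Fin n → ℂ}
    (hφ : DifferentiableOn ℂ φ U) (hm : ∀ w ∈ U, φ w ∈ V) (hu : ContDiffOn ℝ ∞ u V)
    (hz : z ∈ U) (i j : Fin n) :
    ddbar (fun w => u (φ w)) i j z
      = ∑ k, ∑ l, jacobian φ z k i * ddbar u k l (φ z) * conj (jacobian φ z l j) := by
  have hd : ∀ w ∈ U, DifferentiableAt ℂ φ w := fun w hw => hφ.differentiableAt (hU.mem_nhds hw)
  have h1 : ∀ᶠ w in 𝓝 z, wirtingerBar (fun w => u (φ w)) j w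
      = ∑ l, wirtingerBar u l (φ w) * conj (jacobian φ w l j) := by
    filter_upwards [hU.mem_nhds hz] with w hw
    have := hasWirtingerAt_self ((hu.contDiffAt (hV.mem_nhds (hm w hw))).differentiableAt
      (by simp))
    exact (this.comp_holomorphic (hd w hw)).right j
  rw [ddbar_eq (B := fun w j => ∑ l, wirtingerBar u l (φ w) * conj (jacobian φ w l j)) h1
    (HasWirtingerAt.sum fun l _ => HasWirtingerAt.mul
    (HasWirtingerAt.comp_holomorphic (hasWirtingerAt_self (((contDiffOn_wirtingerBar hV hu
      l).contDiffAt (hV.mem_nhds (hm z hz))).differentiableAt (by simp))) (hd z hz))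
    (hasWirtingerAt_of_differentiableAt ((differentiableOn_jacobian hU hφ l j).differentiableAt
      (hU.mem_nhds hz))).conj)]
  simp only [Pi.zero_apply, map_zero, mul_zero, zero_add, Finset.mul_sum]
  rw [Finset.sum_comm]
  refine Finset.sum_congr rfl fun k _ => Finset.sum_congr rfl fun l _ => ?_
  rw [ddbar]; ring

theorem hasWirtingerAt_real_comp {v : (Fin n → ℂ) → ℝ} {f : ℝ → ℝ} {f' : ℝ}
    (hv : HasWirtingerAt (fun w => (v w : ℂ)) a b z) (hf : HasDerivAt f f' (v z)) :
    HasWirtingerAt (fun w => (f (v w) : ℂ)) (fun i => f' * a i) (fun i => f' * b i) z := by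
  have hv' : DifferentiableAt ℝ v z := Complex.reCLM.differentiableAt.comp z hv.diff
  have h1 : HasFDerivAt (fun w => (v w : ℂ)) (Complex.ofRealCLM.comp (fderiv ℝ v z)) z :=
    Complex.ofRealCLM.hasFDerivAt.comp z hv'.hasFDerivAt
  have h2 : HasFDerivAt (fun w => (f (v w) : ℂ))
      (Complex.ofRealCLM.comp (f' • fderiv ℝ v z)) z :=
    Complex.ofRealCLM.hasFDerivAt.comp z (hf.comp_hasFDerivAt z hv'.hasFDerivAt)
  refine ⟨h2.differentiableAt, fun i => ?_, fun i => ?_⟩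
  · rw [← hv.left, wirtinger, wirtinger, h1.fderiv, h2.fderiv]
    simp; ring
  · rw [← hv.right, wirtingerBar, wirtingerBar, h1.fderiv, h2.fderiv]
    simp; ring

/-- `log |D|²` is pluriharmonic where the holomorphic function `D` has no zeros. -/
theorem ddbar_log_normSq {U : Set (Fin n → ℂ)} (hU : IsOpen U) {D : (Fin n → ℂ) → ℂ}
    (hD : DifferentiableOn ℂ D U) (h0 : ∀ w ∈ U, D w ≠ 0) (hz : z ∈ U) (i j : Fin n) :
    ddbar (fun w => (Real.log (Complex.normSq (D w)) : ℂ)) i j z = 0 := by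
  have hd : ∀ w ∈ U, DifferentiableAt ℂ D w := fun w hw => hD.differentiableAt (hU.mem_nhds hw)
  have h1 : ∀ᶠ w in 𝓝 z, wirtingerBar (fun w => (Real.log (Complex.normSq (D w)) : ℂ)) j w
      = conj ((fderiv ℂ D w (Pi.single j 1)) * (D w)⁻¹) := by
    filter_upwards [hU.mem_nhds hz] with w hw
    have hw' := hasWirtingerAt_of_differentiableAt (hd w hw)
    have h2 := (hw'.mul hw'.conj)
    simp only [Complex.mul_conj] at h2
    have h3 : Complex.normSq (D w) ≠ 0 := by simpa using h0 w hw
    rw [(hasWirtingerAt_real_comp h2 (Real.hasDerivAt_log h3)).right j]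
    have h4 : conj (D w) ≠ 0 := by simpa using h0 w hw
    have h5 := h0 w hw
    rw [Complex.ofReal_inv, ← Complex.mul_conj, map_mul, map_inv₀]
    simp only [Pi.zero_apply, mul_zero, add_zero]
    field_simp
  rw [ddbar_eq (B := fun w j => conj ((fderiv ℂ D w (Pi.single j 1)) * (D w)⁻¹)) h1
    (hasWirtingerAt_of_differentiableAt
      (((differentiableOn_fderiv_apply hU hD _).differentiableAt (hU.mem_nhds hz)).mul
        ((hd z hz).inv (h0 z hz)))).conj]
  simp

theorem ddbar_add {V : Set (Fin n → ℂ)} (hV : IsOpen V) {u v : (Fin n → ℂ) → ℂ}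
    (hu : ContDiffOn ℝ ∞ u V) (hv : ContDiffOn ℝ ∞ v V) (hz : z ∈ V) (i j : Fin n) :
    ddbar (fun w => u w + v w) i j z = ddbar u i j z + ddbar v i j z := by
  have hd : ∀ u : (Fin n → ℂ) → ℂ, ContDiffOn ℝ ∞ u V → ∀ w ∈ V, HasWirtingerAt u
      (fun i => wirtinger u i w) (fun i => wirtingerBar u i w) w := fun u hu w hw =>
    hasWirtingerAt_self ((hu.contDiffAt (hV.mem_nhds hw)).differentiableAt (by simp))
  exact ddbar_eq (B := fun w j => wirtingerBar u j w + wirtingerBar v j w)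
    ((hV.eventually_mem hz).mono fun w hw =>
      ((hd u hu w hw).add (hd v hv w hw)).right j)
    ((hd _ (contDiffOn_wirtingerBar hV hu j) z hz).add
      (hd _ (contDiffOn_wirtingerBar hV hv j) z hz))

theorem contDiffOn_matrix_det {𝕜 : Type*} [NontriviallyNormedField 𝕜] [NormedAlgebra 𝕜 ℂ]
    {k : WithTop ℕ∞} [NormedSpace 𝕜 (Fin n → ℂ)]
    {V : Set (Fin n → ℂ)} {A : (Fin n → ℂ) → Matrix (Fin n) (Fin n) ℂ}
    (hA : ∀ i j, ContDiffOn 𝕜 k (fun w => A w i j) V) : ContDiffOn 𝕜 k (fun w => (A w).det) V := by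
  simp only [Matrix.det_apply']
  exact ContDiffOn.sum fun σ _ => contDiffOn_const.mul (contDiffOn_prod fun i _ => hA _ _)

theorem differentiableOn_matrix_det
    {V : Set (Fin n → ℂ)} {A : (Fin n → ℂ) → Matrix (Fin n) (Fin n) ℂ}
    (hA : ∀ i j, DifferentiableOn ℂ (fun w => A w i j) V) :
    DifferentiableOn ℂ (fun w => (A w).det) V := by
  simp only [Matrix.det_apply']
  exact DifferentiableOn.fun_sum fun σ _ => (differentiableOn_const _).mul
    fun w hw => (HasFDerivWithinAt.finsetProd fun i _ =>
      (hA (σ i) i w hw).hasFDerivWithinAt).differentiableWithinAt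

end Composition

/-! ### Change of holomorphic coordinates -/

section ChartChange

variable {n : ℕ} {M : Type*} [TopologicalSpace M] [ChartedSpace (Fin n → ℂ) M]
  {e e' : OpenPartialHomeomorph M (Fin n → ℂ)}

theorem differentiableOn_transition (he : e ∈ holoCharts n M) (he' : e' ∈ holoCharts n M) :
    DifferentiableOn ℂ (fun w => e' (e.symm w)) (e.symm.trans e').source := by
  have h := IsManifold.compatible_of_mem_maximalAtlas he he'
  rw [contDiffGroupoid, mem_groupoid_of_pregroupoid] at h
  have h1 := h.1
  simp only [contDiffPregroupoid, modelWithCornersSelf_coe, modelWithCornersSelf_coe_symm,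
    Function.comp_id, Function.id_comp, Set.preimage_id, Set.range_id, Set.inter_univ] at h1
  exact h1.differentiableOn (by simp)

theorem mdifferentiableAt_chart (he : e ∈ holoCharts n M) {q : M} (hq : q ∈ e.source) :
    MDifferentiableAt 𝓘(ℂ, Fin n → ℂ) 𝓘(ℂ, Fin n → ℂ) e q :=
  (contMDiffAt_of_mem_maximalAtlas he hq).mdifferentiableAt (by simp)

theorem mdifferentiableAt_chart_symm (he : e ∈ holoCharts n M) {z : Fin n → ℂ}
    (hz : z ∈ e.target) : MDifferentiableAt 𝓘(ℂ, Fin n → ℂ) 𝓘(ℂ, Fin n → ℂ) e.symm z :=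
  (contMDiffAt_symm_of_mem_maximalAtlas he hz).mdifferentiableAt (by simp)

/-- The derivative of the inverse of a chart, with values in the model space. -/
def symmDeriv (e : OpenPartialHomeomorph M (Fin n → ℂ)) (z : Fin n → ℂ) :
    (Fin n → ℂ) →L[ℂ] (Fin n → ℂ) :=
  mfderiv 𝓘(ℂ, Fin n → ℂ) 𝓘(ℂ, Fin n → ℂ) e.symm z

theorem symmDeriv_transition (he : e ∈ holoCharts n M) (he' : e' ∈ holoCharts n M)
    {z : Fin n → ℂ} (hz : z ∈ (e.symm.trans e').source) :
    symmDeriv e z = (symmDeriv e' (e' (e.symm z))).comp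
      (fderiv ℂ (fun w => e' (e.symm w)) z) := by
  have ho := (e.symm.trans e').open_source
  have hd := (differentiableOn_transition he he').differentiableAt (ho.mem_nhds hz)
  have hev : e.symm =ᶠ[𝓝 z] e'.symm ∘ fun w => e' (e.symm w) := by
    filter_upwards [ho.mem_nhds hz] with w hw
    rw [OpenPartialHomeomorph.trans_source] at hw
    exact (e'.left_inv hw.2).symm
  have hz2 : e' (e.symm z) ∈ e'.target := by
    rw [OpenPartialHomeomorph.trans_source] at hz
    exact e'.map_source hz.2
  unfold symmDeriv
  rw [hev.mfderiv_eq, mfderiv_comp (I' := 𝓘(ℂ, Fin n → ℂ)) z (mdifferentiableAt_chart_symm he' hz2)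
    hd.mdifferentiableAt, mfderiv_eq_fderiv]
  rfl

theorem symmDeriv_injective (he : e ∈ holoCharts n M) {z : Fin n → ℂ} (hz : z ∈ e.target) :
    Function.Injective (symmDeriv e z) := by
  have h1 : (e ∘ e.symm) =ᶠ[𝓝 z] id := by
    filter_upwards [e.open_target.mem_nhds hz] with w hw
    exact e.right_inv hw
  have h2 := mfderiv_comp (I := 𝓘(ℂ, Fin n → ℂ)) (I' := 𝓘(ℂ, Fin n → ℂ))
    (I'' := 𝓘(ℂ, Fin n → ℂ)) z (mdifferentiableAt_chart he (e.map_target hz))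
    (mdifferentiableAt_chart_symm he hz)
  rw [h1.mfderiv_eq, mfderiv_id] at h2
  intro v w hvw
  have h3 : ∀ v : Fin n → ℂ, v = mfderiv 𝓘(ℂ, Fin n → ℂ) 𝓘(ℂ, Fin n → ℂ) e (e.symm z)
      (symmDeriv e z v) := fun v => DFunLike.congr_fun h2 v
  rw [h3 v, h3 w, hvw]

/-- The Hermitian form of a metric, read on the model space. -/
def modelForm (g : KahlerMetric n M) (p : M) : (Fin n → ℂ) →ₗ[ℂ] (Fin n → ℂ) →ₗ⋆[ℂ] ℂ := g.form p

theorem metricMatrix_eq (g : KahlerMetric n M) (e : OpenPartialHomeomorph M (Fin n → ℂ))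
    (z : Fin n → ℂ) (i j : Fin n) : metricMatrix g e z i j
      = modelForm g (e.symm z) (symmDeriv e z (Pi.single i 1)) (symmDeriv e z (Pi.single j 1)) :=
  rfl

theorem sum_smul_single (v : Fin n → ℂ) : v = ∑ k, v k • (Pi.single k 1 : Fin n → ℂ) := by
  ext l; simp [Finset.sum_apply, Pi.single_apply]

theorem modelForm_apply_sum (g : KahlerMetric n M) (e : OpenPartialHomeomorph M (Fin n → ℂ))
    (z v w : Fin n → ℂ) : modelForm g (e.symm z) (symmDeriv e z v) (symmDeriv e z w)
      = ∑ k, ∑ l, v k * metricMatrix g e z k l * conj (w l) := by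
  conv_lhs => rw [sum_smul_single v, sum_smul_single w]
  simp only [map_sum, map_smul, LinearMap.sum_apply, LinearMap.smul_apply, map_smulₛₗ,
    smul_eq_mul, metricMatrix_eq]
  simp only [Finset.mul_sum]
  rw [Finset.sum_comm]
  refine Finset.sum_congr rfl fun k _ => Finset.sum_congr rfl fun l _ => ?_
  ring

theorem metricMatrix_transition (g : KahlerMetric n M) (he : e ∈ holoCharts n M)
    (he' : e' ∈ holoCharts n M) {z : Fin n → ℂ} (hz : z ∈ (e.symm.trans e').source)
    (i j : Fin n) : metricMatrix g e z i j
      = ∑ k, ∑ l, jacobian (fun w => e' (e.symm w)) z k i * metricMatrix g e' (e' (e.symm z)) k l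
        * conj (jacobian (fun w => e' (e.symm w)) z l j) := by
  have h1 : e'.symm (e' (e.symm z)) = e.symm z := by
    rw [OpenPartialHomeomorph.trans_source] at hz
    exact e'.left_inv hz.2
  rw [metricMatrix_eq, symmDeriv_transition he he' hz, ContinuousLinearMap.comp_apply,
    ContinuousLinearMap.comp_apply]
  have h2 := modelForm_apply_sum g e' (e' (e.symm z))
    (fderiv ℂ (fun w => e' (e.symm w)) z (Pi.single i 1))
    (fderiv ℂ (fun w => e' (e.symm w)) z (Pi.single j 1))
  rw [h1] at h2
  exact h2

/-- `metricMatrix_transition` as an identity of matrices. -/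
theorem metricMatrix_transition' (g : KahlerMetric n M) (he : e ∈ holoCharts n M)
    (he' : e' ∈ holoCharts n M) {z : Fin n → ℂ} (hz : z ∈ (e.symm.trans e').source) :
    metricMatrix g e z = (jacobian (fun w => e' (e.symm w)) z).transpose
      * metricMatrix g e' (e' (e.symm z))
      * (jacobian (fun w => e' (e.symm w)) z).map conj := by
  ext i j
  rw [metricMatrix_transition g he he' hz]
  simp only [Matrix.mul_apply, Matrix.transpose_apply, Matrix.map_apply, Finset.sum_mul]
  rw [Finset.sum_comm]

open scoped ComplexOrder in
theorem metricMatrix_posDef (g : KahlerMetric n M) (he : e ∈ holoCharts n M) {z : Fin n → ℂ}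
    (hz : z ∈ e.target) : (metricMatrix g e z).PosDef := by
  have hherm : ∀ p v w, modelForm g p v w = conj (modelForm g p w v) :=
    fun p v w => g.hermitian p w v
  refine Matrix.PosDef.of_dotProduct_mulVec_pos ?_ fun v hv => ?_
  · ext i j
    rw [Matrix.conjTranspose_apply, metricMatrix_eq, metricMatrix_eq, hherm]
    simp
  · have h0 : symmDeriv e z (star v) ≠ 0 := by
      intro h
      have := symmDeriv_injective he hz (h.trans (map_zero _).symm)
      exact hv (star_eq_zero.1 this)
    have h1 : 0 < (modelForm g (e.symm z) (symmDeriv e z (star v)) (symmDeriv e z (star v))).re :=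
      g.posDef _ _ h0
    have h2 := hherm (e.symm z) (symmDeriv e z (star v)) (symmDeriv e z (star v))
    have h3 : star v ⬝ᵥ (metricMatrix g e z).mulVec v
        = modelForm g (e.symm z) (symmDeriv e z (star v)) (symmDeriv e z (star v)) := by
      rw [modelForm_apply_sum]
      simp [dotProduct, Matrix.mulVec, Finset.mul_sum, mul_assoc]
    rw [h3, Complex.lt_def]
    refine ⟨h1, ?_⟩
    have := congrArg Complex.im h2
    simp only [Complex.conj_im] at this
    simp only [Complex.zero_im]; linarith

theorem metricMatrix_det_pos (g : KahlerMetric n M) (he : e ∈ holoCharts n M) {z : Fin n → ℂ}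
    (hz : z ∈ e.target) : 0 < (metricMatrix g e z).det.re ∧
      ((metricMatrix g e z).det.re : ℂ) = (metricMatrix g e z).det := by
  have h := (metricMatrix_posDef g he hz).det_pos
  rw [Complex.lt_def] at h
  exact ⟨h.1, Complex.ext (by simp) (by simpa using h.2)⟩

theorem metricMatrix_det_ne_zero (g : KahlerMetric n M) (he : e ∈ holoCharts n M)
    {z : Fin n → ℂ} (hz : z ∈ e.target) : (metricMatrix g e z).det ≠ 0 := by
  rw [← (metricMatrix_det_pos g he hz).2]
  exact_mod_cast (metricMatrix_det_pos g he hz).1.ne'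

theorem contDiffOn_log_det (g : KahlerMetric n M) (he : e ∈ holoCharts n M) :
    ContDiffOn ℝ ∞ (fun w => (Real.log (metricMatrix g e w).det.re : ℂ)) e.target := by
  have h1 : ContDiffOn ℝ ∞ (fun w => (metricMatrix g e w).det) e.target :=
    contDiffOn_matrix_det fun i j => g.smooth e he i j
  have h2 : ContDiffOn ℝ ∞ (fun w => (metricMatrix g e w).det.re) e.target :=
    Complex.reCLM.contDiff.comp_contDiffOn h1
  exact Complex.ofRealCLM.contDiff.comp_contDiffOn
    (h2.log fun w hw => (metricMatrix_det_pos g he hw).1.ne')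

theorem contDiffOn_ricciMatrix (g : KahlerMetric n M) (he : e ∈ holoCharts n M) (i j : Fin n) :
    ContDiffOn ℝ ∞ (fun w => ricciMatrix g e w i j) e.target :=
  (contDiffOn_wirtinger e.open_target
    (contDiffOn_wirtingerBar e.open_target (contDiffOn_log_det g he) j) i).neg

theorem ricciMatrix_transition (g : KahlerMetric n M) (he : e ∈ holoCharts n M)
    (he' : e' ∈ holoCharts n M) {z : Fin n → ℂ} (hz : z ∈ (e.symm.trans e').source)
    (i j : Fin n) : ricciMatrix g e z i j
      = ∑ k, ∑ l, jacobian (fun w => e' (e.symm w)) z k i * ricciMatrix g e' (e' (e.symm z)) k l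
        * conj (jacobian (fun w => e' (e.symm w)) z l j) := by
  set φ := fun w => e' (e.symm w) with hφ
  set U := (e.symm.trans e').source with hU
  have ho : IsOpen U := (e.symm.trans e').open_source
  have hUm : ∀ w ∈ U, w ∈ e.target ∧ φ w ∈ e'.target := by
    intro w hw
    rw [hU, OpenPartialHomeomorph.trans_source] at hw
    exact ⟨hw.1, e'.map_source hw.2⟩
  have hd : DifferentiableOn ℂ φ U := differentiableOn_transition he he'
  have hdet : ∀ w ∈ U, (metricMatrix g e w).det = (metricMatrix g e' (φ w)).det
      * Complex.normSq (jacobian φ w).det := by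
    intro w hw
    rw [metricMatrix_transition' g he he' hw, Matrix.det_mul, Matrix.det_mul,
      Matrix.det_transpose, ← Complex.mul_conj]
    have : ((jacobian φ w).map conj).det = conj (jacobian φ w).det :=
      (RingHom.map_det (starRingEnd ℂ) _).symm
    rw [this]; ring
  have hJ : ∀ w ∈ U, (jacobian φ w).det ≠ 0 := by
    intro w hw h0
    refine metricMatrix_det_ne_zero g he (hUm w hw).1 ?_
    rw [hdet w hw, h0]; simp
  have hJd : DifferentiableOn ℂ (fun w => (jacobian φ w).det) U :=
    differentiableOn_matrix_det fun k l => differentiableOn_jacobian ho hd k l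
  have hev : (fun w => (Real.log (metricMatrix g e w).det.re : ℂ)) =ᶠ[𝓝 z]
      fun w => (Real.log (metricMatrix g e' (φ w)).det.re : ℂ)
        + (Real.log (Complex.normSq (jacobian φ w).det) : ℂ) := by
    filter_upwards [ho.mem_nhds hz] with w hw
    rw [hdet w hw, Complex.re_mul_ofReal, Real.log_mul
      (metricMatrix_det_pos g he' (hUm w hw).2).1.ne' (by simpa using hJ w hw)]
    push_cast; rfl
  have hφr : ContDiffOn ℝ ∞ φ U := by
    have h := IsManifold.compatible_of_mem_maximalAtlas he he'
    rw [contDiffGroupoid, mem_groupoid_of_pregroupoid] at h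
    have h1 := h.1
    simp only [contDiffPregroupoid, modelWithCornersSelf_coe, modelWithCornersSelf_coe_symm,
      Function.comp_id, Function.id_comp, Set.preimage_id, Set.range_id, Set.inter_univ] at h1
    exact (h1.restrict_scalars ℝ).of_le (by simp)
  have hs1 : ContDiffOn ℝ ∞ (fun w => (Real.log (metricMatrix g e' (φ w)).det.re : ℂ)) U :=
    (contDiffOn_log_det g he').comp hφr fun w hw => (hUm w hw).2
  have hs2 : ContDiffOn ℝ ∞ (fun w => (Real.log (Complex.normSq (jacobian φ w).det) : ℂ)) U := by
    have h3 : ContDiffOn ℝ ∞ (fun w => (Real.log (metricMatrix g e w).det.re : ℂ)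
        - (Real.log (metricMatrix g e' (φ w)).det.re : ℂ)) U :=
      ((contDiffOn_log_det g he).mono fun w hw => (hUm w hw).1).sub hs1
    refine h3.congr fun w hw => ?_
    rw [hdet w hw, Complex.re_mul_ofReal, Real.log_mul
      (metricMatrix_det_pos g he' (hUm w hw).2).1.ne' (by simpa using hJ w hw)]
    push_cast; ring
  have h1 : ddbar (fun w => (Real.log (metricMatrix g e w).det.re : ℂ)) i j z
      = ∑ k, ∑ l, jacobian φ z k i
        * ddbar (fun w => (Real.log (metricMatrix g e' w).det.re : ℂ)) k l (φ z)
        * conj (jacobian φ z l j) := by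
    rw [ddbar_congr hev, ddbar_add ho hs1 hs2 hz, ddbar_log_normSq ho hJd hJ hz, add_zero]
    exact ddbar_comp_holomorphic ho e'.open_target hd (fun w hw => (hUm w hw).2)
      (contDiffOn_log_det g he') hz i j
  simp only [ricciMatrix, h1, mul_neg, neg_mul, Finset.sum_neg_distrib]
  rfl

/-- Proportionality of the Ricci tensor and the metric at a point does not depend on the chart. -/
theorem ricciMatrix_eq_smul_of_chart (g : KahlerMetric n M) (he : e ∈ holoCharts n M)
    (he' : e' ∈ holoCharts n M) {q : M} (hq : q ∈ e.source) (hq' : q ∈ e'.source) {c : ℂ}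
    (h : ricciMatrix g e' (e' q) = c • metricMatrix g e' (e' q)) :
    ricciMatrix g e (e q) = c • metricMatrix g e (e q) := by
  have hz : e q ∈ (e.symm.trans e').source := by
    rw [OpenPartialHomeomorph.trans_source]
    exact ⟨e.map_source hq, by simpa [e.left_inv hq] using hq'⟩
  ext i j
  rw [Matrix.smul_apply, ricciMatrix_transition g he he' hz, metricMatrix_transition g he he' hz,
    e.left_inv hq, h, Finset.smul_sum]
  refine Finset.sum_congr rfl fun k _ => ?_
  rw [Finset.smul_sum]
  refine Finset.sum_congr rfl fun l _ => ?_
  simp only [Matrix.smul_apply, smul_eq_mul]; ring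

/-- A metric that is Einstein near every point, in some chart and with a constant depending on the
point, is Einstein: the constant is locally constant, hence constant. -/
theorem mem_KE_of_local [ConnectedSpace M] (hn : 0 < n) (g : KahlerMetric n M)
    (h : ∀ p : M, ∃ e ∈ holoCharts n M, p ∈ e.source ∧ ∃ c : ℝ, ∀ᶠ w in 𝓝 (e p),
      ricciMatrix g e w = (c : ℂ) • metricMatrix g e w) : g ∈ KE n M := by
  choose e he hp c hc using h
  have huniq : ∀ (e : OpenPartialHomeomorph M (Fin n → ℂ)), e ∈ holoCharts n M → ∀ q ∈ e.source,
      ∀ c c' : ℝ, ricciMatrix g e (e q) = (c : ℂ) • metricMatrix g e (e q) →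
        ricciMatrix g e (e q) = (c' : ℂ) • metricMatrix g e (e q) → c = c' := by
    intro e he q hq c c' h1 h2
    have h3 : ((c : ℂ) - c') • metricMatrix g e (e q) = 0 := by
      rw [sub_smul, ← h1, ← h2, sub_self]
    rcases smul_eq_zero.1 h3 with h4 | h4
    · exact_mod_cast sub_eq_zero.1 h4
    · exfalso
      apply metricMatrix_det_ne_zero g he (e.map_source hq)
      have : Nonempty (Fin n) := ⟨⟨0, hn⟩⟩
      rw [h4, Matrix.det_zero]
  have hloc : IsLocallyConstant c := by
    rw [IsLocallyConstant.iff_eventually_eq]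
    intro p
    have h1 := ((e p).continuousAt (hp p)).eventually (hc p)
    filter_upwards [h1, (e p).open_source.mem_nhds (hp p)] with q hq hqs
    refine huniq (e p) (he p) q hqs _ _ ?_ hq
    exact ricciMatrix_eq_smul_of_chart g (he p) (he q) hqs (hp q) (hc q).self_of_nhds
  have p₀ : M := Classical.arbitrary M
  refine ⟨2 * c p₀, fun e₁ he₁ z hz => ?_⟩
  have h1 : c (e₁.symm z) = c p₀ := hloc.apply_eq_of_preconnectedSpace _ _
  have h2 := ricciMatrix_eq_smul_of_chart g he₁ (he (e₁.symm z)) (e₁.map_target hz)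
    (hp (e₁.symm z)) (hc (e₁.symm z)).self_of_nhds
  rw [e₁.right_inv hz, h1] at h2
  ext i j
  rw [ricciForm, h2, kahlerForm]
  simp only [Matrix.smul_apply, smul_eq_mul]
  push_cast; ring

end ChartChange

section PuncturedBall

variable {E : Type*} [NormedAddCommGroup E] [NormedSpace ℝ E]

theorem isPreconnected_punctured_ball (h : 1 < Module.rank ℝ E) {r : ℝ} (hr : 0 < r) :
    IsPreconnected (Metric.ball (0 : E) r \ {0}) := by
  have h1 : Continuous fun x : E => (r / (1 + ‖x‖)) • x := by
    refine Continuous.smul (continuous_const.div (by fun_prop) fun x => ?_) continuous_id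
    positivity
  have h2 := (isConnected_compl_singleton_of_one_lt_rank h (0 : E)).isPreconnected.image _
    h1.continuousOn
  convert h2 using 1
  ext y
  simp only [Set.mem_sdiff, Metric.mem_ball, dist_zero_right, Set.mem_singleton_iff,
    Set.mem_image, Set.mem_compl_iff]
  constructor
  · rintro ⟨hy, hy0⟩
    have hy1 : 0 < r - ‖y‖ := by linarith
    refine ⟨(r - ‖y‖)⁻¹ • y, by simp [hy1.ne', hy0], ?_⟩
    rw [norm_smul, norm_inv, Real.norm_of_nonneg hy1.le, smul_smul]
    have : r / (1 + (r - ‖y‖)⁻¹ * ‖y‖) * (r - ‖y‖)⁻¹ = 1 := by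
      field_simp
      ring_nf
    rw [this, one_smul]
  · rintro ⟨x, hx, rfl⟩
    have hx1 : 0 < 1 + ‖x‖ := by positivity
    refine ⟨?_, by simp [hx, hr.ne', hx1.ne']⟩
    rw [norm_smul, Real.norm_of_nonneg (by positivity), div_mul_eq_mul_div, div_lt_iff₀ hx1]
    nlinarith

end PuncturedBall

/-! ### Radial metrics in coordinates -/

section OneVariable

variable {I : Set ℝ} {u : ℝ → ℝ}

theorem hasDerivAt_of_contDiffOn (hI : IsOpen I) (hu : ContDiffOn ℝ ∞ u I) {x : ℝ} (hx : x ∈ I) :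
    HasDerivAt u (deriv u x) x :=
  ((hu.contDiffAt (hI.mem_nhds hx)).differentiableAt (by simp)).hasDerivAt

theorem contDiffOn_deriv (hI : IsOpen I) (hu : ContDiffOn ℝ ∞ u I) :
    ContDiffOn ℝ ∞ (deriv u) I :=
  hu.deriv_of_isOpen hI (by simp)

end OneVariable

section RadialMatrix

variable {n : ℕ}

/-- The matrix `a δ_ij + b z̄_i z_j`. -/
def radialMatrix (a b : ℂ) (z : Fin n → ℂ) : Matrix (Fin n) (Fin n) ℂ :=
  fun i j => a * (if i = j then 1 else 0) + b * (conj (z i) * z j)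

theorem radialMatrix_eq (a b : ℂ) (z : Fin n → ℂ) : radialMatrix a b z
    = a • (1 : Matrix (Fin n) (Fin n) ℂ) + b • Matrix.vecMulVec (fun i => conj (z i)) z := by
  ext i j
  simp [radialMatrix, Matrix.one_apply, Matrix.vecMulVec_apply]

theorem det_smul_one_add_vecMulVec {R : Type*} [CommRing R] [Nontrivial R] (a b : R)
    (u v : Fin n → R) :
    (a • (1 : Matrix (Fin n) (Fin n) R) + b • Matrix.vecMulVec u v).det
      = a ^ n + b * (u ⬝ᵥ v) * a ^ (n - 1) := by
  have h1 := Matrix.eval_charpoly (Matrix.vecMulVec (-(b • u)) v) a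
  rw [Matrix.charpoly_vecMulVec] at h1
  have h2 : (a • (1 : Matrix (Fin n) (Fin n) R) + b • Matrix.vecMulVec u v)
      = Matrix.scalar (Fin n) a - Matrix.vecMulVec (-(b • u)) v := by
    ext i j
    simp [Matrix.vecMulVec_apply, Matrix.scalar_apply, Matrix.one_apply, Matrix.diagonal_apply]
  rw [h2, ← h1]
  simp [smul_dotProduct]

theorem conj_dotProduct_self (z : Fin n → ℂ) : (fun i => conj (z i)) ⬝ᵥ z = (sqNorm z : ℂ) := by
  rw [ofReal_sqNorm, dotProduct]
  exact Finset.sum_congr rfl fun i _ => mul_comm _ _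

theorem radialMatrix_det (hn : 0 < n) (a b : ℂ) (z : Fin n → ℂ) :
    (radialMatrix a b z).det = a ^ (n - 1) * (a + b * sqNorm z) := by
  rw [radialMatrix_eq, det_smul_one_add_vecMulVec, conj_dotProduct_self]
  obtain ⟨k, rfl⟩ := Nat.exists_eq_succ_of_ne_zero hn.ne'
  simp only [Nat.succ_eq_add_one, Nat.add_sub_cancel]; ring

theorem radialMatrix_mulVec_conj (a b : ℂ) (z : Fin n → ℂ) :
    (radialMatrix a b z).mulVec (fun i => conj (z i))
      = (a + b * sqNorm z) • fun i => conj (z i) := by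
  rw [radialMatrix_eq, Matrix.add_mulVec, Matrix.smul_mulVec, Matrix.smul_mulVec,
    Matrix.one_mulVec, Matrix.vecMulVec_mulVec, dotProduct_comm, conj_dotProduct_self]
  ext i
  simp; ring

theorem vecMul_radialMatrix (a b : ℂ) (z : Fin n → ℂ) :
    Matrix.vecMul z (radialMatrix a b z) = (a + b * sqNorm z) • z := by
  rw [radialMatrix_eq, Matrix.vecMul_add, Matrix.vecMul_smul, Matrix.vecMul_smul,
    Matrix.vecMul_one, Matrix.vecMul_vecMulVec, dotProduct_comm, conj_dotProduct_self]
  ext i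
  simp; ring

theorem radialMatrix_mulVec_tangent (a b : ℂ) {z v : Fin n → ℂ} (hv : ∑ i, v i * z i = 0) :
    (radialMatrix a b z).mulVec v = a • v := by
  have : z ⬝ᵥ v = 0 := by rw [dotProduct_comm]; exact hv
  rw [radialMatrix_eq, Matrix.add_mulVec, Matrix.smul_mulVec, Matrix.smul_mulVec,
    Matrix.one_mulVec, Matrix.vecMulVec_mulVec, this]
  simp

theorem exists_tangent (hn : 1 < n) (z : Fin n → ℂ) :
    ∃ v : Fin n → ℂ, v ≠ 0 ∧ ∑ i, v i * z i = 0 := by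
  let L : (Fin n → ℂ) →ₗ[ℂ] ℂ :=
    { toFun := fun v => ∑ i, v i * z i
      map_add' := fun v w => by simp [add_mul, Finset.sum_add_distrib]
      map_smul' := fun c v => by simp [Finset.mul_sum, mul_assoc] }
  have h : LinearMap.ker L ≠ ⊥ := LinearMap.ker_ne_bot_of_finrank_lt (by simpa using hn)
  obtain ⟨v, hv, hv0⟩ := (Submodule.ne_bot_iff _).1 h
  exact ⟨v, hv0, hv⟩

end RadialMatrix

section Radial

variable {n : ℕ} {M : Type*} [TopologicalSpace M] [ChartedSpace (Fin n → ℂ) M]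

/-- For `φ = f'`, the derivative `(x f')' = φ + x φ'`: the eigenvalue of the metric with potential
`f(|z|²)` in the radial direction. -/
def radialDensity (φ : ℝ → ℝ) (x : ℝ) : ℝ := φ x + x * deriv φ x

/-- The logarithm of the determinant of the metric, as a function of `x = |z|²`. -/
def logDet (n : ℕ) (φ : ℝ → ℝ) (x : ℝ) : ℝ := Real.log (φ x ^ (n - 1) * radialDensity φ x)

/-- The eigenvalue of the Ricci tensor on the complex tangent space of the sphere. -/
def ricTangent (n : ℕ) (φ : ℝ → ℝ) (x : ℝ) : ℝ := -deriv (logDet n φ) x / φ x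

/-- The eigenvalue of the Ricci tensor in the radial direction. -/
def ricRadial (n : ℕ) (φ : ℝ → ℝ) (x : ℝ) : ℝ :=
  -(deriv (logDet n φ) x + x * deriv (deriv (logDet n φ)) x) / radialDensity φ x

/-- The scalar curvature as a function of `x = |z|²`. -/
def scalProfile (n : ℕ) (φ : ℝ → ℝ) (x : ℝ) : ℝ :=
  ((n : ℝ) - 1) * ricTangent n φ x + ricRadial n φ x

/-- On the open set `U` of coordinates, which does not contain `0` and whose points have
`|z|²` filling the interval `I`, the metric `g` is `φ δ_ij + φ' z̄_i z_j` with `φ` evaluated at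
`|z|²`; that is, it has the potential `f(|z|²)` with `f' = φ`. -/
structure IsRadialOn (g : KahlerMetric n M) (e : OpenPartialHomeomorph M (Fin n → ℂ))
    (U : Set (Fin n → ℂ)) (I : Set ℝ) (φ : ℝ → ℝ) : Prop where
  mem_charts : e ∈ holoCharts n M
  dim_pos : 0 < n
  isOpen_U : IsOpen U
  subset : U ⊆ e.target
  isOpen_I : IsOpen I
  conn : IsPreconnected I
  I_pos : ∀ x ∈ I, 0 < x
  maps : ∀ z ∈ U, sqNorm z ∈ I
  surj : ∀ x ∈ I, ∃ z ∈ U, sqNorm z = x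
  smooth : ContDiffOn ℝ ∞ φ I
  pos : ∀ x ∈ I, 0 < φ x
  dens_pos : ∀ x ∈ I, 0 < radialDensity φ x
  metric : ∀ z ∈ U, metricMatrix g e z
    = radialMatrix (φ (sqNorm z)) ((deriv φ (sqNorm z) : ℝ) : ℂ) z

variable {g : KahlerMetric n M} {e : OpenPartialHomeomorph M (Fin n → ℂ)}
  {U : Set (Fin n → ℂ)} {I : Set ℝ} {φ : ℝ → ℝ}

namespace IsRadialOn

/-- Restriction to a smaller interval. -/
theorem mono (h : IsRadialOn g e U I φ) {J : Set ℝ} (hJ : IsOpen J) (hJc : IsPreconnected J)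
    (hJI : J ⊆ I) : IsRadialOn g e (U ∩ sqNorm ⁻¹' J) J φ where
  mem_charts := h.mem_charts
  dim_pos := h.dim_pos
  isOpen_U := h.isOpen_U.inter (hJ.preimage
    (continuous_iff_continuousAt.2 fun _ => differentiableAt_sqNorm.continuousAt))
  subset := Set.inter_subset_left.trans h.subset
  isOpen_I := hJ
  conn := hJc
  I_pos := fun x hx => h.I_pos x (hJI hx)
  maps := fun z hz => hz.2
  surj := fun x hx => by
    obtain ⟨z, hz, rfl⟩ := h.surj x (hJI hx)
    exact ⟨z, ⟨hz, hx⟩, rfl⟩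
  smooth := h.smooth.mono hJI
  pos := fun x hx => h.pos x (hJI hx)
  dens_pos := fun x hx => h.dens_pos x (hJI hx)
  metric := fun z hz => h.metric z hz.1

theorem contDiffOn_density (h : IsRadialOn g e U I φ) : ContDiffOn ℝ ∞ (radialDensity φ) I :=
  h.smooth.add (contDiffOn_id.mul (contDiffOn_deriv h.isOpen_I h.smooth))

theorem contDiffOn_logDet (h : IsRadialOn g e U I φ) : ContDiffOn ℝ ∞ (logDet n φ) I :=
  ((h.smooth.pow (n - 1)).mul h.contDiffOn_density).log fun x hx =>
    (mul_pos (pow_pos (h.pos x hx) _) (h.dens_pos x hx)).ne'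

theorem contDiffOn_ricTangent (h : IsRadialOn g e U I φ) : ContDiffOn ℝ ∞ (ricTangent n φ) I :=
  (contDiffOn_deriv h.isOpen_I h.contDiffOn_logDet).neg.div h.smooth fun x hx => (h.pos x hx).ne'

theorem contDiffOn_ricRadial (h : IsRadialOn g e U I φ) : ContDiffOn ℝ ∞ (ricRadial n φ) I :=
  have h1 := contDiffOn_deriv h.isOpen_I h.contDiffOn_logDet
  (h1.add (contDiffOn_id.mul (contDiffOn_deriv h.isOpen_I h1))).neg.div h.contDiffOn_density
    fun x hx => (h.dens_pos x hx).ne'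

theorem contDiffOn_scalProfile (h : IsRadialOn g e U I φ) : ContDiffOn ℝ ∞ (scalProfile n φ) I :=
  (contDiffOn_const.mul h.contDiffOn_ricTangent).add h.contDiffOn_ricRadial

theorem density_eq_ofReal (φ : ℝ → ℝ) (x : ℝ) :
    (φ x : ℂ) + ((deriv φ x : ℝ) : ℂ) * x = (radialDensity φ x : ℂ) := by
  rw [radialDensity]; push_cast; ring

theorem det_eq (h : IsRadialOn g e U I φ) {z : Fin n → ℂ} (hz : z ∈ U) :
    (metricMatrix g e z).det
      = ((φ (sqNorm z) ^ (n - 1) * radialDensity φ (sqNorm z) : ℝ) : ℂ) := by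
  rw [h.metric z hz, radialMatrix_det h.dim_pos, density_eq_ofReal]
  push_cast; rfl

theorem ricciMatrix_eq (h : IsRadialOn g e U I φ) {z : Fin n → ℂ} (hz : z ∈ U) :
    ricciMatrix g e z = radialMatrix (-deriv (logDet n φ) (sqNorm z) : ℝ)
      (-deriv (deriv (logDet n φ)) (sqNorm z) : ℝ) z := by
  ext i j
  have hev : (fun w => (Real.log (metricMatrix g e w).det.re : ℂ)) =ᶠ[𝓝 z]
      fun w => (logDet n φ (sqNorm w) : ℂ) := by
    filter_upwards [h.isOpen_U.mem_nhds hz] with w hw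
    rw [h.det_eq hw, Complex.ofReal_re]; rfl
  have hx := h.maps z hz
  rw [ricciMatrix, ddbar_congr hev, ddbar_radial (f' := deriv (logDet n φ))
    (f'' := deriv (deriv (logDet n φ)) (sqNorm z))
    ((h.isOpen_I.eventually_mem hx).mono fun x hx =>
      hasDerivAt_of_contDiffOn h.isOpen_I h.contDiffOn_logDet hx)
    (hasDerivAt_of_contDiffOn h.isOpen_I (contDiffOn_deriv h.isOpen_I h.contDiffOn_logDet) hx),
    radialMatrix]
  push_cast; ring

theorem deriv_logDet_eq (h : IsRadialOn g e U I φ) {x : ℝ} (hx : x ∈ I) :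
    -deriv (logDet n φ) x = ricTangent n φ x * φ x := by
  rw [ricTangent, div_mul_cancel₀ _ (h.pos x hx).ne']

theorem deriv_logDet_eq' (h : IsRadialOn g e U I φ) {x : ℝ} (hx : x ∈ I) :
    -deriv (logDet n φ) x + -deriv (deriv (logDet n φ)) x * x
      = ricRadial n φ x * radialDensity φ x := by
  rw [ricRadial, div_mul_cancel₀ _ (h.dens_pos x hx).ne']; ring

theorem inv_mulVec_conj (h : IsRadialOn g e U I φ) {z : Fin n → ℂ} (hz : z ∈ U) :
    (metricMatrix g e z)⁻¹.mulVec (fun i => conj (z i))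
      = (radialDensity φ (sqNorm z) : ℂ)⁻¹ • fun i => conj (z i) := by
  have h1 := radialMatrix_mulVec_conj (φ (sqNorm z)) ((deriv φ (sqNorm z) : ℝ) : ℂ) z
  rw [density_eq_ofReal, ← h.metric z hz] at h1
  have h2 : (radialDensity φ (sqNorm z) : ℂ) ≠ 0 := by
    exact_mod_cast (h.dens_pos _ (h.maps z hz)).ne'
  have h3 : IsUnit (metricMatrix g e z).det :=
    (metricMatrix_det_ne_zero g h.mem_charts (h.subset hz)).isUnit
  rw [eq_inv_smul_iff₀ h2, ← Matrix.mulVec_smul, ← h1, Matrix.mulVec_mulVec,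
    Matrix.nonsing_inv_mul _ h3, Matrix.one_mulVec]

theorem vecMul_inv (h : IsRadialOn g e U I φ) {z : Fin n → ℂ} (hz : z ∈ U) :
    Matrix.vecMul z (metricMatrix g e z)⁻¹ = (radialDensity φ (sqNorm z) : ℂ)⁻¹ • z := by
  have h1 := vecMul_radialMatrix (φ (sqNorm z)) ((deriv φ (sqNorm z) : ℝ) : ℂ) z
  rw [density_eq_ofReal, ← h.metric z hz] at h1
  have h2 : (radialDensity φ (sqNorm z) : ℂ) ≠ 0 := by
    exact_mod_cast (h.dens_pos _ (h.maps z hz)).ne'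
  have h3 : IsUnit (metricMatrix g e z).det :=
    (metricMatrix_det_ne_zero g h.mem_charts (h.subset hz)).isUnit
  rw [eq_inv_smul_iff₀ h2, ← Matrix.smul_vecMul, ← h1, Matrix.vecMul_vecMul,
    Matrix.mul_nonsing_inv _ h3, Matrix.vecMul_one]

theorem scalarCurvature_eq (h : IsRadialOn g e U I φ) {z : Fin n → ℂ} (hz : z ∈ U) :
    scalarCurvature g e z = (scalProfile n φ (sqNorm z) : ℂ) := by
  have hx := h.maps z hz
  set x := sqNorm z with hxd
  have h3 : IsUnit (metricMatrix g e z).det :=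
    (metricMatrix_det_ne_zero g h.mem_charts (h.subset hz)).isUnit
  have hD : (radialDensity φ x : ℂ) ≠ 0 := by exact_mod_cast (h.dens_pos x hx).ne'
  -- split off the part proportional to the metric
  have h4 : ricciMatrix g e z = (ricTangent n φ x : ℂ) • metricMatrix g e z
      + ((-deriv (deriv (logDet n φ)) x - ricTangent n φ x * deriv φ x : ℝ) : ℂ) •
        Matrix.vecMulVec (fun i => conj (z i)) z := by
    rw [h.ricciMatrix_eq hz, h.metric z hz, ← hxd, h.deriv_logDet_eq hx]
    ext i j
    simp only [radialMatrix, Matrix.add_apply, Matrix.smul_apply, Matrix.vecMulVec_apply,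
      smul_eq_mul]
    push_cast; ring
  rw [scalarCurvature, h4, Matrix.mul_add, Matrix.mul_smul, Matrix.mul_smul,
    Matrix.nonsing_inv_mul _ h3, Matrix.mul_vecMulVec, h.inv_mulVec_conj hz, Matrix.trace_add,
    Matrix.trace_smul, Matrix.trace_smul, Matrix.trace_one, Matrix.trace_vecMulVec,
    smul_dotProduct, conj_dotProduct_self, ← hxd]
  simp only [smul_eq_mul, Fintype.card_fin]
  have h5 := h.deriv_logDet_eq' hx
  rw [h.deriv_logDet_eq hx] at h5
  have h6 : (-deriv (deriv (logDet n φ)) x - ricTangent n φ x * deriv φ x) * x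
      = (ricRadial n φ x - ricTangent n φ x) * radialDensity φ x := by
    have : radialDensity φ x = φ x + x * deriv φ x := rfl
    linear_combination h5 + ricTangent n φ x * this
  have h7 : ((-deriv (deriv (logDet n φ)) x - ricTangent n φ x * deriv φ x : ℝ) : ℂ)
      * ((radialDensity φ x : ℂ)⁻¹ * x) = ricRadial n φ x - ricTangent n φ x := by
    rw [mul_left_comm, inv_mul_eq_iff_eq_mul₀ hD]
    rw [mul_comm (radialDensity φ x : ℂ)]
    exact_mod_cast h6
  rw [h7, scalProfile]
  push_cast; ring

open Polynomial in
theorem genScalarCurvature_eq (h : IsRadialOn g e U I φ) {z : Fin n → ℂ} (hz : z ∈ U) (k : ℕ) :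
    genScalarCurvature g (k + 1) e z
      = (((n - 1).choose (k + 1) * ricTangent n φ (sqNorm z) ^ (k + 1)
        + (n - 1).choose k * ricTangent n φ (sqNorm z) ^ k * ricRadial n φ (sqNorm z) : ℝ) : ℂ) := by
  have hx := h.maps z hz
  have hdet := metricMatrix_det_ne_zero g h.mem_charts (h.subset hz)
  rw [genScalarCurvature, div_eq_iff hdet, h.det_eq hz, h.ricciMatrix_eq hz, h.metric z hz]
  set x := sqNorm z with hxd
  have h5 := h.deriv_logDet_eq' hx
  rw [h.deriv_logDet_eq hx] at h5 ⊢
  set m := ricTangent n φ x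
  set μ := ricRadial n φ x
  set D := radialDensity φ x with hD
  set B := -deriv (deriv (logDet n φ)) x
  have hmat : (radialMatrix (φ x) ((deriv φ x : ℝ) : ℂ) z).map (C : ℂ → ℂ[X])
      + (X : ℂ[X]) • (radialMatrix ((m * φ x : ℝ) : ℂ) (B : ℂ) z).map (C : ℂ → ℂ[X])
      = (C (φ x : ℂ) * (1 + C (m : ℂ) * X)) • (1 : Matrix (Fin n) (Fin n) ℂ[X])
        + (C ((deriv φ x : ℝ) : ℂ) + X * C (B : ℂ)) •
          Matrix.vecMulVec (fun i => C (conj (z i))) (fun i => C (z i)) := by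
    ext1 i j
    simp only [radialMatrix, Matrix.add_apply, Matrix.map_apply, Matrix.smul_apply, smul_eq_mul,
      Matrix.one_apply, Matrix.vecMulVec_apply, Complex.ofReal_mul, C_add, C_mul]
    split_ifs <;> simp <;> ring
  have hdot : (fun i => (C (conj (z i)) : ℂ[X])) ⬝ᵥ (fun i => C (z i)) = C (x : ℂ) := by
    rw [hxd, ← conj_dotProduct_self, dotProduct, dotProduct, map_sum]
    simp
  have hfac : (C (φ x : ℂ) * (1 + C (m : ℂ) * X))
      + (C ((deriv φ x : ℝ) : ℂ) + X * C (B : ℂ)) * C (x : ℂ)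
      = C (D : ℂ) * (1 + C (μ : ℂ) * X) := by
    have e1 : (D : ℂ) = φ x + x * deriv φ x := by rw [hD, radialDensity]; push_cast; rfl
    have e2 : (μ : ℂ) * D = m * φ x + B * x := by exact_mod_cast h5.symm
    have e3 := congrArg (C : ℂ → ℂ[X]) e1
    have e4 := congrArg (C : ℂ → ℂ[X]) e2
    simp only [C_add, C_mul] at e3 e4
    linear_combination -e3 - X * e4
  have hpow : (C (φ x : ℂ) * (1 + C (m : ℂ) * X)) ^ n
      = (C (φ x : ℂ) * (1 + C (m : ℂ) * X)) ^ (n - 1) * (C (φ x : ℂ) * (1 + C (m : ℂ) * X)) := by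
    rw [← pow_succ, Nat.sub_add_cancel h.dim_pos]
  rw [hmat, det_smul_one_add_vecMulVec, hdot, hpow, mul_comm _ ((C (φ x : ℂ) *
    (1 + C (m : ℂ) * X)) ^ (n - 1)), ← mul_add, hfac]
  have hcoeff : ∀ j, ((1 + C (m : ℂ) * X) ^ (n - 1) : ℂ[X]).coeff j
      = (n - 1).choose j * (m : ℂ) ^ j := by
    intro j
    have : ((1 + C (m : ℂ) * X) ^ (n - 1) : ℂ[X])
        = ((1 + X) ^ (n - 1) : ℂ[X]).comp (C (m : ℂ) * X) := by simp
    rw [this, comp_C_mul_X_coeff, coeff_one_add_X_pow]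
  have : ((C (φ x : ℂ) * (1 + C (m : ℂ) * X)) ^ (n - 1) * (C (D : ℂ) * (1 + C (μ : ℂ) * X)))
      = C ((φ x : ℂ) ^ (n - 1) * D) * ((1 + C (m : ℂ) * X) ^ (n - 1)
        + C (μ : ℂ) * ((1 + C (m : ℂ) * X) ^ (n - 1) * X)) := by
    rw [mul_pow, C_mul, C_pow]; ring
  rw [this, coeff_C_mul, coeff_add, coeff_C_mul, coeff_mul_X, hcoeff, hcoeff]
  push_cast; ring

end IsRadialOn

end Radial

section Existence

variable {n : ℕ} {M : Type*} [TopologicalSpace M] [ChartedSpace (Fin n → ℂ) M]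
  {g : KahlerMetric n M} {e : OpenPartialHomeomorph M (Fin n → ℂ)}

theorem sqNorm_smul (c : ℝ) (z : Fin n → ℂ) : sqNorm ((c : ℂ) • z) = c ^ 2 * sqNorm z := by
  simp [sqNorm, Finset.mul_sum, mul_pow]

theorem sqNorm_pos {z : Fin n → ℂ} (hz : z ≠ 0) : 0 < sqNorm z := by
  obtain ⟨i, hi⟩ := Function.ne_iff.1 hz
  exact Finset.sum_pos' (fun i _ => by positivity)
    ⟨i, Finset.mem_univ i, by have := norm_pos_iff.2 hi; positivity⟩

open scoped ComplexOrder in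
/-- A positive definite matrix `a δ_ij + b z̄_i z_j` has positive radial eigenvalue `a + b|z|²`,
and positive tangential eigenvalue `a` if there are tangential directions. -/
theorem radialMatrix_pos {a b : ℝ} {z : Fin n → ℂ} (hz : z ≠ 0)
    (h : (radialMatrix (a : ℂ) (b : ℂ) z).PosDef) : 0 < a + b * sqNorm z ∧ (1 < n → 0 < a) := by
  have key : ∀ (v : Fin n → ℂ) (c : ℝ), v ≠ 0 →
      (radialMatrix (a : ℂ) (b : ℂ) z).mulVec v = (c : ℂ) • v → 0 < c := by
    intro v c hv hc
    have h1 := h.re_dotProduct_pos hv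
    have h2 : star v ⬝ᵥ v = (sqNorm v : ℂ) := conj_dotProduct_self v
    rw [hc, dotProduct_smul, h2, smul_eq_mul] at h1
    have h3 : 0 < c * sqNorm v := by simpa using h1
    exact pos_of_mul_pos_left h3 (sqNorm_pos hv).le
  constructor
  · refine key (fun i => conj (z i)) _ (fun h0 => hz ?_) ?_
    · ext i
      simpa using congrFun h0 i
    · rw [radialMatrix_mulVec_conj]; push_cast; rfl
  · intro hn
    obtain ⟨v, hv0, hv⟩ := exists_tangent hn z
    exact key v a hv0 (radialMatrix_mulVec_tangent _ _ hv)

/-- In a chart where the potential is radial, the metric is radial near each point other than the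
origin. In dimension one the term `log |z|²` is pluriharmonic, and a multiple of it is added to the
potential to make its derivative `φ` positive. -/
theorem exists_isRadialOn (hn : 0 < n) (he : e ∈ holoCharts n M) {Φ : M → ℝ}
    (hΦ : ContDiffOn ℝ ∞ (fun z => Φ (e.symm z)) e.target)
    (hg : ∀ z ∈ e.target, ∀ i j : Fin n,
        kahlerForm g e z i j = ddbar (fun w => (Φ (e.symm w) : ℂ)) i j z)
    {f : ℝ → ℝ} (hf : ∀ q ∈ e.source, Φ q = f (∑ i, ‖e q i‖ ^ 2))
    {z₀ : Fin n → ℂ} (hz₀ : z₀ ∈ e.target) (h0 : z₀ ≠ 0) :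
    ∃ (U : Set (Fin n → ℂ)) (I : Set ℝ) (φ : ℝ → ℝ), IsRadialOn g e U I φ ∧ z₀ ∈ U := by
  have hf' : ∀ z ∈ e.target, Φ (e.symm z) = f (sqNorm z) := by
    intro z hz
    rw [hf _ (e.map_target hz), e.right_inv hz]; rfl
  have hx₀ : 0 < sqNorm z₀ := sqNorm_pos h0
  set x₀ := sqNorm z₀ with hx₀d
  -- the real half-line through `z₀`, parametrized by the squared norm
  let γ : ℝ → Fin n → ℂ := fun x => ((Real.sqrt (x / x₀) : ℝ) : ℂ) • z₀
  have hγN : ∀ x, 0 < x → sqNorm (γ x) = x := by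
    intro x hx
    rw [sqNorm_smul, Real.sq_sqrt (by positivity), ← hx₀d]; field_simp
  have hγ₀ : γ x₀ = z₀ := by
    simp only [γ]; rw [div_self hx₀.ne']; simp
  have hγc : Continuous γ := by fun_prop
  have hγs : ContDiffOn ℝ ∞ γ (Set.Ioi 0) := by
    have h1 : ContDiffOn ℝ ∞ (fun x : ℝ => Real.sqrt (x / x₀)) (Set.Ioi 0) := by
      refine ContDiffOn.sqrt (by fun_prop) fun x hx => ?_
      have : 0 < x := hx
      positivity
    exact (Complex.ofRealCLM.contDiff.comp_contDiffOn h1).smul contDiffOn_const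
  set I₀ : Set ℝ := Set.Ioi 0 ∩ γ ⁻¹' e.target with hI₀
  have hI₀o : IsOpen I₀ := isOpen_Ioi.inter (e.open_target.preimage hγc)
  have hx₀I : x₀ ∈ I₀ := ⟨hx₀, by simpa [hγ₀] using hz₀⟩
  have hfs : ContDiffOn ℝ ∞ f I₀ := by
    refine (hΦ.comp (hγs.mono Set.inter_subset_left) fun x hx => hx.2).congr fun x hx => ?_
    simp only [Function.comp]
    rw [hf' _ hx.2, hγN x hx.1]
  have hfs' := contDiffOn_deriv hI₀o hfs
  have hmet : ∀ z ∈ e.target, sqNorm z ∈ I₀ → metricMatrix g e z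
      = radialMatrix ((deriv f (sqNorm z) : ℝ) : ℂ) ((deriv (deriv f) (sqNorm z) : ℝ) : ℂ) z := by
    intro z hz hzI
    ext i j
    have hev : (fun w => (Φ (e.symm w) : ℂ)) =ᶠ[𝓝 z] fun w => (f (sqNorm w) : ℂ) := by
      filter_upwards [e.open_target.mem_nhds hz] with w hw
      rw [hf' w hw]
    have h1 := hg z hz i j
    rw [kahlerForm] at h1
    rw [h1, ddbar_congr hev, ddbar_radial (f' := deriv f) (f'' := deriv (deriv f) (sqNorm z))
      ((hI₀o.eventually_mem hzI).mono fun x hx => hasDerivAt_of_contDiffOn hI₀o hfs hx)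
      (hasDerivAt_of_contDiffOn hI₀o hfs' hzI)]
    rfl
  have hne : ∀ z : Fin n → ℂ, sqNorm z ∈ I₀ → z ≠ 0 := by
    rintro z hz rfl
    have : (0 : ℝ) < sqNorm (0 : Fin n → ℂ) := hz.1
    simp [sqNorm] at this
  have hpos : ∀ x ∈ I₀, 0 < deriv f x + deriv (deriv f) x * x ∧ (1 < n → 0 < deriv f x) := by
    intro x hx
    have h2 := metricMatrix_posDef g he hx.2
    have h3 : sqNorm (γ x) = x := hγN x hx.1
    rw [hmet _ hx.2 (by rwa [h3]), h3] at h2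
    simpa only [h3] using radialMatrix_pos (hne _ (by rwa [h3])) h2
  -- for `n = 1` the metric only controls `(x f')'`, which `f' + C / x` does not change
  obtain ⟨C, hC, hCpos⟩ : ∃ C : ℝ, (n = 1 ∨ C = 0) ∧ 0 < deriv f x₀ + C / x₀ := by
    rcases Nat.lt_or_ge 1 n with h1 | h1
    · exact ⟨0, Or.inr rfl, by simpa using (hpos x₀ hx₀I).2 h1⟩
    · refine ⟨x₀ * (1 + |deriv f x₀|), Or.inl (by omega), ?_⟩
      rw [mul_div_cancel_left₀ _ hx₀.ne']
      have := neg_abs_le (deriv f x₀)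
      linarith
  set φ : ℝ → ℝ := fun x => deriv f x + C / x with hφ
  have hφs : ContDiffOn ℝ ∞ φ I₀ :=
    hfs'.add (contDiffOn_const.div contDiffOn_id fun x hx => (show (0 : ℝ) < x from hx.1).ne')
  have hφd : ∀ x ∈ I₀, deriv φ x = deriv (deriv f) x - C / x ^ 2 := by
    intro x hx
    have hx0 : x ≠ 0 := (show (0 : ℝ) < x from hx.1).ne'
    have h1 := (hasDerivAt_of_contDiffOn hI₀o hfs' hx).add
      ((hasDerivAt_const x C).div (hasDerivAt_id x) hx0)
    rw [show φ = (deriv f + (fun _ => C) / id) from rfl, h1.deriv]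
    simp; ring
  have hφc : ContinuousAt φ x₀ := hφs.continuousOn.continuousAt (hI₀o.mem_nhds hx₀I)
  obtain ⟨ε, hε, hεI⟩ := Metric.mem_nhds_iff.1
    (inter_mem (hI₀o.mem_nhds hx₀I) (hφc.eventually (lt_mem_nhds hCpos)))
  have hII : Metric.ball x₀ ε ⊆ I₀ := fun x hx => (hεI hx).1
  have hNc : Continuous (sqNorm : (Fin n → ℂ) → ℝ) :=
    continuous_iff_continuousAt.2 fun _ => differentiableAt_sqNorm.continuousAt
  refine ⟨e.target ∩ sqNorm ⁻¹' Metric.ball x₀ ε, Metric.ball x₀ ε, φ, ?_,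
    hz₀, Metric.mem_ball_self hε⟩
  refine ⟨he, hn, e.open_target.inter (Metric.isOpen_ball.preimage hNc), Set.inter_subset_left,
    Metric.isOpen_ball, (convex_ball x₀ ε).isPreconnected, fun x hx => (hII hx).1,
    fun z hz => hz.2, fun x hx => ⟨γ x, ⟨(hII hx).2, ?_⟩, hγN x (hII hx).1⟩, hφs.mono hII,
    fun x hx => (hεI hx).2, fun x hx => ?_, fun z hz => ?_⟩
  · rw [Set.mem_preimage, hγN x (hII hx).1]; exact hx
  · have hx0 : (0 : ℝ) < x := (hII hx).1
    rw [radialDensity, hφd x (hII hx)]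
    have := (hpos x (hII hx)).1
    have h2 : φ x + x * (deriv (deriv f) x - C / x ^ 2)
        = deriv f x + deriv (deriv f) x * x := by
      simp only [hφ]; field_simp; ring
    rwa [h2]
  · have hzI := hII hz.2
    have hx0 : (0 : ℝ) < sqNorm z := hzI.1
    rw [hmet z hz.1 hzI, hφd _ hzI]
    rcases hC with h1 | h1
    · subst h1
      ext i j
      have h3 : sqNorm z = ‖z 0‖ ^ 2 := by simp [sqNorm]
      have h4 : conj (z 0) * z 0 = (sqNorm z : ℂ) := by
        rw [h3, mul_comm, Complex.mul_conj, Complex.normSq_eq_norm_sq]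
      have h5 : (sqNorm z : ℂ) ≠ 0 := by exact_mod_cast hx0.ne'
      rw [Subsingleton.elim i 0, Subsingleton.elim j 0, radialMatrix, radialMatrix, h4]
      simp only [hφ, if_true]
      push_cast
      field_simp; ring
    · simp [hφ, h1]

end Existence

/-! ### Extremal radial metrics -/

section Extremal

variable {n : ℕ} {M : Type*} [TopologicalSpace M] [ChartedSpace (Fin n → ℂ) M]
  {g : KahlerMetric n M} {e : OpenPartialHomeomorph M (Fin n → ℂ)}
  {U : Set (Fin n → ℂ)} {I : Set ℝ} {φ : ℝ → ℝ}

theorem IsRadialOn.ne_zero (h : IsRadialOn g e U I φ) {z : Fin n → ℂ} (hz : z ∈ U) : z ≠ 0 := by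
  rintro rfl
  have := h.I_pos _ (h.maps _ hz)
  simp [sqNorm] at this

theorem IsRadialOn.hamiltonianScal_eq (h : IsRadialOn g e U I φ) {z : Fin n → ℂ} (hz : z ∈ U)
    (j : Fin n) : hamiltonianScal g e z j = -2 * Complex.I *
      (((deriv (scalProfile n φ) (sqNorm z) / radialDensity φ (sqNorm z) : ℝ) : ℂ) * z j) := by
  have h1 : scalarCurvature g e =ᶠ[𝓝 z] fun w => (scalProfile n φ (sqNorm w) : ℂ) := by
    filter_upwards [h.isOpen_U.mem_nhds hz] with w hw using h.scalarCurvature_eq hw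
  have h2 : ∀ k, wirtingerBar (scalarCurvature g e) k z
      = (deriv (scalProfile n φ) (sqNorm z) : ℝ) * z k := fun k => by
    rw [wirtingerBar_congr h1]
    exact (hasWirtingerAt_radial (hasDerivAt_of_contDiffOn h.isOpen_I h.contDiffOn_scalProfile
      (h.maps z hz))).right k
  have h3 := congrFun (h.vecMul_inv hz) j
  simp only [Matrix.vecMul, dotProduct, Pi.smul_apply, smul_eq_mul] at h3
  rw [hamiltonianScal]
  congr 1
  simp only [h2]
  rw [Complex.ofReal_div, div_eq_mul_inv, mul_assoc, ← h3, Finset.mul_sum]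
  exact Finset.sum_congr rfl fun k _ => by ring

/-- A radial extremal metric has scalar curvature affine in `y = x φ`: the coefficient
`(dS/dx)/(dy/dx)` of the holomorphic field `∑ z_j ∂/∂z_j` is constant. -/
theorem IsRadialOn.deriv_eq_zero_of_ext (h : IsRadialOn g e U I φ) (hE : g ∈ Ext n M) {x : ℝ}
    (hx : x ∈ I) : deriv (fun x => deriv (scalProfile n φ) x / radialDensity φ x) x = 0 := by
  obtain ⟨z, hz, rfl⟩ := h.surj x hx
  obtain ⟨j, hj⟩ := Function.ne_iff.1 (h.ne_zero hz)
  have hs : ContDiffOn ℝ ∞ (fun x => deriv (scalProfile n φ) x / radialDensity φ x) I :=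
    (contDiffOn_deriv h.isOpen_I h.contDiffOn_scalProfile).div h.contDiffOn_density
      fun x hx => (h.dens_pos x hx).ne'
  have h1 : DifferentiableAt ℂ (fun w => hamiltonianScal g e w j) z :=
    (differentiableOn_pi.1 (hE e h.mem_charts) j).differentiableAt
      (e.open_target.mem_nhds (h.subset hz))
  have h2 := (hasWirtingerAt_of_differentiableAt h1).right j
  have h3 : (fun w => hamiltonianScal g e w j) =ᶠ[𝓝 z] fun w => -2 * Complex.I *
      (((deriv (scalProfile n φ) (sqNorm w) / radialDensity φ (sqNorm w) : ℝ) : ℂ) * w j) := by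
    filter_upwards [h.isOpen_U.mem_nhds hz] with w hw using h.hamiltonianScal_eq hw j
  rw [wirtingerBar_congr h3, (((hasWirtingerAt_radial (hasDerivAt_of_contDiffOn h.isOpen_I hs
    hx)).mul (hasWirtingerAt_coord j)).const_mul _).right j] at h2
  have hj' : z j ≠ 0 := hj
  simpa [hj'] using h2

end Extremal

/-! ### Radial metrics associated to a soliton -/

section SolitonMatrix

variable {n : ℕ}

/-- The common shape of the complex Hessians of `u(|z|²) X(|z|²)` and of the Lie derivative of a
radial metric along a holomorphic field `X` with Jacobian matrix `J`. -/
def fieldMatrix (α β γ s : ℂ) (p : Fin n → ℂ) (J : Matrix (Fin n) (Fin n) ℂ) (z : Fin n → ℂ) :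
    Matrix (Fin n) (Fin n) ℂ :=
  fun i j => α * (if i = j then 1 else 0) + β * (conj (z i) * z j)
    + γ * (p i * z j + conj (z i) * conj (p j)) + s * (J j i + conj (J i j))

/-- The value at `(v, v)` of a sesquilinear form given by a matrix. -/
def hermContract (A : Matrix (Fin n) (Fin n) ℂ) (v : Fin n → ℂ) : ℂ :=
  ∑ i, ∑ j, v i * conj (v j) * A i j

theorem hermContract_add (A B : Matrix (Fin n) (Fin n) ℂ) (v : Fin n → ℂ) :
    hermContract (A + B) v = hermContract A v + hermContract B v := by
  simp only [hermContract, Matrix.add_apply, mul_add, Finset.sum_add_distrib]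

theorem hermContract_smul (c : ℂ) (A : Matrix (Fin n) (Fin n) ℂ) (v : Fin n → ℂ) :
    hermContract (c • A) v = c * hermContract A v := by
  simp only [hermContract, Matrix.smul_apply, smul_eq_mul, Finset.mul_sum]
  exact Finset.sum_congr rfl fun i _ => Finset.sum_congr rfl fun j _ => by ring

theorem hermContract_vecMulVec (a b v : Fin n → ℂ) :
    hermContract (Matrix.vecMulVec a b) v = (∑ i, v i * a i) * ∑ j, conj (v j) * b j := by
  simp only [hermContract, Finset.sum_mul_sum, Matrix.vecMulVec_apply]
  exact Finset.sum_congr rfl fun i _ => Finset.sum_congr rfl fun j _ => by ring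

theorem hermContract_one (v : Fin n → ℂ) :
    hermContract (1 : Matrix (Fin n) (Fin n) ℂ) v = (sqNorm v : ℂ) := by
  simp [hermContract, Matrix.one_apply, ofReal_sqNorm]

theorem hermContract_transpose_add_conj (J : Matrix (Fin n) (Fin n) ℂ) (v : Fin n → ℂ) :
    hermContract (J.transpose + J.map conj) v
      = ((2 * (hermContract J.transpose v).re : ℝ) : ℂ) := by
  have h1 : hermContract (J.map conj) v = conj (hermContract J.transpose v) := by
    simp only [hermContract, map_sum, map_mul, Complex.conj_conj, Matrix.transpose_apply,
      Matrix.map_apply]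
    rw [Finset.sum_comm]
    exact Finset.sum_congr rfl fun i _ => Finset.sum_congr rfl fun j _ => by ring
  rw [← Complex.add_conj, ← h1]
  exact hermContract_add _ _ v

theorem fieldMatrix_eq (α β γ s : ℂ) (p : Fin n → ℂ) (J : Matrix (Fin n) (Fin n) ℂ)
    (z : Fin n → ℂ) : fieldMatrix α β γ s p J z = α • (1 : Matrix (Fin n) (Fin n) ℂ)
      + β • Matrix.vecMulVec (fun i => conj (z i)) z
      + γ • (Matrix.vecMulVec p z
        + Matrix.vecMulVec (fun i => conj (z i)) (fun j => conj (p j)))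
      + s • (J.transpose + J.map conj) := by
  ext i j
  simp only [fieldMatrix, Matrix.add_apply, Matrix.smul_apply, Matrix.one_apply, smul_eq_mul,
    Matrix.vecMulVec_apply, Matrix.transpose_apply, Matrix.map_apply]

theorem hermContract_fieldMatrix (α β γ s : ℂ) (p : Fin n → ℂ) (J : Matrix (Fin n) (Fin n) ℂ)
    (z v : Fin n → ℂ) : hermContract (fieldMatrix α β γ s p J z) v
      = α * sqNorm v + β * ((∑ i, v i * conj (z i)) * ∑ j, conj (v j) * z j)
        + γ * ((∑ i, v i * p i) * (∑ j, conj (v j) * z j)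
          + (∑ i, v i * conj (z i)) * ∑ j, conj (v j) * conj (p j))
        + s * ((2 * (hermContract J.transpose v).re : ℝ) : ℂ) := by
  rw [fieldMatrix_eq, hermContract_add, hermContract_smul s, hermContract_transpose_add_conj]
  simp only [hermContract_add, hermContract_smul, hermContract_one, hermContract_vecMulVec]

theorem hermContract_fieldMatrix_tangent {α β γ s : ℂ} {p : Fin n → ℂ}
    {J : Matrix (Fin n) (Fin n) ℂ} {z v : Fin n → ℂ} (hv : ∑ i, v i * conj (z i) = 0) :
    hermContract (fieldMatrix α β γ s p J z) v
      = α * sqNorm v + s * ((2 * (hermContract J.transpose v).re : ℝ) : ℂ) := by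
  have h1 : ∑ j, conj (v j) * z j = 0 := by
    have := congrArg conj hv
    simpa [map_sum] using this
  rw [hermContract_fieldMatrix, hv, h1]; ring

theorem hermContract_fieldMatrix_self {α β γ s : ℂ} {p : Fin n → ℂ}
    {J : Matrix (Fin n) (Fin n) ℂ} {z : Fin n → ℂ} :
    hermContract (fieldMatrix α β γ s p J z) z
      = α * sqNorm z + β * (sqNorm z * sqNorm z)
        + γ * (sqNorm z * ((2 * (∑ i, z i * p i).re : ℝ) : ℂ))
        + s * ((2 * (hermContract J.transpose z).re : ℝ) : ℂ) := by
  have h1 : ∑ j, conj (z j) * z j = (sqNorm z : ℂ) := conj_dotProduct_self z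
  have h2 : ∑ j, conj (z j) * conj (p j) = conj (∑ i, z i * p i) := by simp [map_sum]
  rw [hermContract_fieldMatrix, h1, ← ofReal_sqNorm, h2, ← Complex.add_conj (∑ i, z i * p i)]
  ring

theorem trace_fieldMatrix {α β γ s : ℂ} {p : Fin n → ℂ} {J : Matrix (Fin n) (Fin n) ℂ}
    {z : Fin n → ℂ} : (fieldMatrix α β γ s p J z).trace
      = α * n + β * sqNorm z + γ * ((2 * (∑ i, z i * p i).re : ℝ) : ℂ)
        + s * ((2 * J.trace.re : ℝ) : ℂ) := by
  rw [← Complex.add_conj (∑ i, z i * p i), ← Complex.add_conj J.trace, ofReal_sqNorm]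
  simp only [Matrix.trace, Matrix.diag_apply, fieldMatrix, if_true, mul_one, map_sum, map_mul,
    Finset.sum_add_distrib, Finset.sum_const, Finset.card_univ, Fintype.card_fin,
    nsmul_eq_mul, ← Finset.mul_sum, mul_add]
  have h1 : ∑ i, p i * z i = ∑ i, z i * p i := Finset.sum_congr rfl fun i _ => mul_comm _ _
  have h2 : ∑ i, conj (z i) * z i = ∑ i, z i * conj (z i) :=
    Finset.sum_congr rfl fun i _ => mul_comm _ _
  rw [h1, h2]; ring

theorem radialMatrix_eq_fieldMatrix (a b : ℂ) (z p : Fin n → ℂ) (J : Matrix (Fin n) (Fin n) ℂ) :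
    radialMatrix a b z = fieldMatrix a b 0 0 p J z := by
  ext i j; simp [radialMatrix, fieldMatrix]

theorem hermContract_radialMatrix_tangent {a b : ℂ} {z v : Fin n → ℂ}
    (hv : ∑ i, v i * conj (z i) = 0) : hermContract (radialMatrix a b z) v = a * sqNorm v := by
  rw [radialMatrix_eq_fieldMatrix a b z 0 0, hermContract_fieldMatrix_tangent hv]; ring

theorem hermContract_radialMatrix_self {a b : ℂ} {z : Fin n → ℂ} :
    hermContract (radialMatrix a b z) z = a * sqNorm z + b * (sqNorm z * sqNorm z) := by
  rw [radialMatrix_eq_fieldMatrix a b z 0 0, hermContract_fieldMatrix_self]; ring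

theorem trace_radialMatrix {a b : ℂ} {z : Fin n → ℂ} :
    (radialMatrix a b z).trace = a * n + b * sqNorm z := by
  rw [radialMatrix_eq_fieldMatrix a b z 0 0, trace_fieldMatrix]; ring

end SolitonMatrix

section HolomorphicField

variable {n : ℕ} {X : (Fin n → ℂ) → Fin n → ℂ} {U : Set (Fin n → ℂ)} {z : Fin n → ℂ}

/-- The derivative `X(|z|²) = 2 Re ∑ X^l z̄_l` of `|z|²` along a vector field. -/
def radialSpeed (X : (Fin n → ℂ) → Fin n → ℂ) (z : Fin n → ℂ) : ℝ :=
  2 * (∑ l, X z l * conj (z l)).re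

/-- The Wirtinger derivatives `∂X(|z|²)/∂z_i = ∑ (∂X^l/∂z_i) z̄_l + conj X^i`. -/
def speedGrad (X : (Fin n → ℂ) → Fin n → ℂ) (z : Fin n → ℂ) (i : Fin n) : ℂ :=
  (∑ l, jacobian X z l i * conj (z l)) + conj (X z i)

theorem ofReal_radialSpeed (X : (Fin n → ℂ) → Fin n → ℂ) (z : Fin n → ℂ) :
    (radialSpeed X z : ℂ) = (∑ l, X z l * conj (z l)) + conj (∑ l, X z l * conj (z l)) :=
  (Complex.add_conj _).symm

theorem hasWirtingerAt_component (hX : DifferentiableAt ℂ X z) (l : Fin n) :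
    HasWirtingerAt (fun w => X w l) (fun i => jacobian X z l i) 0 z := by
  refine (hasWirtingerAt_of_differentiableAt (differentiableAt_pi.1 hX l)).congr_deriv
    (fun i => ?_) fun i => rfl
  rw [fderiv_apply hX]; rfl

theorem hasWirtingerAt_radialSpeed (hX : DifferentiableAt ℂ X z) :
    HasWirtingerAt (fun w => (radialSpeed X w : ℂ)) (speedGrad X z)
      (fun i => conj (speedGrad X z i)) z := by
  have h1 : HasWirtingerAt (fun w => ∑ l, X w l * conj (w l)) _ _ z :=
    HasWirtingerAt.sum fun l _ => (hasWirtingerAt_component hX l).mul (hasWirtingerAt_conj_coord l)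
  simp only [ofReal_radialSpeed]
  refine (h1.add h1.conj).congr_deriv (fun i => ?_) (fun i => ?_)
  · simp [speedGrad, mul_comm]
  · simp [speedGrad, mul_comm, add_comm]

theorem hasWirtingerAt_conj_speedGrad (hU : IsOpen U) (hX : DifferentiableOn ℂ X U) (hz : z ∈ U)
    (j : Fin n) : HasWirtingerAt (fun w => conj (speedGrad X w j))
      (fun i => jacobian X z j i + conj (jacobian X z i j))
      (fun i => conj (wirtinger (fun w => speedGrad X w j) i z)) z := by
  have hJ : ∀ l, HasWirtingerAt (fun w => jacobian X w l j) _ 0 z := fun l =>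
    hasWirtingerAt_of_differentiableAt ((differentiableOn_jacobian hU hX l j).differentiableAt
      (hU.mem_nhds hz))
  have h1 : HasWirtingerAt (fun w => speedGrad X w j) _ _ z :=
    (HasWirtingerAt.sum fun l _ => (hJ l).mul (hasWirtingerAt_conj_coord l)).add
      (hasWirtingerAt_component (hX.differentiableAt (hU.mem_nhds hz)) j).conj
  refine h1.conj.congr_deriv (fun i => ?_) (fun i => ?_)
  · simp [add_comm]
  · rw [h1.left]

/-- The complex Hessian of `u(|z|²) X(|z|²)`. -/
theorem ddbar_mul_radialSpeed {I : Set ℝ} (hI : IsOpen I) (hUI : ∀ w ∈ U, sqNorm w ∈ I)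
    (hU : IsOpen U) (hX : DifferentiableOn ℂ X U) (hz : z ∈ U) {u : ℝ → ℝ}
    (hu : ContDiffOn ℝ ∞ u I) (i j : Fin n) :
    ddbar (fun w => ((u (sqNorm w) * radialSpeed X w : ℝ) : ℂ)) i j z
      = fieldMatrix ((deriv u (sqNorm z) * radialSpeed X z : ℝ) : ℂ)
        ((deriv (deriv u) (sqNorm z) * radialSpeed X z : ℝ) : ℂ)
        ((deriv u (sqNorm z) : ℝ) : ℂ) (u (sqNorm z)) (speedGrad X z) (jacobian X z) z i j := by
  have hd : ∀ w ∈ U, DifferentiableAt ℂ X w := fun w hw => hX.differentiableAt (hU.mem_nhds hw)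
  have h1 : ∀ {u : ℝ → ℝ}, ContDiffOn ℝ ∞ u I → ∀ w ∈ U,
      HasWirtingerAt (fun w => (u (sqNorm w) : ℂ)) _ _ w := fun hu w hw =>
    hasWirtingerAt_radial (hasDerivAt_of_contDiffOn hI hu (hUI w hw))
  have hu' := contDiffOn_deriv hI hu
  simp only [Complex.ofReal_mul]
  rw [ddbar_eq (B := fun w j => u (sqNorm w) * conj (speedGrad X w j)
      + radialSpeed X w * ((deriv u (sqNorm w) : ℝ) * w j))
    ((hU.eventually_mem hz).mono fun w hw =>
      ((h1 hu w hw).mul (hasWirtingerAt_radialSpeed (hd w hw))).right j)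
    (((h1 hu z hz).mul (hasWirtingerAt_conj_speedGrad hU hX hz j)).add
      ((hasWirtingerAt_radialSpeed (hd z hz)).mul
        ((h1 hu' z hz).mul (hasWirtingerAt_coord j))))]
  simp only [fieldMatrix]
  ring

theorem sum_mul_speedGrad (X : (Fin n → ℂ) → Fin n → ℂ) (z : Fin n → ℂ) :
    2 * (∑ i, z i * speedGrad X z i).re
      = 2 * (hermContract (jacobian X z).transpose z).re + radialSpeed X z := by
  have h1 : ∑ i, z i * speedGrad X z i = hermContract (jacobian X z).transpose z
      + conj (∑ l, X z l * conj (z l)) := by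
    simp only [speedGrad, hermContract, mul_add, Finset.sum_add_distrib, Finset.mul_sum, map_sum,
      map_mul, Complex.conj_conj, Matrix.transpose_apply]
    congr 1
    · exact Finset.sum_congr rfl fun i _ => Finset.sum_congr rfl fun j _ => by ring
    · exact Finset.sum_congr rfl fun i _ => by ring
  rw [h1, radialSpeed, Complex.add_re, Complex.conj_re]; ring

end HolomorphicField

section Soliton

variable {n : ℕ} {M : Type*} [TopologicalSpace M] [ChartedSpace (Fin n → ℂ) M]
  {g : KahlerMetric n M} {e : OpenPartialHomeomorph M (Fin n → ℂ)}
  {U : Set (Fin n → ℂ)} {I : Set ℝ} {φ : ℝ → ℝ}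

theorem IsRadialOn.hasDerivAt (h : IsRadialOn g e U I φ) {u : ℝ → ℝ} (hu : ContDiffOn ℝ ∞ u I)
    {x : ℝ} (hx : x ∈ I) : HasDerivAt u (deriv u x) x :=
  hasDerivAt_of_contDiffOn h.isOpen_I hu hx

theorem IsRadialOn.lieKahlerForm_eq (h : IsRadialOn g e U I φ)
    {Y : ∀ p : M, TangentSpace 𝓘(ℂ, Fin n → ℂ) p}
    (hY : DifferentiableOn ℂ (vectorCoord Y e) e.target) {z : Fin n → ℂ} (hz : z ∈ U) :
    lieKahlerForm g Y e z = fieldMatrix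
      ((deriv φ (sqNorm z) * radialSpeed (vectorCoord Y e) z : ℝ) : ℂ)
      ((deriv (deriv φ) (sqNorm z) * radialSpeed (vectorCoord Y e) z : ℝ) : ℂ)
      ((deriv φ (sqNorm z) : ℝ) : ℂ) (φ (sqNorm z)) (speedGrad (vectorCoord Y e) z)
      (jacobian (vectorCoord Y e) z) z := by
  ext i j
  simp only [lieKahlerForm]
  generalize vectorCoord Y e = X at hY ⊢
  have hd : DifferentiableAt ℂ X z := hY.differentiableAt (e.open_target.mem_nhds (h.subset hz))
  have hx := h.maps z hz
  set x := sqNorm z with hxd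
  have hg : (fun w => kahlerForm g e w i j) =ᶠ[𝓝 z] fun w =>
      (φ (sqNorm w) : ℂ) * (if i = j then 1 else 0)
        + ((deriv φ (sqNorm w) : ℝ) : ℂ) * (conj (w i) * w j) := by
    filter_upwards [h.isOpen_U.mem_nhds hz] with w hw
    rw [kahlerForm, h.metric w hw]; rfl
  have hg' := (((hasWirtingerAt_radial (h.hasDerivAt h.smooth hx)).mul
    (hasWirtingerAt_const (if i = j then 1 else 0))).add
    ((hasWirtingerAt_radial (h.hasDerivAt (contDiffOn_deriv h.isOpen_I h.smooth) hx)).mul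
      ((hasWirtingerAt_conj_coord i).mul (hasWirtingerAt_coord j)))).fderiv_apply (X z)
  have hgz : ∀ k l, kahlerForm g e z k l = (φ x : ℂ) * (if k = l then 1 else 0)
      + ((deriv φ x : ℝ) : ℂ) * (conj (z k) * z l) := fun k l => by
    rw [kahlerForm, h.metric z hz]; rfl
  rw [hg.fderiv_eq, hg']
  simp only [(hasWirtingerAt_component hd _).left, hgz, ← hxd]
  have e1 : ∑ l, ((φ x : ℂ) * (if l = j then 1 else 0)
      + ((deriv φ x : ℝ) : ℂ) * (conj (z l) * z j)) * jacobian X z l i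
      = φ x * jacobian X z j i
        + (deriv φ x : ℝ) * z j * ∑ l, jacobian X z l i * conj (z l) := by
    simp only [add_mul, Finset.sum_add_distrib, Finset.mul_sum]
    congr 1
    · simp
    · exact Finset.sum_congr rfl fun l _ => by ring
  have e2 : ∑ l, ((φ x : ℂ) * (if i = l then 1 else 0)
      + ((deriv φ x : ℝ) : ℂ) * (conj (z i) * z l)) * conj (jacobian X z l j)
      = φ x * conj (jacobian X z i j)
        + (deriv φ x : ℝ) * conj (z i) * conj (∑ l, jacobian X z l j * conj (z l)) := by
    simp only [add_mul, Finset.sum_add_distrib, map_sum, map_mul, Complex.conj_conj,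
      Finset.mul_sum]
    congr 1
    · simp
    · exact Finset.sum_congr rfl fun l _ => by ring
  rw [e1, e2]
  have e3 : ∀ l, ((φ x * (0 : Fin n → ℂ) l + (if i = j then 1 else 0) *
        (((deriv φ x : ℝ) : ℂ) * conj (z l)) +
        (((deriv φ x : ℝ) : ℂ) * ((conj (z i) * if l = j then 1 else 0)
          + z j * (0 : Fin n → ℂ) l) +
        conj (z i) * z j * (((deriv (deriv φ) x : ℝ) : ℂ) * conj (z l)))) * X z l +
      (φ x * (0 : Fin n → ℂ) l + (if i = j then 1 else 0) * (((deriv φ x : ℝ) : ℂ) * z l) +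
        (((deriv φ x : ℝ) : ℂ) * (conj (z i) * (0 : Fin n → ℂ) l + z j * if l = i then 1 else 0) +
        conj (z i) * z j * (((deriv (deriv φ) x : ℝ) : ℂ) * z l))) * conj (X z l))
      = (((deriv φ x : ℝ) : ℂ) * (if i = j then 1 else 0)
          + ((deriv (deriv φ) x : ℝ) : ℂ) * (conj (z i) * z j))
            * (X z l * conj (z l) + conj (X z l) * z l)
        + ((deriv φ x : ℝ) : ℂ) * conj (z i) * (X z l * if l = j then 1 else 0)
        + ((deriv φ x : ℝ) : ℂ) * z j * (conj (X z l) * if l = i then 1 else 0) := fun l => by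
    simp only [Pi.zero_apply]; ring
  simp only [e3, Finset.sum_add_distrib, ← Finset.mul_sum]
  simp only [fieldMatrix, speedGrad, Complex.ofReal_mul, ofReal_radialSpeed, map_add,
    Complex.conj_conj, map_sum, map_mul, mul_ite, mul_one, mul_zero, Finset.sum_ite_eq',
    Finset.mem_univ, if_true]
  split_ifs <;> ring

/-- The equation `ρ = c ω + L_X ω` for a radial metric with `φ = f'`, on the open set `U`. -/
structure IsSolitonOn (n : ℕ) (φ : ℝ → ℝ) (U : Set (Fin n → ℂ)) (X : (Fin n → ℂ) → Fin n → ℂ)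
    (c : ℝ) : Prop where
  hol : DifferentiableOn ℂ X U
  eq : ∀ z ∈ U, radialMatrix ((-2 * deriv (logDet n φ) (sqNorm z) : ℝ) : ℂ)
      ((-2 * deriv (deriv (logDet n φ)) (sqNorm z) : ℝ) : ℂ) z
    = fieldMatrix ((c * φ (sqNorm z) + deriv φ (sqNorm z) * radialSpeed X z : ℝ) : ℂ)
      ((c * deriv φ (sqNorm z) + deriv (deriv φ) (sqNorm z) * radialSpeed X z : ℝ) : ℂ)
      ((deriv φ (sqNorm z) : ℝ) : ℂ) (φ (sqNorm z)) (speedGrad X z) (jacobian X z) z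

theorem IsRadialOn.exists_isSolitonOn (h : IsRadialOn g e U I φ) (hg : g ∈ KRS n M) :
    ∃ (X : (Fin n → ℂ) → Fin n → ℂ) (c : ℝ), IsSolitonOn n φ U X c := by
  obtain ⟨c, Y, hY, hYg⟩ := hg
  have hYe := hY e h.mem_charts
  refine ⟨vectorCoord Y e, c, hYe.mono h.subset, fun z hz => ?_⟩
  have h1 := hYg e h.mem_charts z (h.subset hz)
  rw [h.lieKahlerForm_eq hYe hz, kahlerForm, h.metric z hz] at h1
  ext i j
  have h2 := congrFun (congrFun h1 i) j
  rw [ricciForm, h.ricciMatrix_eq hz] at h2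
  simp only [radialMatrix, fieldMatrix, Matrix.add_apply, Matrix.smul_apply, smul_eq_mul] at h2 ⊢
  push_cast at h2 ⊢
  linear_combination h2

theorem IsRadialOn.deriv_density (h : IsRadialOn g e U I φ) {x : ℝ} (hx : x ∈ I) :
    deriv (radialDensity φ) x = 2 * deriv φ x + x * deriv (deriv φ) x := by
  have h1 := (h.hasDerivAt h.smooth hx).add ((hasDerivAt_id x).mul
    (h.hasDerivAt (contDiffOn_deriv h.isOpen_I h.smooth) hx))
  have h2 : HasDerivAt (radialDensity φ) _ x := h1
  rw [h2.deriv]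
  simp; ring

/-- The logarithmic derivative of `det g = φ^(n-1) y'`, with denominators cleared. -/
theorem IsRadialOn.deriv_logDet (h : IsRadialOn g e U I φ) {x : ℝ} (hx : x ∈ I) :
    deriv (logDet n φ) x * (φ x * radialDensity φ x)
      = ((n : ℝ) - 1) * deriv φ x * radialDensity φ x + deriv (radialDensity φ) x * φ x := by
  have hp := (h.pos x hx).ne'
  have hd := (h.dens_pos x hx).ne'
  have h1 := (((h.hasDerivAt h.smooth hx).pow (n - 1)).mul
    (h.hasDerivAt h.contDiffOn_density hx)).log (mul_ne_zero (pow_ne_zero _ hp) hd)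
  have h2 : HasDerivAt (logDet n φ) _ x := h1
  rw [h2.deriv]
  obtain ⟨k, rfl⟩ := Nat.exists_eq_succ_of_ne_zero h.dim_pos.ne'
  simp only [Nat.succ_eq_add_one, Nat.add_sub_cancel, Pi.pow_apply, Pi.mul_apply]
  rcases k with _ | k
  · simp only [pow_zero, one_mul]; field_simp; simp
  · simp only [Nat.add_sub_cancel]
    push_cast
    field_simp
    ring

section

variable {X : (Fin n → ℂ) → Fin n → ℂ} {c : ℝ} {z : Fin n → ℂ}

theorem IsSolitonOn.tangent (hs : IsSolitonOn n φ U X c) (hz : z ∈ U) {v : Fin n → ℂ}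
    (hv : ∑ i, v i * conj (z i) = 0) : -2 * deriv (logDet n φ) (sqNorm z) * sqNorm v
      = (c * φ (sqNorm z) + deriv φ (sqNorm z) * radialSpeed X z) * sqNorm v
        + φ (sqNorm z) * (2 * (hermContract (jacobian X z).transpose v).re) := by
  have h1 := congrArg (fun A => hermContract A v) (hs.eq z hz)
  simp only [hermContract_radialMatrix_tangent hv, hermContract_fieldMatrix_tangent hv] at h1
  exact_mod_cast h1

theorem IsSolitonOn.radial (hs : IsSolitonOn n φ U X c) (hz : z ∈ U) :
    -2 * deriv (logDet n φ) (sqNorm z) * sqNorm z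
        + -2 * deriv (deriv (logDet n φ)) (sqNorm z) * (sqNorm z * sqNorm z)
      = (c * φ (sqNorm z) + deriv φ (sqNorm z) * radialSpeed X z) * sqNorm z
        + (c * deriv φ (sqNorm z) + deriv (deriv φ) (sqNorm z) * radialSpeed X z)
          * (sqNorm z * sqNorm z)
        + deriv φ (sqNorm z) * (sqNorm z * (2 * (hermContract (jacobian X z).transpose z).re
            + radialSpeed X z))
        + φ (sqNorm z) * (2 * (hermContract (jacobian X z).transpose z).re) := by
  have h1 := congrArg (fun A => hermContract A z) (hs.eq z hz)
  simp only [hermContract_radialMatrix_self, hermContract_fieldMatrix_self,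
    sum_mul_speedGrad] at h1
  exact_mod_cast h1

theorem IsSolitonOn.trace (hs : IsSolitonOn n φ U X c) (hz : z ∈ U) :
    -2 * deriv (logDet n φ) (sqNorm z) * n
        + -2 * deriv (deriv (logDet n φ)) (sqNorm z) * sqNorm z
      = (c * φ (sqNorm z) + deriv φ (sqNorm z) * radialSpeed X z) * n
        + (c * deriv φ (sqNorm z) + deriv (deriv φ) (sqNorm z) * radialSpeed X z) * sqNorm z
        + deriv φ (sqNorm z) * (2 * (hermContract (jacobian X z).transpose z).re
            + radialSpeed X z)
        + φ (sqNorm z) * (2 * (jacobian X z).trace.re) := by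
  have h1 := congrArg Matrix.trace (hs.eq z hz)
  simp only [trace_radialMatrix, trace_fieldMatrix, sum_mul_speedGrad] at h1
  exact_mod_cast h1

/-- The trace of the soliton equation: `2 Re div X = 2 scal - c n - X(log det g)`. -/
theorem IsSolitonOn.divergence (h : IsRadialOn g e U I φ) (hs : IsSolitonOn n φ U X c)
    (hz : z ∈ U) : 2 * (jacobian X z).trace.re = 2 * scalProfile n φ (sqNorm z) - c * n
      - deriv (logDet n φ) (sqNorm z) * radialSpeed X z := by
  have hx := h.maps z hz
  have h1 := hs.trace hz
  have h2 := hs.radial hz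
  have h3 := h.deriv_logDet hx
  have h4 := h.deriv_density hx
  have hp := (h.pos _ hx).ne'
  have hd := (h.dens_pos _ hx).ne'
  have h5 : scalProfile n φ (sqNorm z) * (φ (sqNorm z) * radialDensity φ (sqNorm z))
      = -((n : ℝ) - 1) * deriv (logDet n φ) (sqNorm z) * radialDensity φ (sqNorm z)
        - (deriv (logDet n φ) (sqNorm z) + sqNorm z * deriv (deriv (logDet n φ)) (sqNorm z))
          * φ (sqNorm z) := by
    rw [scalProfile, ricTangent, ricRadial]; field_simp; ring
  have h6 : radialDensity φ (sqNorm z) = φ (sqNorm z) + sqNorm z * deriv φ (sqNorm z) := rfl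
  generalize sqNorm z = x at *
  generalize scalProfile n φ x = S at *
  generalize deriv (deriv (logDet n φ)) x = w at *
  generalize deriv (logDet n φ) x = u at *
  generalize deriv (radialDensity φ) x = y₂ at *
  generalize deriv (deriv φ) x = d at *
  generalize deriv φ x = b at *
  generalize radialDensity φ x = y₁ at *
  generalize φ x = a at *
  subst h6 h4
  refine mul_right_cancel₀ (mul_ne_zero hp hd) ?_
  linear_combination -(a + x * b) * h1 + b * h2 - 2 * h5 + radialSpeed X z * h3

/-- The divergence is pluriharmonic, so the Hessian of its expression in
`IsSolitonOn.divergence` vanishes. -/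
theorem IsSolitonOn.hessian (h : IsRadialOn g e U I φ) (hs : IsSolitonOn n φ U X c)
    (hz : z ∈ U) :
    radialMatrix ((2 * deriv (scalProfile n φ) (sqNorm z) : ℝ) : ℂ)
      ((2 * deriv (deriv (scalProfile n φ)) (sqNorm z) : ℝ) : ℂ) z
    = fieldMatrix ((deriv (deriv (logDet n φ)) (sqNorm z) * radialSpeed X z : ℝ) : ℂ)
        ((deriv (deriv (deriv (logDet n φ))) (sqNorm z) * radialSpeed X z : ℝ) : ℂ)
        ((deriv (deriv (logDet n φ)) (sqNorm z) : ℝ) : ℂ) (deriv (logDet n φ) (sqNorm z) : ℝ)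
        (speedGrad X z) (jacobian X z) z := by
  have hu := contDiffOn_deriv h.isOpen_I h.contDiffOn_logDet
  have hx := h.maps z hz
  have hS := h.contDiffOn_scalProfile
  ext i j
  rw [← ddbar_mul_radialSpeed h.isOpen_I h.maps h.isOpen_U hs.hol hz hu i j]
  have hev : (fun w => ((deriv (logDet n φ) (sqNorm w) * radialSpeed X w : ℝ) : ℂ)) =ᶠ[𝓝 z]
      fun w => ((2 * scalProfile n φ (sqNorm w) - c * n : ℝ) : ℂ)
        + ((-1 : ℝ) : ℂ) * ((2 * (jacobian X w).trace.re : ℝ) : ℂ) := by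
    filter_upwards [h.isOpen_U.mem_nhds hz] with w hw
    rw [hs.divergence h hw]; push_cast; ring
  have hD : DifferentiableOn ℂ (fun w => (jacobian X w).trace) U :=
    DifferentiableOn.fun_sum fun k _ => differentiableOn_jacobian h.isOpen_U hs.hol k k
  have hD' := differentiableOn_fderiv_apply h.isOpen_U hD (Pi.single j 1)
  have hw : ∀ w ∈ U, HasWirtingerAt (fun w => (jacobian X w).trace) _ 0 w := fun w hw =>
    hasWirtingerAt_of_differentiableAt (hD.differentiableAt (h.isOpen_U.mem_nhds hw))
  have hr : ∀ x ∈ I, HasDerivAt (fun x => 2 * scalProfile n φ x - c * n)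
      (2 * deriv (scalProfile n φ) x) x := fun x hx =>
    ((h.hasDerivAt hS hx).const_mul 2).sub_const _
  have hr' : HasDerivAt (fun x => 2 * deriv (scalProfile n φ) x)
      (2 * deriv (deriv (scalProfile n φ)) (sqNorm z)) (sqNorm z) :=
    (h.hasDerivAt (contDiffOn_deriv h.isOpen_I hS) hx).const_mul 2
  simp only [← Complex.add_conj] at hev
  rw [ddbar_congr hev, ddbar_eq (B := fun w j => ((2 * deriv (scalProfile n φ) (sqNorm w) : ℝ) : ℂ)
      * w j + ((-1 : ℝ) : ℂ) * (0 + conj (fderiv ℂ (fun w => (jacobian X w).trace) w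
      (Pi.single j 1))))
    ((h.isOpen_U.eventually_mem hz).mono fun w hwU =>
      ((hasWirtingerAt_radial (hr _ (h.maps w hwU))).add
        (((hw w hwU).add (hw w hwU).conj).const_mul _)).right j)
    (((hasWirtingerAt_radial hr').mul (hasWirtingerAt_coord j)).add
      (((hasWirtingerAt_const 0).add (hasWirtingerAt_of_differentiableAt
        (hD'.differentiableAt (h.isOpen_U.mem_nhds hz))).conj).const_mul _))]
  simp only [radialMatrix, Pi.zero_apply, map_zero, add_zero, mul_zero]
  ring

end

end Soliton

theorem eq_zero_of_hasDerivAt {I : Set ℝ} (hI : IsOpen I) {F : ℝ → ℝ} {d x : ℝ}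
    (hF : ∀ x ∈ I, F x = 0) (hx : x ∈ I) (hd : HasDerivAt F d x) : d = 0 := by
  have h1 : F =ᶠ[𝓝 x] fun _ => 0 := by
    filter_upwards [hI.mem_nhds hx] with w hw using hF w hw
  have h2 := hd.congr_of_eventuallyEq h1.symm
  exact h2.unique (hasDerivAt_const x 0)

section RadialSpeed

variable {n : ℕ} {M : Type*} [TopologicalSpace M] [ChartedSpace (Fin n → ℂ) M]
  {g : KahlerMetric n M} {e : OpenPartialHomeomorph M (Fin n → ℂ)}
  {U : Set (Fin n → ℂ)} {I : Set ℝ} {φ : ℝ → ℝ}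
  {X : (Fin n → ℂ) → Fin n → ℂ} {c : ℝ} {z : Fin n → ℂ} {Q : ℝ → ℝ}

/-- If `X(|z|²)` is a function `Q` of `x = |z|²`, its gradient and its Hessian
`∂X^j/∂z_i + conj (∂X^i/∂z_j)` are radial. -/
theorem IsSolitonOn.hessian_radialSpeed (h : IsRadialOn g e U I φ) (hs : IsSolitonOn n φ U X c)
    (hQ : ContDiffOn ℝ ∞ Q I) (hXQ : ∀ z ∈ U, radialSpeed X z = Q (sqNorm z)) (hz : z ∈ U) :
    2 * (hermContract (jacobian X z).transpose z).re + Q (sqNorm z)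
        = 2 * (sqNorm z * deriv Q (sqNorm z)) ∧
      radialMatrix ((deriv Q (sqNorm z) : ℝ) : ℂ) ((deriv (deriv Q) (sqNorm z) : ℝ) : ℂ) z
        = fieldMatrix 0 0 0 1 (speedGrad X z) (jacobian X z) z := by
  have hx := h.maps z hz
  have hd := hs.hol.differentiableAt (h.isOpen_U.mem_nhds hz)
  have hev : (fun w => (radialSpeed X w : ℂ)) =ᶠ[𝓝 z] fun w => (Q (sqNorm w) : ℂ) := by
    filter_upwards [h.isOpen_U.mem_nhds hz] with w hw
    rw [hXQ w hw]
  constructor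
  · have h1 : ∀ i, speedGrad X z i = (deriv Q (sqNorm z) : ℝ) * conj (z i) := fun i => by
      rw [← (hasWirtingerAt_radialSpeed hd).left, wirtinger_congr hev]
      exact (hasWirtingerAt_radial (h.hasDerivAt hQ hx)).left i
    have h2 : ∑ i, z i * speedGrad X z i = ((sqNorm z * deriv Q (sqNorm z) : ℝ) : ℂ) := by
      rw [Complex.ofReal_mul, ofReal_sqNorm, Finset.sum_mul]
      exact Finset.sum_congr rfl fun i _ => by rw [h1]; ring
    rw [← hXQ z hz, ← sum_mul_speedGrad, h2, Complex.ofReal_re]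
  · ext i j
    have h1 := ddbar_mul_radialSpeed h.isOpen_I h.maps h.isOpen_U hs.hol hz
      (u := fun _ => 1) contDiffOn_const i j
    simp only [one_mul, deriv_const', zero_mul, Complex.ofReal_zero, Complex.ofReal_one] at h1
    rw [← h1, ddbar_congr hev, ddbar_radial (f' := deriv Q)
      ((h.isOpen_I.eventually_mem hx).mono fun x hx => h.hasDerivAt hQ hx)
      (h.hasDerivAt (contDiffOn_deriv h.isOpen_I hQ) hx)]
    rfl

/-- If `X(|z|²) = Q(|z|²)` then `Q / x` is affine in `log x`. -/
theorem IsSolitonOn.euler_eq (h : IsRadialOn g e U I φ) (hs : IsSolitonOn n φ U X c)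
    (hQ : ContDiffOn ℝ ∞ Q I) (hXQ : ∀ z ∈ U, radialSpeed X z = Q (sqNorm z)) {x : ℝ}
    (hx : x ∈ I) : x ^ 2 * deriv (deriv Q) x - x * deriv Q x + Q x = 0 := by
  obtain ⟨z, hz, rfl⟩ := h.surj x hx
  obtain ⟨h1, h2⟩ := hs.hessian_radialSpeed h hQ hXQ hz
  have h3 := congrArg (fun A => hermContract A z) h2
  simp only [hermContract_radialMatrix_self, hermContract_fieldMatrix_self, zero_mul, zero_add,
    one_mul] at h3
  have h4 : deriv Q (sqNorm z) * sqNorm z + deriv (deriv Q) (sqNorm z) * (sqNorm z * sqNorm z)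
      = 2 * (hermContract (jacobian X z).transpose z).re := by exact_mod_cast h3
  linear_combination h4 + h1

theorem IsSolitonOn.divergence_eq (h : IsRadialOn g e U I φ) (hs : IsSolitonOn n φ U X c)
    (hQ : ContDiffOn ℝ ∞ Q I) (hXQ : ∀ z ∈ U, radialSpeed X z = Q (sqNorm z)) {x : ℝ}
    (hx : x ∈ I) : 2 * scalProfile n φ x - c * n - deriv (logDet n φ) x * Q x
      = ((n : ℝ) + 1) * deriv Q x - Q x / x := by
  have h0 := hs.euler_eq h hQ hXQ hx
  have hx0 := (h.I_pos x hx).ne'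
  obtain ⟨z, hz, rfl⟩ := h.surj x hx
  obtain ⟨h1, h2⟩ := hs.hessian_radialSpeed h hQ hXQ hz
  have h3 := congrArg Matrix.trace h2
  simp only [trace_radialMatrix, trace_fieldMatrix, zero_mul, zero_add, one_mul] at h3
  have h4 : deriv Q (sqNorm z) * n + deriv (deriv Q) (sqNorm z) * sqNorm z
      = 2 * (jacobian X z).trace.re := by exact_mod_cast h3
  have h5 := hs.divergence h hz
  rw [hXQ z hz] at h5
  rw [← h5, ← h4]
  field_simp
  linear_combination h0

/-- In dimension at least two, if the tangential Ricci eigenvalue is not locally constant, the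
soliton field acts on `x = |z|²` as `a x`, and the soliton equation reduces to an ordinary
differential equation. The tangential parts of the soliton equation and of the pluriharmonicity
of `div X` form a linear system for `X(|z|²)`, so that `X(|z|²)` is a function of `|z|²`. -/
theorem IsRadialOn.soliton_ode (h : IsRadialOn g e U I φ) (hn : 1 < n) (hg : g ∈ KRS n M)
    (hm : ∀ x ∈ I, deriv (ricTangent n φ) x ≠ 0) :
    ∃ a c : ℝ, ∀ x ∈ I, 2 * ricTangent n φ x * φ x = c * φ x + a * radialDensity φ x := by
  obtain ⟨X, c, hs⟩ := h.exists_isSolitonOn hg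
  have hI := h.isOpen_I
  have hL := h.contDiffOn_logDet
  have hL' := contDiffOn_deriv hI hL
  have hL'' := contDiffOn_deriv hI hL'
  have hφ' := contDiffOn_deriv hI h.smooth
  have hS := h.contDiffOn_scalProfile
  have hS' := contDiffOn_deriv hI hS
  have hden : ∀ x ∈ I, φ x * deriv (deriv (logDet n φ)) x - deriv φ x * deriv (logDet n φ) x
      ≠ 0 := by
    intro x hx
    have hp := (h.pos x hx).ne'
    have h1 : HasDerivAt (ricTangent n φ) _ x :=
      (h.hasDerivAt hL' hx).neg.div (h.hasDerivAt h.smooth hx) hp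
    have h2 := hm x hx
    rw [h1.deriv] at h2
    intro h3
    apply h2
    rw [div_eq_zero_iff]
    left
    simp only [Pi.neg_apply]
    linear_combination -h3
  -- the solution of the two tangential equations; the denominator is `-φ² m'`
  set Q : ℝ → ℝ := fun x => (φ x * (2 * deriv (scalProfile n φ) x)
      + 2 * deriv (logDet n φ) x ^ 2 + c * φ x * deriv (logDet n φ) x)
      / (φ x * deriv (deriv (logDet n φ)) x - deriv φ x * deriv (logDet n φ) x) with hQd
  have hQ : ContDiffOn ℝ ∞ Q I := by
    refine ContDiffOn.div ?_ ((h.smooth.mul hL'').sub (hφ'.mul hL')) hden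
    exact ((h.smooth.mul (contDiffOn_const.mul hS')).add (contDiffOn_const.mul (hL'.pow 2))).add
      ((contDiffOn_const.mul h.smooth).mul hL')
  have htan : ∀ z ∈ U, ∃ v : Fin n → ℂ, 0 < sqNorm v ∧ ∑ i, v i * conj (z i) = 0 := fun z _ => by
    obtain ⟨v, hv0, hv⟩ := exists_tangent hn (fun i => conj (z i))
    exact ⟨v, sqNorm_pos hv0, hv⟩
  have hhess : ∀ z ∈ U, ∀ v : Fin n → ℂ, ∑ i, v i * conj (z i) = 0 →
      2 * deriv (scalProfile n φ) (sqNorm z) * sqNorm v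
        = deriv (deriv (logDet n φ)) (sqNorm z) * radialSpeed X z * sqNorm v
          + deriv (logDet n φ) (sqNorm z) *
            (2 * (hermContract (jacobian X z).transpose v).re) := by
    intro z hz v hv
    have h1 := congrArg (fun A => hermContract A v) (hs.hessian h hz)
    simp only [hermContract_radialMatrix_tangent hv, hermContract_fieldMatrix_tangent hv] at h1
    exact_mod_cast h1
  have hXQ : ∀ z ∈ U, radialSpeed X z = Q (sqNorm z) := by
    intro z hz
    obtain ⟨v, hv0, hv⟩ := htan z hz
    have h1 := hs.tangent hz hv
    have h2 := hhess z hz v hv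
    rw [hQd, eq_div_iff (hden _ (h.maps z hz))]
    refine mul_right_cancel₀ hv0.ne' ?_
    linear_combination -φ (sqNorm z) * h2 + deriv (logDet n φ) (sqNorm z) * h1
  clear_value Q
  have hQ' := contDiffOn_deriv hI hQ
  have hsec : ∀ z ∈ U, ∀ v : Fin n → ℂ, ∑ i, v i * conj (z i) = 0 →
      2 * (hermContract (jacobian X z).transpose v).re = deriv Q (sqNorm z) * sqNorm v := by
    intro z hz v hv
    have h1 := congrArg (fun A => hermContract A v) (hs.hessian_radialSpeed h hQ hXQ hz).2
    simp only [hermContract_radialMatrix_tangent hv, hermContract_fieldMatrix_tangent hv,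
      zero_mul, zero_add, one_mul] at h1
    exact_mod_cast h1.symm
  -- the divergence, a radial pluriharmonic function, is constant, whence `Q'' = 0`
  have hQ2 : ∀ x ∈ I, deriv (deriv Q) x = 0 := by
    intro x hx
    have hx0 := (h.I_pos x hx).ne'
    have h1 : ∀ x ∈ I, 2 * scalProfile n φ x - c * n - deriv (logDet n φ) x * Q x
        - (((n : ℝ) + 1) * deriv Q x - Q x / x) = 0 := fun x hx => by
      rw [hs.divergence_eq h hQ hXQ hx, sub_self]
    have h2 := eq_zero_of_hasDerivAt hI h1 hx
      (((((h.hasDerivAt hS hx).const_mul 2).sub_const (c * n)).sub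
        ((h.hasDerivAt hL' hx).mul (h.hasDerivAt hQ hx))).sub
        (((h.hasDerivAt hQ' hx).const_mul ((n : ℝ) + 1)).sub
          ((h.hasDerivAt hQ hx).div (hasDerivAt_id x) hx0)))
    have h4 := hs.euler_eq h hQ hXQ hx
    obtain ⟨z, hz, rfl⟩ := h.surj x hx
    obtain ⟨v, hv0, hv⟩ := htan z hz
    have h3 := hhess z hz v hv
    rw [hsec z hz v hv, hXQ z hz] at h3
    have h3' : 2 * deriv (scalProfile n φ) (sqNorm z)
        = deriv (deriv (logDet n φ)) (sqNorm z) * Q (sqNorm z)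
          + deriv (logDet n φ) (sqNorm z) * deriv Q (sqNorm z) :=
      mul_right_cancel₀ hv0.ne' (by linear_combination h3)
    have hn0 : (n : ℝ) ≠ 0 := by
      have := h.dim_pos
      positivity
    simp only [mul_one] at h2
    rw [h3'] at h2
    have h5 : (deriv Q (sqNorm z) * sqNorm z - Q (sqNorm z)) / sqNorm z ^ 2
        = deriv (deriv Q) (sqNorm z) := by
      rw [div_eq_iff (by positivity)]; linear_combination -h4
    rw [h5] at h2
    refine (mul_eq_zero.1 (?_ : (n : ℝ) * deriv (deriv Q) (sqNorm z) = 0)).resolve_left hn0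
    linear_combination -h2
  obtain ⟨a, ha⟩ := hI.exists_is_const_of_deriv_eq_zero h.conn
    (hQ'.differentiableOn (by simp)) hQ2
  refine ⟨a, c, fun x hx => ?_⟩
  have h1 := hs.euler_eq h hQ hXQ hx
  rw [hQ2 x hx, ha x hx] at h1
  have h3 := ha x hx
  have h4 := h.deriv_logDet_eq hx
  have h5 : radialDensity φ x = φ x + x * deriv φ x := rfl
  obtain ⟨z, hz, rfl⟩ := h.surj x hx
  obtain ⟨v, hv0, hv⟩ := htan z hz
  have h2 := hs.tangent hz hv
  rw [hsec z hz v hv, hXQ z hz, h3] at h2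
  refine mul_right_cancel₀ hv0.ne' ?_
  rw [h5]
  linear_combination h2 + deriv φ (sqNorm z) * sqNorm v * h1 - 2 * sqNorm v * h4

end RadialSpeed

/-! ### Extremal solitons in dimension one -/

/-- With `S' = κ y'`, `R' = -S y'` and `ψ' = R y'`, the functions `S`, `R`, `ψ` are polynomials of
degrees one, two and three in `y` when `κ ≠ 0`, and the given relation, of degree four, is then
impossible. -/
theorem eq_zero_of_quartic_relation {I : Set ℝ} (hI : IsOpen I) (hne : I.Nonempty)
    {y₁ S R ψ : ℝ → ℝ} {κ c b : ℝ} (hy : ∀ x ∈ I, y₁ x ≠ 0)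
    (hS : ∀ x ∈ I, HasDerivAt S (κ * y₁ x) x) (hR : ∀ x ∈ I, HasDerivAt R (-(S x * y₁ x)) x)
    (hψ : ∀ x ∈ I, HasDerivAt ψ (R x * y₁ x) x)
    (h : ∀ x ∈ I, (S x * (2 * S x - c) + 2 * κ * R x) * R x + (2 * S x - c - 2 * b) * κ * ψ x = 0) :
    κ = 0 := by
  by_contra hκ
  have h2 : ∀ x ∈ I, κ * R x * (2 * S x - 2 * c - 2 * b) - S x ^ 2 * (2 * S x - c)
      + 2 * κ ^ 2 * ψ x = 0 := by
    intro x hx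
    have h1 := eq_zero_of_hasDerivAt hI h hx
      (((((hS x hx).mul (((hS x hx).const_mul 2).sub_const c)).add
        ((hR x hx).const_mul (2 * κ))).mul (hR x hx)).add
        ((((((hS x hx).const_mul 2).sub_const c).sub_const (2 * b)).mul_const κ).mul (hψ x hx)))
    refine mul_right_cancel₀ (hy x hx) ?_
    simp only [Pi.add_apply, Pi.mul_apply] at h1
    linear_combination h1
  have h3 : ∀ x ∈ I, 4 * κ * R x - 8 * S x ^ 2 + (4 * c + 2 * b) * S x = 0 := by
    intro x hx
    have h1 := eq_zero_of_hasDerivAt hI h2 hx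
      (((((hR x hx).const_mul κ).mul ((((hS x hx).const_mul 2).sub_const (2 * c)).sub_const
        (2 * b))).sub (((hS x hx).pow 2).mul (((hS x hx).const_mul 2).sub_const c))).add
        ((hψ x hx).const_mul (2 * κ ^ 2)))
    refine mul_right_cancel₀ (mul_ne_zero hκ (hy x hx)) ?_
    simp only [Pi.pow_apply] at h1
    push_cast at h1
    linear_combination h1
  have h4 : ∀ x ∈ I, -20 * S x + (4 * c + 2 * b) = 0 := by
    intro x hx
    have h1 := eq_zero_of_hasDerivAt hI h3 hx
      ((((hR x hx).const_mul (4 * κ)).sub (((hS x hx).pow 2).const_mul 8)).add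
        ((hS x hx).const_mul (4 * c + 2 * b)))
    refine mul_right_cancel₀ (mul_ne_zero hκ (hy x hx)) ?_
    push_cast at h1
    linear_combination h1
  obtain ⟨x, hx⟩ := hne
  have h1 := eq_zero_of_hasDerivAt hI h4 hx (((hS x hx).const_mul (-20)).add_const _)
  have : κ * y₁ x = 0 := by linarith
  exact (mul_ne_zero hκ (hy x hx)) this

section DimensionOne

variable {M : Type*} [TopologicalSpace M] [ChartedSpace (Fin 1 → ℂ) M]
  {g : KahlerMetric 1 M} {e : OpenPartialHomeomorph M (Fin 1 → ℂ)}
  {U : Set (Fin 1 → ℂ)} {I : Set ℝ} {φ : ℝ → ℝ}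

/-- An extremal soliton of dimension one has constant scalar curvature. Otherwise the
pluriharmonicity of `div X` makes `X(|z|²)` a function of `|z|²`. -/
theorem IsRadialOn.deriv_scal_eq_zero (h : IsRadialOn g e U I φ) (hg : g ∈ KRS 1 M)
    (hE : g ∈ Ext 1 M) {x : ℝ} (hx : x ∈ I) : deriv (scalProfile 1 φ) x = 0 := by
  obtain ⟨X, c, hs⟩ := h.exists_isSolitonOn hg
  have hI := h.isOpen_I
  have hL := h.contDiffOn_logDet
  have hL' := contDiffOn_deriv hI hL
  have hL'' := contDiffOn_deriv hI hL'
  have hy := h.contDiffOn_density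
  have hS := h.contDiffOn_scalProfile
  have hS' := contDiffOn_deriv hI hS
  have hy0 : ∀ x ∈ I, radialDensity φ x ≠ 0 := fun x hx => (h.dens_pos x hx).ne'
  obtain ⟨κ, hκ⟩ := hI.exists_is_const_of_deriv_eq_zero h.conn
    ((hS'.div hy hy0).differentiableOn (by simp)) (fun x hx => h.deriv_eq_zero_of_ext hE hx)
  have hκS : ∀ x ∈ I, deriv (scalProfile 1 φ) x = κ * radialDensity φ x := fun x hx => by
    rw [← hκ x hx]
    simp only [Pi.div_apply]
    rw [div_mul_cancel₀ _ (hy0 x hx)]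
  rw [hκS x hx]
  suffices κ = 0 by rw [this, zero_mul]
  by_contra hκ0
  -- `S y' = -(x G')'` and `G' y' = y''`
  have hSy : ∀ x ∈ I, scalProfile 1 φ x * radialDensity φ x
      = -(deriv (logDet 1 φ) x + x * deriv (deriv (logDet 1 φ)) x) := fun x hx => by
    rw [scalProfile, ricRadial, add_mul, div_mul_cancel₀ _ (hy0 x hx)]; push_cast; ring
  have hGy : ∀ x ∈ I, deriv (logDet 1 φ) x * radialDensity φ x = deriv (radialDensity φ) x :=
    fun x hx => by
      have := h.deriv_logDet hx
      refine mul_right_cancel₀ (h.pos x hx).ne' ?_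
      push_cast at this
      linear_combination this
  have hSy' : ∀ x ∈ I, deriv (scalProfile 1 φ) x * radialDensity φ x
      + scalProfile 1 φ x * deriv (radialDensity φ) x
      = -(2 * deriv (deriv (logDet 1 φ)) x + x * deriv (deriv (deriv (logDet 1 φ))) x) := by
    intro x hx
    have h1 : ∀ x ∈ I, scalProfile 1 φ x * radialDensity φ x
      + (deriv (logDet 1 φ) x + x * deriv (deriv (logDet 1 φ)) x) = 0 := fun x hx => by
      rw [hSy x hx]; ring
    have h2 := eq_zero_of_hasDerivAt hI h1 hx (((h.hasDerivAt hS hx).mul (h.hasDerivAt hy hx)).add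
      ((h.hasDerivAt hL' hx).add ((hasDerivAt_id x).mul (h.hasDerivAt hL'' hx))))
    simp only [id] at h2
    linear_combination h2
  have hS2 : ∀ x ∈ I, deriv (deriv (scalProfile 1 φ)) x = κ * deriv (radialDensity φ) x := by
    intro x hx
    have h1 : ∀ x ∈ I, deriv (scalProfile 1 φ) x - κ * radialDensity φ x = 0 := fun x hx => by
      rw [hκS x hx, sub_self]
    have h2 := eq_zero_of_hasDerivAt hI h1 hx ((h.hasDerivAt hS' hx).sub
      ((h.hasDerivAt hy hx).const_mul κ))
    linear_combination h2
  -- the solution for `X(|z|²)` of the equation `∂∂̄ div X = 0`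
  set Q : ℝ → ℝ := fun x => -((2 * scalProfile 1 φ x - c) * scalProfile 1 φ x
      + 2 * κ * (1 + x * deriv (logDet 1 φ) x)) / (κ * radialDensity φ x) with hQd
  have hden : ∀ x ∈ I, κ * radialDensity φ x ≠ 0 := fun x hx => mul_ne_zero hκ0 (hy0 x hx)
  have hQ : ContDiffOn ℝ ∞ Q I := by
    refine ContDiffOn.div ?_ (contDiffOn_const.mul hy) hden
    exact ((((contDiffOn_const.mul hS).sub contDiffOn_const).mul hS).add
      (contDiffOn_const.mul (contDiffOn_const.add (contDiffOn_id.mul hL')))).neg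
  have hXQ : ∀ z ∈ U, radialSpeed X z = Q (sqNorm z) := by
    intro z hz
    have hx := h.maps z hz
    have hx0 := (h.I_pos _ hx).ne'
    have h1 := congrArg (fun A => hermContract A z) (hs.hessian h hz)
    simp only [hermContract_radialMatrix_self, hermContract_fieldMatrix_self,
      sum_mul_speedGrad] at h1
    have h2 : 2 * deriv (scalProfile 1 φ) (sqNorm z) * sqNorm z
        + 2 * deriv (deriv (scalProfile 1 φ)) (sqNorm z) * (sqNorm z * sqNorm z)
      = deriv (deriv (logDet 1 φ)) (sqNorm z) * radialSpeed X z * sqNorm z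
        + deriv (deriv (deriv (logDet 1 φ))) (sqNorm z) * radialSpeed X z
          * (sqNorm z * sqNorm z)
        + deriv (deriv (logDet 1 φ)) (sqNorm z) * (sqNorm z
          * (2 * (hermContract (jacobian X z).transpose z).re + radialSpeed X z))
        + deriv (logDet 1 φ) (sqNorm z) * (2 * (hermContract (jacobian X z).transpose z).re) := by
      exact_mod_cast h1
    have h3 : (hermContract (jacobian X z).transpose z).re
        = sqNorm z * (jacobian X z).trace.re := by
      have : hermContract (jacobian X z).transpose z
          = (sqNorm z : ℂ) * (jacobian X z).trace := by
        rw [ofReal_sqNorm]; simp [hermContract, Matrix.trace]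
      rw [this, Complex.re_ofReal_mul]
    have h4 := hs.divergence h hz
    have h5 : 2 * (hermContract (jacobian X z).transpose z).re
        = sqNorm z * (2 * scalProfile 1 φ (sqNorm z) - c * (1 : ℕ)
          - deriv (logDet 1 φ) (sqNorm z) * radialSpeed X z) := by
      rw [← h4, h3]; ring
    rw [h5, hS2 _ hx, hκS _ hx, ← hGy _ hx] at h2
    have h6 := hSy _ hx
    have h7 := hSy' _ hx
    rw [hκS _ hx, ← hGy _ hx] at h7
    rw [hQd, eq_div_iff (hden _ hx)]
    refine mul_right_cancel₀ (mul_ne_zero hx0 (hy0 _ hx)) ?_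
    push_cast at h2
    linear_combination h2 + sqNorm z * radialSpeed X z * h7
      + sqNorm z * (2 * scalProfile 1 φ (sqNorm z) - c
        - deriv (logDet 1 φ) (sqNorm z) * radialSpeed X z) * h6
  have hQκ : ∀ x ∈ I, Q x * (κ * radialDensity φ x) = -((2 * scalProfile 1 φ x - c) *
      scalProfile 1 φ x + 2 * κ * (1 + x * deriv (logDet 1 φ) x)) := fun x hx => by
    rw [hQd]; exact div_mul_cancel₀ _ (hden x hx)
  clear_value Q
  have hQ' := contDiffOn_deriv hI hQ
  have hx0 : ∀ x ∈ I, x ≠ 0 := fun x hx => (h.I_pos x hx).ne'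
  obtain ⟨b, hb⟩ := hI.exists_is_const_of_deriv_eq_zero h.conn
    (f := fun x => deriv Q x - Q x / x)
    ((hQ'.sub (hQ.div contDiffOn_id hx0)).differentiableOn (by simp)) (fun x hx => by
      have h1 : HasDerivAt (fun x => deriv Q x - Q x / x) _ x := (h.hasDerivAt hQ' hx).sub
        ((h.hasDerivAt hQ hx).div (hasDerivAt_id x) (hx0 x hx))
      have h2 := hs.euler_eq h hQ hXQ hx
      have h3 := hx0 x hx
      rw [h1.deriv]
      simp only [mul_one, Pi.zero_apply]
      field_simp
      linear_combination h2)
  refine hκ0 (eq_zero_of_quartic_relation hI ⟨x, hx⟩ (y₁ := radialDensity φ)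
    (S := scalProfile 1 φ) (R := fun x => 1 + x * deriv (logDet 1 φ) x)
    (ψ := fun x => x * radialDensity φ x) (c := c) (b := b) hy0 (fun x hx => ?_) (fun x hx => ?_)
    (fun x hx => ?_) fun x hx => ?_)
  · rw [← hκS x hx]; exact h.hasDerivAt hS hx
  · rw [hSy x hx, neg_neg]
    have h1 := ((hasDerivAt_id x).mul (h.hasDerivAt hL' hx)).const_add 1
    simp only [id, one_mul] at h1
    exact h1
  · have h1 := (hasDerivAt_id x).mul (h.hasDerivAt hy hx)
    refine h1.congr_deriv ?_
    rw [← hGy x hx]; simp only [id]; ring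
  · have h1 := hs.divergence_eq h hQ hXQ hx
    have h2 := hQκ x hx
    have h3 := hb x hx
    have h4 := hx0 x hx
    have h5 : x * (2 * scalProfile 1 φ x - c - deriv (logDet 1 φ) x * Q x)
        = 2 * b * x + Q x := by
      push_cast at h1
      rw [show 2 * scalProfile 1 φ x - c = 2 * scalProfile 1 φ x - c * 1 by ring, h1, ← h3]
      field_simp; ring
    linear_combination κ * radialDensity φ x * h5 + (1 + x * deriv (logDet 1 φ) x) * h2

end DimensionOne

/-! ### Rigidity in dimension at least two: ordinary differential equations -/

/-- The one-variable content of a radial metric on an interval where the tangential Ricci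
eigenvalue `m` has no critical point. Here `y = x f'(x)` is the momentum coordinate, `ψ = x y'` the
momentum profile, `y₁ = y'` and `m₁ = m'`; the last field expresses `m` through `ψ`. -/
structure IsMomentumProfile (n : ℕ) (I : Set ℝ) (y y₁ m m₁ ψ : ℝ → ℝ) : Prop where
  isOpen : IsOpen I
  conn : IsPreconnected I
  nonempty : I.Nonempty
  y_pos : ∀ x ∈ I, 0 < y x
  y₁_pos : ∀ x ∈ I, 0 < y₁ x
  m₁_ne : ∀ x ∈ I, m₁ x ≠ 0
  hasDerivAt_y : ∀ x ∈ I, HasDerivAt y (y₁ x) x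
  hasDerivAt_m : ∀ x ∈ I, HasDerivAt m (m₁ x) x
  hasDerivAt_ψ : ∀ x ∈ I,
    HasDerivAt ψ (y₁ x * (n * y x - (n - 1) * ψ x - y x ^ 2 * m x) / y x) x

section Algebraic

open Polynomial

/-- A polynomial relation satisfied by a nonconstant function on an interval is trivial. -/
theorem polynomial_eq_zero_of_eval {I : Set ℝ} (hI : IsOpen I) (hc : IsPreconnected I)
    {v : ℝ → ℝ} (hv : ContinuousOn v I) {x d : ℝ} (hx : x ∈ I) (hd : HasDerivAt v d x)
    (hd0 : d ≠ 0) {p : ℝ[X]} (hp : ∀ x ∈ I, p.eval (v x) = 0) : p = 0 := by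
  have h1 : (v '' I).Nontrivial := by
    by_contra h
    rw [Set.not_nontrivial_iff] at h
    refine hd0 (eq_zero_of_hasDerivAt hI (F := fun w => v w - v x) (fun w hw => ?_) hx
      (hd.sub_const _))
    rw [h (Set.mem_image_of_mem v hw) (Set.mem_image_of_mem v hx), sub_self]
  refine Polynomial.eq_zero_of_infinite_isRoot p
    (((hc.image v hv).infinite_of_nontrivial h1).mono ?_)
  rintro _ ⟨x, hx, rfl⟩
  exact hp x hx

end Algebraic

namespace IsMomentumProfile

variable {n : ℕ} {I : Set ℝ} {y y₁ m m₁ ψ : ℝ → ℝ}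

theorem not_const (h : IsMomentumProfile n I y y₁ m m₁ ψ) (a : ℝ) : ¬ ∀ x ∈ I, m x = a := by
  intro hm
  obtain ⟨x, hx⟩ := h.nonempty
  exact h.m₁_ne x hx (eq_zero_of_hasDerivAt h.isOpen (F := fun w => m w - a)
    (fun w hw => sub_eq_zero.2 (hm w hw)) hx ((h.hasDerivAt_m x hx).sub_const _))

open Polynomial in
theorem polynomial_m (h : IsMomentumProfile n I y y₁ m m₁ ψ) {p : ℝ[X]}
    (hp : ∀ x ∈ I, p.eval (m x) = 0) : p = 0 := by
  obtain ⟨x, hx⟩ := h.nonempty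
  exact polynomial_eq_zero_of_eval h.isOpen h.conn
    (fun x hx => (h.hasDerivAt_m x hx).continuousAt.continuousWithinAt) hx (h.hasDerivAt_m x hx)
    (h.m₁_ne x hx) hp

open Polynomial in
theorem polynomial_y (h : IsMomentumProfile n I y y₁ m m₁ ψ) {p : ℝ[X]}
    (hp : ∀ x ∈ I, p.eval (y x) = 0) : p = 0 := by
  obtain ⟨x, hx⟩ := h.nonempty
  exact polynomial_eq_zero_of_eval h.isOpen h.conn
    (fun x hx => (h.hasDerivAt_y x hx).continuousAt.continuousWithinAt) hx (h.hasDerivAt_y x hx)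
    (h.y₁_pos x hx).ne' hp

theorem exists_const (h : IsMomentumProfile n I y y₁ m m₁ ψ) {F : ℝ → ℝ}
    (hF : ∀ x ∈ I, HasDerivAt F 0 x) : ∃ B, ∀ x ∈ I, F x = B :=
  h.isOpen.exists_is_const_of_deriv_eq_zero h.conn
    (fun x hx => (hF x hx).differentiableAt.differentiableWithinAt) fun x hx => (hF x hx).deriv

/-- The equation `(k+1) m^k y m' = n y' (A - m^(k+1))`, which expresses that the `k+1`-st
generalized scalar curvature is constant, integrates to `m^(k+1) = A + B y^(-n)`. -/
theorem genScal_integral (h : IsMomentumProfile n I y y₁ m m₁ ψ) (hn : 0 < n) {k : ℕ} {A : ℝ}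
    (hA : ∀ x ∈ I, (k + 1) * m x ^ k * (y x * m₁ x) = n * y₁ x * (A - m x ^ (k + 1))) :
    ∃ B, ∀ x ∈ I, (m x ^ (k + 1) - A) * y x ^ n = B := by
  refine h.exists_const fun x hx => ?_
  refine ((((h.hasDerivAt_m x hx).pow (k + 1)).sub_const A).mul
    ((h.hasDerivAt_y x hx).pow n)).congr_deriv ?_
  obtain ⟨d, rfl⟩ := Nat.exists_eq_succ_of_ne_zero hn.ne'
  have h1 := hA x hx
  simp only [Nat.succ_eq_add_one, Nat.add_sub_cancel, Pi.pow_apply] at h1 ⊢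
  push_cast at h1 ⊢
  linear_combination y x ^ d * h1

/-- If two generalized scalar curvatures were constant, a polynomial in `m` would vanish: the
products of `y^n` with `m^(k+1) - A` and with `m^(l+1) - A'` are both constant. -/
theorem not_genScal_genScal (h : IsMomentumProfile n I y y₁ m m₁ ψ) (hn : 0 < n) {k l : ℕ}
    (hkl : k ≠ l) {A A' : ℝ}
    (hA : ∀ x ∈ I, (k + 1) * m x ^ k * (y x * m₁ x) = n * y₁ x * (A - m x ^ (k + 1)))
    (hA' : ∀ x ∈ I, (l + 1) * m x ^ l * (y x * m₁ x) = n * y₁ x * (A' - m x ^ (l + 1))) :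
    False := by
  obtain ⟨B, hB⟩ := h.genScal_integral hn hA
  obtain ⟨B', hB'⟩ := h.genScal_integral hn hA'
  open Polynomial in
  have h1 : (C B' * (X ^ (k + 1) - C A) - C B * (X ^ (l + 1) - C A') : ℝ[X]) = 0 := by
    refine h.polynomial_m fun x hx => ?_
    simp only [eval_sub, eval_mul, eval_C, eval_pow, eval_X]
    refine (mul_eq_zero.1 (?_ : _ * y x ^ n = 0)).resolve_right
      (pow_ne_zero _ (h.y_pos x hx).ne')
    linear_combination B' * hB x hx - B * hB' x hx
  have h2 := congrArg (fun p => Polynomial.coeff p (l + 1)) h1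
  have hB0 : B = 0 := by
    simpa [Polynomial.coeff_X_pow, Polynomial.coeff_C, hkl.symm, hkl] using h2
  open Polynomial in
  have h3 : (X ^ (k + 1) - C A : ℝ[X]) = 0 := by
    refine h.polynomial_m fun x hx => ?_
    simp only [eval_sub, eval_C, eval_pow, eval_X]
    refine (mul_eq_zero.1 (?_ : _ * y x ^ n = 0)).resolve_right
      (pow_ne_zero _ (h.y_pos x hx).ne')
    rw [hB x hx, hB0]
  have h4 := congrArg (fun p => Polynomial.coeff p (k + 1)) h3
  simp [Polynomial.coeff_X_pow] at h4

/-- If the scalar curvature is `κ y + δ`, then `m = κ y / (n + 1) + δ / n + ε y^(-n)`. -/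
theorem ext_integral (h : IsMomentumProfile n I y y₁ m m₁ ψ) (hn : 0 < n) {κ δ : ℝ}
    (hE : ∀ x ∈ I, n * m x * y₁ x + y x * m₁ x = (κ * y x + δ) * y₁ x) :
    ∃ ε, ∀ x ∈ I, y x ^ n * m x = κ / (n + 1) * y x ^ (n + 1) + δ / n * y x ^ n + ε := by
  obtain ⟨ε, hε⟩ := h.exists_const
    (F := fun x => y x ^ n * m x - (κ / (n + 1) * y x ^ (n + 1) + δ / n * y x ^ n))
    fun x hx => by
    have hy := h.hasDerivAt_y x hx
    refine (((hy.pow n).mul (h.hasDerivAt_m x hx)).sub (((hy.pow (n + 1)).const_mul _).add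
      ((hy.pow n).const_mul _))).congr_deriv ?_
    obtain ⟨d, rfl⟩ := Nat.exists_eq_succ_of_ne_zero hn.ne'
    have h1 := hE x hx
    have h2 : ((d : ℝ) + 1) ≠ 0 := by positivity
    have h3 : ((d : ℝ) + 1 + 1) ≠ 0 := by positivity
    simp only [Nat.succ_eq_add_one, Nat.add_sub_cancel, Pi.pow_apply] at h1 ⊢
    push_cast at h1 ⊢
    field_simp
    linear_combination y x ^ d * h1
  exact ⟨ε, fun x hx => by rw [← hε x hx]; ring⟩

/-- Substituting `m = K y + D + ε y^(-n)` into `m^(k+1) = A + B y^(-n)` gives a polynomial relation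
for `y`, which forces `m = D`. The hypothesis `0 < k` is needed to exclude `ε ≠ 0`: for `k = 0` both
equations hold for metrics of constant scalar curvature. -/
theorem not_genScal_ext (h : IsMomentumProfile n I y y₁ m m₁ ψ) (hn : 0 < n) {k : ℕ}
    (hk : 0 < k) {A κ δ : ℝ}
    (hA : ∀ x ∈ I, (k + 1) * m x ^ k * (y x * m₁ x) = n * y₁ x * (A - m x ^ (k + 1)))
    (hE : ∀ x ∈ I, n * m x * y₁ x + y x * m₁ x = (κ * y x + δ) * y₁ x) : False := by
  obtain ⟨B, hB⟩ := h.genScal_integral hn hA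
  obtain ⟨ε, hε⟩ := h.ext_integral hn hE
  generalize κ / ((n : ℝ) + 1) = K at hε
  generalize δ / (n : ℝ) = D at hε
  open Polynomial in
  have h1 : ((C K * X ^ (n + 1) + C D * X ^ n + C ε) ^ (k + 1)
      - (C A * X ^ (n * (k + 1)) + C B * X ^ (n * k)) : ℝ[X]) = 0 := by
    refine h.polynomial_y fun x hx => ?_
    simp only [eval_sub, eval_mul, eval_C, eval_pow, eval_X, eval_add]
    rw [← hε x hx, ← hB x hx]
    ring
  -- the term of degree `(k+1)(n+1)` comes only from the power of `K X^(n+1)`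
  have hK : K = 0 := by
    have h2 := congrArg (fun p => Polynomial.coeff p ((k + 1) * (n + 1))) h1
    have h3 : ((Polynomial.C K * Polynomial.X ^ (n + 1) + Polynomial.C D * Polynomial.X ^ n
        + Polynomial.C ε) ^ (k + 1)).coeff ((k + 1) * (n + 1)) = K ^ (k + 1) := by
      rw [Polynomial.coeff_pow_of_natDegree_le (n := n + 1) (by compute_degree)]
      simp [Polynomial.coeff_X_pow]
    have e1 : (k + 1) * (n + 1) ≠ n * (k + 1) := by
      intro h0
      have h5 : (k + 1) * (n + 1) = n * (k + 1) + (k + 1) := by ring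
      omega
    have e2 : (k + 1) * (n + 1) ≠ n * k := by
      intro h0
      have h5 : (k + 1) * (n + 1) = n * k + n + (k + 1) := by ring
      omega
    simp only [Polynomial.coeff_sub, h3, Polynomial.coeff_add, Polynomial.coeff_C_mul,
      Polynomial.coeff_X_pow, e1, e2, if_false, mul_zero, add_zero, sub_zero,
      Polynomial.coeff_zero] at h2
    exact pow_eq_zero_iff (Nat.succ_ne_zero k) |>.1 h2
  have hε0 : ε = 0 := by
    have h2 := congrArg (Polynomial.eval 0) h1
    simpa [hn.ne', hk.ne'] using h2
  refine h.not_const D fun x hx => ?_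
  refine mul_left_cancel₀ (pow_ne_zero n (h.y_pos x hx).ne') ?_
  rw [hε x hx, hK, hε0]; ring

/-- The soliton equation `2 m y = c y + a ψ` and the equation of `ψ` determine `m'`. -/
theorem soliton_deriv (h : IsMomentumProfile n I y y₁ m m₁ ψ) {a c : ℝ}
    (hs : ∀ x ∈ I, 2 * m x * y x = c * y x + a * ψ x) {x : ℝ} (hx : x ∈ I) :
    2 * (y x * m₁ x) = y₁ x * (a * n + n * c - 2 * n * m x - a * y x * m x) := by
  have hy := (h.y_pos x hx).ne'
  have h1 := eq_zero_of_hasDerivAt h.isOpen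
    (F := fun x => 2 * m x * y x - (c * y x + a * ψ x)) (fun x hx => sub_eq_zero.2 (hs x hx)) hx
    ((((h.hasDerivAt_m x hx).const_mul 2).mul (h.hasDerivAt_y x hx)).sub
      (((h.hasDerivAt_y x hx).const_mul c).add ((h.hasDerivAt_ψ x hx).const_mul a)))
  have h2 := hs x hx
  field_simp at h1
  refine mul_right_cancel₀ hy ?_
  linear_combination h1 + y₁ x * (n - 1) * h2

theorem soliton_coeff_ne_zero (h : IsMomentumProfile n I y y₁ m m₁ ψ) {a c : ℝ}
    (hs : ∀ x ∈ I, 2 * m x * y x = c * y x + a * ψ x) : a ≠ 0 := by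
  rintro rfl
  refine h.not_const (c / 2) fun x hx => ?_
  refine mul_right_cancel₀ (h.y_pos x hx).ne' ?_
  linear_combination hs x hx / 2

/-- Eliminating `m'` from the two equations gives `a y m` as an affine function of `y`; with
`IsMomentumProfile.ext_integral` this is a polynomial relation for `y`. The terms `r X^(d+1)` and
`a ε` have different degrees because `n = d + 2` is at least two. -/
theorem not_ext_soliton (h : IsMomentumProfile n I y y₁ m m₁ ψ) (hn : 1 < n) {a c κ δ : ℝ}
    (hs : ∀ x ∈ I, 2 * m x * y x = c * y x + a * ψ x)
    (hE : ∀ x ∈ I, n * m x * y₁ x + y x * m₁ x = (κ * y x + δ) * y₁ x) : False := by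
  have ha := h.soliton_coeff_ne_zero hs
  obtain ⟨ε, hε⟩ := h.ext_integral (by omega) hE
  have hlin : ∀ x ∈ I, a * y x * m x = a * n + n * c - 2 * δ - 2 * κ * y x := by
    intro x hx
    refine mul_right_cancel₀ (h.y₁_pos x hx).ne' ?_
    linear_combination h.soliton_deriv hs hx - 2 * hE x hx
  obtain ⟨d, rfl⟩ : ∃ d, n = d + 2 := ⟨n - 2, by omega⟩
  set K := κ / (((d + 2 : ℕ) : ℝ) + 1) with hK
  set D := δ / ((d + 2 : ℕ) : ℝ)
  set r := a * ((d + 2 : ℕ) : ℝ) + ((d + 2 : ℕ) : ℝ) * c - 2 * δ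
  open Polynomial in
  have h1 : (C (a * K) * X ^ (d + 3) + C (a * D + 2 * κ) * X ^ (d + 2) - C r * X ^ (d + 1)
      + C (a * ε) : ℝ[X]) = 0 := by
    refine h.polynomial_y fun x hx => ?_
    simp only [eval_sub, eval_mul, eval_C, eval_pow, eval_X, eval_add]
    linear_combination y x ^ (d + 1) * hlin x hx - a * hε x hx
  have hcoef := fun j => congrArg (fun p => Polynomial.coeff p j) h1
  simp only [Polynomial.coeff_add, Polynomial.coeff_sub, Polynomial.coeff_C_mul,
    Polynomial.coeff_X_pow, Polynomial.coeff_C, Polynomial.coeff_zero] at hcoef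
  have hK0 : K = 0 := by
    simpa [ha] using hcoef (d + 3)
  have hκ : κ = 0 := by
    have : (((d + 2 : ℕ) : ℝ) + 1) ≠ 0 := by positivity
    exact (div_eq_zero_iff.1 hK0).resolve_right this
  have hD0 : D = 0 := by
    simpa [ha, hκ] using hcoef (d + 2)
  have hε0 : ε = 0 := by
    simpa [ha] using hcoef 0
  refine h.not_const 0 fun x hx => ?_
  refine mul_left_cancel₀ (pow_ne_zero (d + 2) (h.y_pos x hx).ne') ?_
  rw [hε x hx, hK0, hD0, hε0]; ring

/-- Eliminating `m'`, and then `y` with `IsMomentumProfile.genScal_integral`, gives a polynomial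
relation for `m`. -/
theorem not_genScal_soliton (h : IsMomentumProfile n I y y₁ m m₁ ψ) (hn : 1 < n) {k : ℕ}
    {a c A : ℝ} (hs : ∀ x ∈ I, 2 * m x * y x = c * y x + a * ψ x)
    (hA : ∀ x ∈ I, (k + 1) * m x ^ k * (y x * m₁ x) = n * y₁ x * (A - m x ^ (k + 1))) :
    False := by
  have ha := h.soliton_coeff_ne_zero hs
  obtain ⟨B, hB⟩ := h.genScal_integral (by omega) hA
  -- eliminating `m'` expresses `y m^(k+1)` as a polynomial in `m`
  have hlin : ∀ x ∈ I, a * (k + 1) * (y x * m x ^ (k + 1))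
      = (k + 1) * n * (a + c) * m x ^ k - 2 * n * k * m x ^ (k + 1) - 2 * n * A := by
    intro x hx
    refine mul_right_cancel₀ (h.y₁_pos x hx).ne' ?_
    linear_combination (k + 1) * m x ^ k * h.soliton_deriv hs hx - 2 * hA x hx
  open Polynomial in
  have h1 : ((X ^ (k + 1) - C A) * (C (((k : ℝ) + 1) * n * (a + c)) * X ^ k
        - C (2 * n * (k : ℝ)) * X ^ (k + 1) - C (2 * n * A)) ^ n
      - C (B * (a * ((k : ℝ) + 1)) ^ n) * X ^ ((k + 1) * n) : ℝ[X]) = 0 := by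
    refine h.polynomial_m fun x hx => ?_
    simp only [eval_sub, eval_mul, eval_C, eval_pow, eval_X]
    rw [← hlin x hx, ← hB x hx, mul_pow _ (y x * _), mul_pow (y x), ← pow_mul]
    ring
  have hn0 : (n : ℝ) ≠ 0 := by
    have : 0 < n := by omega
    positivity
  rcases Nat.eq_zero_or_pos k with rfl | hk
  · -- here the polynomial is the constant `p₀`, and the equation reads `a y m = p₀`
    obtain ⟨p₀, hp₀⟩ : ∃ p₀, p₀ = n * (a + c) - 2 * n * A := ⟨_, rfl⟩
    open Polynomial in
    have h2 : ((X - C A) * C (p₀ ^ n) - C (B * a ^ n) * X ^ n : ℝ[X]) = 0 := by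
      rw [← h1, hp₀, C_pow, ← C_pow]
      simp
    have h3 := congrArg (fun p => Polynomial.coeff p 1) h2
    have h4 : p₀ = 0 := by
      have hn1 : (1 : ℕ) ≠ n := by omega
      have : p₀ ^ n = 0 := by
        simpa only [Polynomial.coeff_sub, Polynomial.coeff_mul_C, Polynomial.coeff_C_mul,
          Polynomial.coeff_X_pow, Polynomial.coeff_X_one, Polynomial.coeff_C_of_ne_zero one_ne_zero,
          hn1, if_false, mul_zero, sub_zero, one_mul, Polynomial.coeff_zero] using h3
      exact pow_eq_zero_iff (by omega) |>.1 this
    refine h.not_const 0 fun x hx => ?_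
    have h5 := hlin x hx
    simp only [Nat.cast_zero, zero_add, mul_one, pow_one, pow_zero, one_mul, mul_zero,
      zero_mul, sub_zero] at h5
    rw [← hp₀, h4] at h5
    simpa [ha, (h.y_pos x hx).ne'] using h5
  · -- the leading coefficient, in degree `(k+1)(n+1)`, is `(-2 n k)^n`
    have h2 := congrArg (fun p => Polynomial.coeff p ((k + 1) + n * (k + 1))) h1
    have e1 : (k + 1) + n * (k + 1) ≠ (k + 1) * n := by
      rw [mul_comm n]; omega
    simp only [Polynomial.coeff_sub, Polynomial.coeff_C_mul, Polynomial.coeff_zero,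
      Polynomial.coeff_X_pow, e1, if_false, mul_zero, sub_zero] at h2
    rw [Polynomial.coeff_mul_add_eq_of_natDegree_le (df := k + 1) (dg := n * (k + 1))
      (by compute_degree) (Polynomial.natDegree_pow_le_of_le n (by compute_degree)),
      Polynomial.coeff_pow_of_natDegree_le (by compute_degree)] at h2
    have hk0 : (k : ℝ) ≠ 0 := by positivity
    have hk1 : k + 1 ≠ k := by omega
    simp only [Polynomial.coeff_sub, Polynomial.coeff_C_mul, Polynomial.coeff_X_pow,
      Polynomial.coeff_C_of_ne_zero (Nat.succ_ne_zero k), hk1, if_false, if_true] at h2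
    simp [hn0, hk0] at h2

end IsMomentumProfile

/-! ### From the curvature conditions to differential equations -/

section Rigidity

variable {n : ℕ} {M : Type*} [TopologicalSpace M] [ChartedSpace (Fin n → ℂ) M]
  {g : KahlerMetric n M} {e : OpenPartialHomeomorph M (Fin n → ℂ)}
  {U : Set (Fin n → ℂ)} {I : Set ℝ} {φ : ℝ → ℝ}

namespace IsRadialOn

/-- The momentum profile of a radial metric. -/
theorem isMomentumProfile (h : IsRadialOn g e U I φ) (hne : I.Nonempty)
    (hm : ∀ x ∈ I, deriv (ricTangent n φ) x ≠ 0) :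
    IsMomentumProfile n I (fun x => x * φ x) (radialDensity φ) (ricTangent n φ)
      (deriv (ricTangent n φ)) (fun x => x * radialDensity φ x) where
  isOpen := h.isOpen_I
  conn := h.conn
  nonempty := hne
  y_pos := fun x hx => mul_pos (h.I_pos x hx) (h.pos x hx)
  y₁_pos := h.dens_pos
  m₁_ne := hm
  hasDerivAt_y := fun x hx => ((hasDerivAt_id x).mul (h.hasDerivAt h.smooth hx)).congr_deriv (by
    simp [radialDensity])
  hasDerivAt_m := fun x hx => h.hasDerivAt h.contDiffOn_ricTangent hx
  hasDerivAt_ψ := fun x hx => by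
    refine ((hasDerivAt_id x).mul (h.hasDerivAt h.contDiffOn_density hx)).congr_deriv ?_
    have hx0 := (h.I_pos x hx).ne'
    have hφ := (h.pos x hx).ne'
    have h1 := h.deriv_logDet hx
    have h2 := h.deriv_logDet_eq hx
    have h3 : radialDensity φ x = φ x + x * deriv φ x := rfl
    rw [eq_div_iff (mul_ne_zero hx0 hφ)]
    simp only [id, one_mul]
    linear_combination -x ^ 2 * h1 - x ^ 2 * φ x * radialDensity φ x * h2
      + x * (n - 1) * radialDensity φ x * h3

/-- The radial Ricci eigenvalue in terms of the tangential one. -/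
theorem ricRadial_mul (h : IsRadialOn g e U I φ) {x : ℝ} (hx : x ∈ I) :
    ricRadial n φ x * radialDensity φ x
      = ricTangent n φ x * radialDensity φ x + x * φ x * deriv (ricTangent n φ) x := by
  have h1 := eq_zero_of_hasDerivAt h.isOpen_I
    (F := fun x => ricTangent n φ x * φ x - -deriv (logDet n φ) x)
    (fun w hw => sub_eq_zero.2 (h.deriv_logDet_eq hw).symm) hx
    (((h.hasDerivAt h.contDiffOn_ricTangent hx).mul (h.hasDerivAt h.smooth hx)).sub
      (h.hasDerivAt (contDiffOn_deriv h.isOpen_I h.contDiffOn_logDet) hx).neg)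
  have h2 := h.deriv_logDet_eq hx
  have h3 : radialDensity φ x = φ x + x * deriv φ x := rfl
  linear_combination -h.deriv_logDet_eq' hx + h2 - x * h1 - ricTangent n φ x * h3

/-- The equation expressing that `ρ_(k+1)` is constant; `A` is its value divided by
`C(n,k+1)`. -/
theorem genScal_ode (h : IsRadialOn g e U I φ) {k : ℕ} (hk : k < n)
    (hg : g ∈ ConstGenScal n M (k + 1)) :
    ∃ A : ℝ, ∀ x ∈ I, (k + 1) * ricTangent n φ x ^ k * (x * φ x * deriv (ricTangent n φ) x)
      = n * radialDensity φ x * (A - ricTangent n φ x ^ (k + 1)) := by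
  obtain ⟨c, hc⟩ := hg
  obtain ⟨d, rfl⟩ : ∃ d, n = d + 1 := ⟨n - 1, by omega⟩
  have hN : ((d + 1).choose (k + 1) : ℝ) ≠ 0 := by
    exact_mod_cast (Nat.choose_pos (by omega)).ne'
  have e1 : ((d + 1).choose (k + 1) : ℝ) = d.choose k + d.choose (k + 1) := by
    exact_mod_cast Nat.choose_succ_succ d k
  have e2 : ((d : ℝ) + 1) * d.choose k = (d + 1).choose (k + 1) * (k + 1) := by
    exact_mod_cast Nat.add_one_mul_choose_eq d k
  refine ⟨c / (d + 1).choose (k + 1), fun x hx => ?_⟩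
  obtain ⟨z, hz, rfl⟩ := h.surj x hx
  have h1 := hc e h.mem_charts z (h.subset hz)
  rw [h.genScalarCurvature_eq hz] at h1
  have h2 := Complex.ofReal_injective h1
  have h3 := h.ricRadial_mul hx
  simp only [Nat.add_sub_cancel] at h2
  refine mul_left_cancel₀ hN ?_
  have h4 : ((d + 1).choose (k + 1) : ℝ) * (c / (d + 1).choose (k + 1)) = c :=
    mul_div_cancel₀ _ hN
  push_cast
  generalize c / ((d + 1).choose (k + 1) : ℝ) = A at *
  linear_combination (d + 1) * radialDensity φ (sqNorm z) * h2
    - (d + 1) * radialDensity φ (sqNorm z) * h4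
    - ricTangent (d + 1) φ (sqNorm z) ^ k * (d + 1) * d.choose k * h3
    - ricTangent (d + 1) φ (sqNorm z) ^ k *
      (sqNorm z * φ (sqNorm z) * deriv (ricTangent (d + 1) φ) (sqNorm z)) * e2
    + (d + 1) * radialDensity φ (sqNorm z) * ricTangent (d + 1) φ (sqNorm z) ^ (k + 1) * e1

/-- For an extremal metric the scalar curvature is affine in `y = x φ`. -/
theorem ext_ode (h : IsRadialOn g e U I φ) (hg : g ∈ Ext n M) :
    ∃ κ δ : ℝ, ∀ x ∈ I, n * ricTangent n φ x * radialDensity φ x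
      + x * φ x * deriv (ricTangent n φ) x = (κ * (x * φ x) + δ) * radialDensity φ x := by
  have hS := h.contDiffOn_scalProfile
  have hq : ContDiffOn ℝ ∞ (fun x => deriv (scalProfile n φ) x / radialDensity φ x) I :=
    (contDiffOn_deriv h.isOpen_I hS).div h.contDiffOn_density fun x hx => (h.dens_pos x hx).ne'
  obtain ⟨κ, hκ⟩ := h.isOpen_I.exists_is_const_of_deriv_eq_zero h.conn
    (hq.differentiableOn (by simp)) fun x hx => h.deriv_eq_zero_of_ext hg hx
  have hd : ∀ x ∈ I, HasDerivAt (fun x => scalProfile n φ x - κ * (x * φ x)) 0 x :=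
    fun x hx => by
      refine ((h.hasDerivAt hS hx).sub (((hasDerivAt_id x).mul
        (h.hasDerivAt h.smooth hx)).const_mul κ)).congr_deriv ?_
      have h1 := hκ x hx
      rw [div_eq_iff (h.dens_pos x hx).ne'] at h1
      rw [h1, radialDensity]; simp only [id]; ring
  obtain ⟨δ, hδ⟩ := h.isOpen_I.exists_is_const_of_deriv_eq_zero h.conn
    (fun x hx => (hd x hx).differentiableAt.differentiableWithinAt) fun x hx => (hd x hx).deriv
  refine ⟨κ, δ, fun x hx => ?_⟩
  have h1 := hδ x hx
  have h2 : scalProfile n φ x = ((n : ℝ) - 1) * ricTangent n φ x + ricRadial n φ x := rfl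
  linear_combination radialDensity φ x * h1 - radialDensity φ x * h2 - h.ricRadial_mul hx

theorem soliton_momentum (h : IsRadialOn g e U I φ) (hn : 1 < n) (hg : g ∈ KRS n M)
    (hm : ∀ x ∈ I, deriv (ricTangent n φ) x ≠ 0) :
    ∃ a c : ℝ, ∀ x ∈ I, 2 * ricTangent n φ x * (x * φ x)
      = c * (x * φ x) + a * (x * radialDensity φ x) := by
  obtain ⟨a, c, hac⟩ := h.soliton_ode hn hg hm
  exact ⟨a, c, fun x hx => by linear_combination x * hac x hx⟩

/-- If every interval contains a critical point of the tangential Ricci eigenvalue, this eigenvalue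
is constant, and the metric is Einstein. -/
theorem exists_ricciMatrix_eq_smul (h : IsRadialOn g e U I φ)
    (H : ∀ U' J, IsRadialOn g e U' J φ → J.Nonempty →
      ¬ ∀ x ∈ J, deriv (ricTangent n φ) x ≠ 0) :
    ∃ c : ℝ, ∀ z ∈ U, ricciMatrix g e z = (c : ℂ) • metricMatrix g e z := by
  have hI := h.isOpen_I
  have hm := h.contDiffOn_ricTangent
  have h0 : ∀ x ∈ I, deriv (ricTangent n φ) x = 0 := by
    intro x hx
    by_contra hne
    have hev : ∀ᶠ w in 𝓝 x, w ∈ I ∧ deriv (ricTangent n φ) w ≠ 0 :=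
      (hI.eventually_mem hx).and
        (((contDiffOn_deriv hI hm).continuousOn.continuousAt (hI.mem_nhds hx)).eventually_ne hne)
    obtain ⟨r, hr, hball⟩ := Metric.eventually_nhds_iff_ball.1 hev
    exact H _ _ (h.mono Metric.isOpen_ball (convex_ball x r).isPreconnected
      fun w hw => (hball w hw).1) ⟨x, Metric.mem_ball_self hr⟩ fun w hw => (hball w hw).2
  obtain ⟨c, hc⟩ := hI.exists_is_const_of_deriv_eq_zero h.conn
    (hm.differentiableOn (by simp)) h0
  refine ⟨c, fun z hz => ?_⟩
  have hx := h.maps z hz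
  have h1 := h.deriv_logDet_eq hx
  have h2 := h.deriv_logDet_eq' hx
  have h3 := h.ricRadial_mul hx
  have h4 : radialDensity φ (sqNorm z) = φ (sqNorm z) + sqNorm z * deriv φ (sqNorm z) := rfl
  rw [h0 _ hx] at h3
  rw [hc _ hx] at h1 h3
  have h5 : -deriv (deriv (logDet n φ)) (sqNorm z) = c * deriv φ (sqNorm z) := by
    refine mul_right_cancel₀ (h.I_pos _ hx).ne' ?_
    linear_combination h2 + h3 - h1 + c * h4
  rw [h.ricciMatrix_eq hz, h.metric z hz, h1, h5]
  ext i j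
  simp only [radialMatrix, Matrix.smul_apply, smul_eq_mul]
  push_cast; split_ifs <;> ring

/-- On a Riemann surface the scalar curvature determines the Ricci form. -/
theorem ricciMatrix_eq_scal {M : Type*} [TopologicalSpace M] [ChartedSpace (Fin 1 → ℂ) M]
    {g : KahlerMetric 1 M} {e : OpenPartialHomeomorph M (Fin 1 → ℂ)} {U : Set (Fin 1 → ℂ)}
    (h : IsRadialOn g e U I φ) {z : Fin 1 → ℂ} (hz : z ∈ U) :
    ricciMatrix g e z = (scalProfile 1 φ (sqNorm z) : ℂ) • metricMatrix g e z := by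
  have h1 : IsUnit (metricMatrix g e z).det :=
    (metricMatrix_det_ne_zero g h.mem_charts (h.subset hz)).isUnit
  rw [← h.scalarCurvature_eq hz, scalarCurvature]
  generalize hB : (metricMatrix g e z)⁻¹ * ricciMatrix g e z = B
  have h2 : ricciMatrix g e z = metricMatrix g e z * B := by
    rw [← hB, Matrix.mul_nonsing_inv_cancel_left _ _ h1]
  rw [h2]
  ext i j
  fin_cases i; fin_cases j
  simp [Matrix.mul_apply, Matrix.trace, mul_comm]

end IsRadialOn

end Rigidity

/-! ### From the radial annuli to the whole manifold -/

section Global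

variable {n : ℕ} {M : Type*} [TopologicalSpace M] [ChartedSpace (Fin n → ℂ) M]
  {g : KahlerMetric n M} {e : OpenPartialHomeomorph M (Fin n → ℂ)}

theorem one_lt_rank_real (hn : 0 < n) : 1 < Module.rank ℝ (Fin n → ℂ) := by
  have h1 : Module.finrank ℝ (Fin n → ℂ) = n * 2 := by
    rw [Module.finrank_pi_fintype]; simp [Complex.finrank_real_complex]
  rw [← Module.finrank_eq_rank, h1]
  exact_mod_cast (by omega : 1 < n * 2)

open scoped ComplexOrder in
/-- The Einstein condition extends over the origin of a chart: the punctured ball is connected, so the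
Einstein constant is the same on all of it, and both sides of the equation are continuous. -/
theorem eventually_ricciMatrix_eq_smul (hn : 0 < n) (he : e ∈ holoCharts n M)
    (h0 : (0 : Fin n → ℂ) ∈ e.target)
    (H : ∀ z ∈ e.target, z ≠ 0 → ∃ c : ℝ, ∀ᶠ w in 𝓝 z,
      ricciMatrix g e w = (c : ℂ) • metricMatrix g e w) :
    ∃ c : ℝ, ∀ᶠ w in 𝓝 (0 : Fin n → ℂ), ricciMatrix g e w = (c : ℂ) • metricMatrix g e w := by
  obtain ⟨r, hr, hball⟩ := Metric.isOpen_iff.1 e.open_target 0 h0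
  set i₀ : Fin n := ⟨0, hn⟩
  have hpos : ∀ z ∈ e.target, metricMatrix g e z i₀ i₀ ≠ 0 := fun z hz =>
    (metricMatrix_posDef g he hz).diag_pos.ne'
  set q : (Fin n → ℂ) → ℝ := fun z => (ricciMatrix g e z i₀ i₀ / metricMatrix g e z i₀ i₀).re
  have hqc : ∀ z ∈ e.target, ∀ c : ℝ, ricciMatrix g e z = (c : ℂ) • metricMatrix g e z →
      q z = c := by
    intro z hz c hc
    simp [q, hc, hpos z hz]
  have hq : ∀ z ∈ Metric.ball (0 : Fin n → ℂ) r \ {0}, ∃ c : ℝ, q =ᶠ[𝓝 z] fun _ => c := by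
    rintro z ⟨hz, hz0⟩
    obtain ⟨c, hc⟩ := H z (hball hz) hz0
    refine ⟨c, ?_⟩
    filter_upwards [hc, e.open_target.mem_nhds (hball hz)] with w hw hwt using hqc w hwt c hw
  have hopen : IsOpen (Metric.ball (0 : Fin n → ℂ) r \ {0}) :=
    Metric.isOpen_ball.sdiff isClosed_singleton
  obtain ⟨c, hc⟩ := hopen.exists_is_const_of_fderiv_eq_zero (𝕜 := ℝ) (f := q)
    (isPreconnected_punctured_ball (one_lt_rank_real hn) hr)
    (fun z hz => by
      obtain ⟨c, hc⟩ := hq z hz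
      exact ((hasFDerivAt_const c z).congr_of_eventuallyEq hc).differentiableAt
        |>.differentiableWithinAt)
    (fun z hz => by
      obtain ⟨c, hc⟩ := hq z hz
      exact ((hasFDerivAt_const c z).congr_of_eventuallyEq hc).fderiv)
  have hall : ∀ z ∈ Metric.ball (0 : Fin n → ℂ) r \ {0},
      ricciMatrix g e z = (c : ℂ) • metricMatrix g e z := by
    intro z hz
    obtain ⟨c', hc'⟩ := H z (hball hz.1) hz.2
    have h1 := hc'.self_of_nhds
    rwa [← hqc z (hball hz.1) c' h1, hc z hz] at h1
  have hzero : ricciMatrix g e 0 = (c : ℂ) • metricMatrix g e 0 := by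
    have : Nonempty (Fin n) := ⟨i₀⟩
    have hne : (𝓝[≠] (0 : Fin n → ℂ)).NeBot := Module.punctured_nhds_neBot ℝ (Fin n → ℂ) 0
    ext i j
    have hR : ContinuousAt (fun w => ricciMatrix g e w i j) 0 :=
      (contDiffOn_ricciMatrix g he i j).continuousOn.continuousAt (e.open_target.mem_nhds h0)
    have hG : ContinuousAt (fun w => (c : ℂ) * metricMatrix g e w i j) 0 :=
      continuousAt_const.mul
        ((g.smooth e he i j).continuousOn.continuousAt (e.open_target.mem_nhds h0))
    refine tendsto_nhds_unique_of_eventuallyEq (l := 𝓝[≠] (0 : Fin n → ℂ))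
      (hR.tendsto.mono_left nhdsWithin_le_nhds) (hG.tendsto.mono_left nhdsWithin_le_nhds) ?_
    filter_upwards [self_mem_nhdsWithin, nhdsWithin_le_nhds (Metric.ball_mem_nhds _ hr)]
      with w hw hw'
    rw [hall w ⟨hw', hw⟩]; rfl
  refine ⟨c, ?_⟩
  filter_upwards [Metric.ball_mem_nhds _ hr] with w hw
  rcases eq_or_ne w 0 with rfl | hw0
  · exact hzero
  · exact hall w ⟨hw, hw0⟩

/-- A radial metric which is Einstein on every radial region is Einstein. -/
theorem mem_KE_of_radial [ConnectedSpace M] (hn : 0 < n) (hg : g ∈ Rad n M)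
    (H : ∀ e U I φ, IsRadialOn g e U I φ →
      ∃ c : ℝ, ∀ z ∈ U, ricciMatrix g e z = (c : ℂ) • metricMatrix g e z) : g ∈ KE n M := by
  obtain ⟨Φ, hΦ, hrad⟩ := hg
  refine mem_KE_of_local hn g fun p => ?_
  obtain ⟨e, he, hp, f, hf⟩ := hrad p
  refine ⟨e, he, hp, ?_⟩
  have hoff : ∀ z ∈ e.target, z ≠ 0 → ∃ c : ℝ, ∀ᶠ w in 𝓝 z,
      ricciMatrix g e w = (c : ℂ) • metricMatrix g e w := by
    intro z hz hz0
    obtain ⟨U, I, φ, hU, hzU⟩ := exists_isRadialOn hn he (hΦ e he).1 (hΦ e he).2 hf hz hz0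
    obtain ⟨c, hc⟩ := H e U I φ hU
    exact ⟨c, (hU.isOpen_U.eventually_mem hzU).mono fun w hw => hc w hw⟩
  rcases eq_or_ne (e p) 0 with h0 | h0
  · rw [h0]
    exact eventually_ricciMatrix_eq_smul hn he (h0 ▸ e.map_source hp) hoff
  · exact hoff _ (e.map_source hp) h0

end Global

/-! ### Einstein metrics -/

section Einstein

variable {n : ℕ} {M : Type*} [TopologicalSpace M] [ChartedSpace (Fin n → ℂ) M]
  {g : KahlerMetric n M}

theorem exists_ricciMatrix_of_mem_KE (hg : g ∈ KE n M) : ∃ c : ℝ, ∀ e ∈ holoCharts n M,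
    ∀ z ∈ e.target, ricciMatrix g e z = (c : ℂ) • metricMatrix g e z := by
  obtain ⟨c, hc⟩ := hg
  refine ⟨c / 2, fun e he z hz => ?_⟩
  ext i j
  have h1 : 2 * ricciMatrix g e z i j = c * metricMatrix g e z i j :=
    congrFun (congrFun (hc e he z hz) i) j
  simp only [Matrix.smul_apply, smul_eq_mul]
  push_cast
  linear_combination h1 / 2

theorem mem_Ext_of_mem_KE (hg : g ∈ KE n M) : g ∈ Ext n M := by
  obtain ⟨c, hc⟩ := exists_ricciMatrix_of_mem_KE hg
  intro e he
  have h1 : ∀ z ∈ e.target, scalarCurvature g e z = c * n := by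
    intro z hz
    rw [scalarCurvature, hc e he z hz, Matrix.mul_smul,
      Matrix.nonsing_inv_mul _ (metricMatrix_det_ne_zero g he hz).isUnit]
    simp
  have h2 : ∀ z ∈ e.target, hamiltonianScal g e z = 0 := by
    intro z hz
    have h3 : scalarCurvature g e =ᶠ[𝓝 z] fun _ => (c * n : ℂ) := by
      filter_upwards [e.open_target.mem_nhds hz] with w hw using h1 w hw
    ext j
    simp only [hamiltonianScal, wirtingerBar_congr h3]
    simp [wirtingerBar]
  exact (differentiableOn_const 0).congr h2

theorem mem_KRS_of_mem_KE (hg : g ∈ KE n M) : g ∈ KRS n M := by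
  obtain ⟨c, hc⟩ := hg
  have h0 : ∀ e : OpenPartialHomeomorph M (Fin n → ℂ),
      vectorCoord (fun _ => 0) e = fun _ => (0 : Fin n → ℂ) := fun e => by
    ext1 z; exact map_zero _
  refine ⟨c, fun _ => 0, fun e _ => ?_, fun e he z hz => ?_⟩
  · rw [h0]; exact differentiableOn_const 0
  · rw [hc e he z hz]
    ext i j
    simp [lieKahlerForm, h0, wirtinger]

open Polynomial in
theorem mem_ConstGenScal_of_mem_KE (hg : g ∈ KE n M) (k : ℕ) : g ∈ ConstGenScal n M k := by
  obtain ⟨c, hc⟩ := exists_ricciMatrix_of_mem_KE hg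
  refine ⟨n.choose k * c ^ k, fun e he z hz => ?_⟩
  have hdet := metricMatrix_det_ne_zero g he hz
  have h1 : (metricMatrix g e z).map (C : ℂ → ℂ[X])
      + (X : ℂ[X]) • ((c : ℂ) • metricMatrix g e z).map (C : ℂ → ℂ[X])
      = (1 + X).comp (C (c : ℂ) * X) • (metricMatrix g e z).map (C : ℂ → ℂ[X]) := by
    ext1 i j
    simp; ring
  have h2 : ((metricMatrix g e z).map (C : ℂ → ℂ[X])).det = C (metricMatrix g e z).det :=
    (RingHom.map_det (C : ℂ →+* ℂ[X]) _).symm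
  rw [genScalarCurvature, hc e he z hz, h1, Matrix.det_smul, h2, coeff_mul_C,
    mul_div_cancel_right₀ _ hdet, Fintype.card_fin, ← pow_comp, comp_C_mul_X_coeff,
    coeff_one_add_X_pow]
  push_cast; rfl

end Einstein

/-! ### The classes of radial metrics -/

section Classes

variable {n : ℕ} {M : Type*} [TopologicalSpace M] [ChartedSpace (Fin n → ℂ) M]
  [ConnectedSpace M] {g : KahlerMetric n M}

theorem mem_KE_of_genScal_genScal {k l : ℕ} (hk : k < n) (hl : l < n) (hkl : k ≠ l)
    (h₁ : g ∈ ConstGenScal n M (k + 1)) (h₂ : g ∈ ConstGenScal n M (l + 1))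
    (hg : g ∈ Rad n M) : g ∈ KE n M := by
  refine mem_KE_of_radial (by omega) hg fun e U I φ h =>
    h.exists_ricciMatrix_eq_smul fun U' J hJ hne hm => ?_
  obtain ⟨A, hA⟩ := hJ.genScal_ode hk h₁
  obtain ⟨A', hA'⟩ := hJ.genScal_ode hl h₂
  exact (hJ.isMomentumProfile hne hm).not_genScal_genScal (by omega) hkl hA hA'

theorem mem_KE_of_genScal_ext {k : ℕ} (hk : k < n) (hk0 : 0 < k)
    (h₁ : g ∈ ConstGenScal n M (k + 1)) (h₂ : g ∈ Ext n M) (hg : g ∈ Rad n M) :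
    g ∈ KE n M := by
  refine mem_KE_of_radial (by omega) hg fun e U I φ h =>
    h.exists_ricciMatrix_eq_smul fun U' J hJ hne hm => ?_
  obtain ⟨A, hA⟩ := hJ.genScal_ode hk h₁
  obtain ⟨κ, δ, hE⟩ := hJ.ext_ode h₂
  exact (hJ.isMomentumProfile hne hm).not_genScal_ext (by omega) hk0 hA hE

theorem mem_KE_of_genScal_soliton {k : ℕ} (hk : k < n)
    (h₁ : g ∈ ConstGenScal n M (k + 1)) (h₂ : g ∈ KRS n M) (hg : g ∈ Rad n M) :
    g ∈ KE n M := by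
  refine mem_KE_of_radial (by omega) hg fun e U I φ h => ?_
  rcases Nat.lt_or_ge 1 n with hn | hn
  · refine h.exists_ricciMatrix_eq_smul fun U' J hJ hne hm => ?_
    obtain ⟨A, hA⟩ := hJ.genScal_ode hk h₁
    obtain ⟨a, c, hs⟩ := hJ.soliton_momentum hn h₂ hm
    exact (hJ.isMomentumProfile hne hm).not_genScal_soliton hn hs hA
  · -- on a curve `ρ₁` is the scalar curvature, and it determines the Ricci form
    obtain rfl : n = 1 := by omega
    obtain rfl : k = 0 := by omega
    obtain ⟨c, hc⟩ := h₁
    refine ⟨c, fun z hz => ?_⟩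
    have h1 := hc e h.mem_charts z (h.subset hz)
    rw [h.genScalarCurvature_eq hz] at h1
    rw [h.ricciMatrix_eq_scal hz, ← h1]
    simp [scalProfile]

theorem mem_KE_of_ext_soliton (h₁ : g ∈ Ext n M) (h₂ : g ∈ KRS n M) (hg : g ∈ Rad n M) :
    g ∈ KE n M := by
  rcases Nat.eq_zero_or_pos n with rfl | hn0
  · exact ⟨0, fun e _ z _ => Subsingleton.elim _ _⟩
  refine mem_KE_of_radial hn0 hg fun e U I φ h => ?_
  rcases Nat.lt_or_ge 1 n with hn | hn
  · refine h.exists_ricciMatrix_eq_smul fun U' J hJ hne hm => ?_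
    obtain ⟨κ, δ, hE⟩ := hJ.ext_ode h₁
    obtain ⟨a, c, hs⟩ := hJ.soliton_momentum hn h₂ hm
    exact (hJ.isMomentumProfile hne hm).not_ext_soliton hn hs hE
  · obtain rfl : n = 1 := by omega
    obtain ⟨c, hc⟩ := h.isOpen_I.exists_is_const_of_deriv_eq_zero h.conn
      (h.contDiffOn_scalProfile.differentiableOn (by simp))
      fun x hx => h.deriv_scal_eq_zero h₂ h₁ hx
    refine ⟨c, fun z hz => ?_⟩
    rw [h.ricciMatrix_eq_scal hz, hc _ (h.maps z hz)]

end Classes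

end RadialKahler

end

theorem theorem1p1 (n : ℕ) (M : Type*) [TopologicalSpace M] [ChartedSpace (Fin n → ℂ) M]
    [IsManifold 𝓘(ℂ, Fin n → ℂ) ω M] [ConnectedSpace M] :
    (RadialKahler.Ext n M ∩ RadialKahler.KRS n M ∩ RadialKahler.Rad n M
        = RadialKahler.KE n M ∩ RadialKahler.Rad n M) ∧
    (∀ k h : ℕ, 1 ≤ k → k ≤ n → 1 ≤ h → h ≤ n → h ≠ k →
      RadialKahler.ConstGenScal n M k ∩ RadialKahler.ConstGenScal n M h ∩ RadialKahler.Rad n M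
        = RadialKahler.KE n M ∩ RadialKahler.Rad n M) ∧
    (∀ k : ℕ, 1 < k → k ≤ n →
      RadialKahler.ConstGenScal n M k ∩ RadialKahler.Ext n M ∩ RadialKahler.Rad n M
        = RadialKahler.KE n M ∩ RadialKahler.Rad n M) ∧
    (∀ k : ℕ, 1 ≤ k → k ≤ n →
      RadialKahler.ConstGenScal n M k ∩ RadialKahler.KRS n M ∩ RadialKahler.Rad n M
        = RadialKahler.KE n M ∩ RadialKahler.Rad n M) := by
  refine ⟨?_, fun k h hk hkn hh hhn hne => ?_, fun k hk hkn => ?_, fun k hk hkn => ?_⟩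
  · ext g
    exact ⟨fun ⟨⟨h₁, h₂⟩, hg⟩ => ⟨RadialKahler.mem_KE_of_ext_soliton h₁ h₂ hg, hg⟩,
      fun ⟨h, hg⟩ => ⟨⟨RadialKahler.mem_Ext_of_mem_KE h, RadialKahler.mem_KRS_of_mem_KE h⟩, hg⟩⟩
  · obtain ⟨k, rfl⟩ := Nat.exists_eq_add_of_le' hk
    obtain ⟨h, rfl⟩ := Nat.exists_eq_add_of_le' hh
    ext g
    exact ⟨fun ⟨⟨h₁, h₂⟩, hg⟩ => ⟨RadialKahler.mem_KE_of_genScal_genScal (by omega) (by omega)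
        (by omega) h₁ h₂ hg, hg⟩,
      fun ⟨h, hg⟩ => ⟨⟨RadialKahler.mem_ConstGenScal_of_mem_KE h _,
        RadialKahler.mem_ConstGenScal_of_mem_KE h _⟩, hg⟩⟩
  · obtain ⟨k, rfl⟩ := Nat.exists_eq_add_of_le' hk.le
    ext g
    exact ⟨fun ⟨⟨h₁, h₂⟩, hg⟩ => ⟨RadialKahler.mem_KE_of_genScal_ext (by omega) (by omega)
        h₁ h₂ hg, hg⟩,
      fun ⟨h, hg⟩ => ⟨⟨RadialKahler.mem_ConstGenScal_of_mem_KE h _,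
        RadialKahler.mem_Ext_of_mem_KE h⟩, hg⟩⟩
  · obtain ⟨k, rfl⟩ := Nat.exists_eq_add_of_le' hk
    ext g
    exact ⟨fun ⟨⟨h₁, h₂⟩, hg⟩ => ⟨RadialKahler.mem_KE_of_genScal_soliton (by omega) h₁ h₂ hg,
        hg⟩,
      fun ⟨h, hg⟩ => ⟨⟨RadialKahler.mem_ConstGenScal_of_mem_KE h _,
        RadialKahler.mem_KRS_of_mem_KE h⟩, hg⟩⟩
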